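/- For $R\ge 1$ let $\Pi_R=\{(x_1,x_2,x_3)\in\mathbb{R}^3 : x_1^2+x_2^2+x_3^2/R^2<1\}$, let $\nu$ and $dS$ be the outward unit normal and the surface measure on $\partial\Pi_R$, and let $H^{1/2}(\partial\Pi_R)$ be the Sobolev space of complex-valued functions $\varphi\in L^2(\partial\Pi_R)$ with $$\|\varphi\|_{H^{1/2}}^2=\int_{\partial\Pi_R}|\varphi|^2\,dS+\int_{\partial\Pi_R}\int_{\partial\Pi_R}\frac{|\varphi(x)-\varphi(y)|^2}{|x-y|^3}\,dS(x)\,dS(y)<\infty .$$ Let $\mathcal{K}_{\partial\Pi_R}$ be the Neumann–Poincaré operator on $\partial\Pi_R$, $$\mathcal{K}_{\partial\Pi_R}[\varphi](x)=\frac1{4\pi}\int_{\partial\Pi_R}\frac{\langle y-x,\nu(y)\rangle}{|x-y|^3}\,\varphi(y)\,dS(y),\qquad x\in\partial\Pi_R ,$$ and let $\sigma(\mathcal{K}_{\partial\Pi_R})\subset\mathbb{C}$ be its spectrum as a bounded linear operator on $H^{1/2}(\partial\Pi_R)$. **Theorem 1.2.** The operator $\mathcal{K}_{\partial\Pi_R}$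 is well defined and bounded on $H^{1/2}(\partial\Pi_R)$ for every $R\ge1$, and if $(R_j)$ is a sequence of real numbers with $R_j\ge 1$ for all $j$ and $R_j\to\infty$ as $j\to\infty$, then $$\overline{\bigcup_{j}\sigma(\mathcal{K}_{\partial\Pi_{R_j}})}=[0,1/2].$$ -/

import Mathlib

open MeasureTheory Set Filter Topology

noncomputable section

/-- Euclidean three-space `ℝ³`; its points are `(x 0, x 1, x 2)`. -/
abbrev E3 : Type := EuclideanSpace ℝ (Fin 3)

/-! ### Surface measure of a parametrized surface -/

/-- The area density `√(‖∂₁Φ‖² ‖∂₂Φ‖² - ⟨∂₁Φ, ∂₂Φ⟩²)` (that is, `‖∂₁Φ × ∂₂Φ‖`) of a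
parametrization `Φ` of a surface in `ℝ³`. -/
def areaDensity (Φ : ℝ × ℝ → E3) (p : ℝ × ℝ) : ℝ :=
  Real.sqrt (‖deriv (fun s => Φ (s, p.2)) p.1‖ ^ 2 * ‖deriv (fun t => Φ (p.1, t)) p.2‖ ^ 2
    - (inner ℝ (deriv (fun s => Φ (s, p.2)) p.1) (deriv (fun t => Φ (p.1, t)) p.2)) ^ 2)

/-- The surface measure `dS`, as a measure on `ℝ³`, of the surface parametrized by `Φ` on `U`:
`∫ f dS = ∫_U f(Φ(p)) ‖∂₁Φ(p) × ∂₂Φ(p)‖ dp`. -/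
def surfaceMeasure (Φ : ℝ × ℝ → E3) (U : Set (ℝ × ℝ)) : Measure E3 :=
  ((volume.restrict U).withDensity fun p => ENNReal.ofReal (areaDensity Φ p)).map Φ

instance surfaceMeasure.instSFinite (Φ : ℝ × ℝ → E3) (U : Set (ℝ × ℝ)) :
    SFinite (surfaceMeasure Φ U) := by
  unfold surfaceMeasure
  infer_instance

/-! ### The Sobolev space `H^{1/2}` of a surface -/

/-- The difference quotient `(f(x) - f(y)) / |x - y|^{3/2}`, whose squared `L²(σ × σ)` norm is the
Gagliardo seminorm `∫∫ |f(x) - f(y)|² / |x - y|³ dσ(x) dσ(y)`. -/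
def halfQuotient (f : E3 → ℂ) (z : E3 × E3) : ℂ :=
  (f z.1 - f z.2) / ((‖z.1 - z.2‖ ^ (3 / 2 : ℝ) : ℝ) : ℂ)

/-- The Sobolev space `H^{1/2}` of a surface in `ℝ³` with surface measure `σ`: the functions
`f ∈ L²(σ)` whose difference quotient lies in `L²(σ × σ)`. An element is stored as the pair
of `f` and its difference quotient (which `f` determines), so that the norm inherited
from `L²(σ) ⊕ L²(σ × σ)` is the usual one,
`‖f‖² = ∫ |f|² dσ + ∫∫ |f(x) - f(y)|² / |x - y|³ dσ(x) dσ(y)`. -/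
def HHalf (σ : Measure E3) [SFinite σ] :
    Submodule ℂ (WithLp 2 (Lp ℂ 2 σ × Lp ℂ 2 (σ.prod σ))) where
  carrier := {p | p.snd =ᵐ[σ.prod σ] halfQuotient p.fst}
  zero_mem' := by
    have h1 : ∀ᵐ z ∂σ.prod σ, (0 : Lp ℂ 2 σ) z.1 = 0 :=
      Measure.quasiMeasurePreserving_fst.ae (Lp.coeFn_zero ℂ 2 σ)
    have h2 : ∀ᵐ z ∂σ.prod σ, (0 : Lp ℂ 2 σ) z.2 = 0 :=
      Measure.quasiMeasurePreserving_snd.ae (Lp.coeFn_zero ℂ 2 σ)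
    have h3 := Lp.coeFn_zero ℂ 2 (σ.prod σ)
    simp only [mem_ofPred_eq, WithLp.zero_fst, WithLp.zero_snd]
    filter_upwards [h1, h2, h3] with z h1 h2 h3
    simp only [halfQuotient]
    rw [h1, h2, h3]
    simp
  add_mem' := by
    intro a b ha hb
    have h1 : ∀ᵐ z ∂σ.prod σ, (a.fst + b.fst : Lp ℂ 2 σ) z.1 = a.fst z.1 + b.fst z.1 :=
      Measure.quasiMeasurePreserving_fst.ae (Lp.coeFn_add a.fst b.fst)
    have h2 : ∀ᵐ z ∂σ.prod σ, (a.fst + b.fst : Lp ℂ 2 σ) z.2 = a.fst z.2 + b.fst z.2 :=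
      Measure.quasiMeasurePreserving_snd.ae (Lp.coeFn_add a.fst b.fst)
    have h3 := Lp.coeFn_add a.snd b.snd
    simp only [mem_ofPred_eq, WithLp.add_fst, WithLp.add_snd] at ha hb ⊢
    filter_upwards [h1, h2, h3, ha, hb] with z h1 h2 h3 ha hb
    simp only [halfQuotient] at ha hb ⊢
    rw [h1, h2, h3, Pi.add_apply, ha, hb]
    ring
  smul_mem' := by
    intro c a ha
    have h1 : ∀ᵐ z ∂σ.prod σ, (c • a.fst : Lp ℂ 2 σ) z.1 = c * a.fst z.1 :=
      Measure.quasiMeasurePreserving_fst.ae (Lp.coeFn_smul c a.fst)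
    have h2 : ∀ᵐ z ∂σ.prod σ, (c • a.fst : Lp ℂ 2 σ) z.2 = c * a.fst z.2 :=
      Measure.quasiMeasurePreserving_snd.ae (Lp.coeFn_smul c a.fst)
    have h3 := Lp.coeFn_smul c a.snd
    simp only [mem_ofPred_eq, WithLp.smul_fst, WithLp.smul_snd] at ha ⊢
    filter_upwards [h1, h2, h3, ha] with z h1 h2 h3 ha
    simp only [halfQuotient] at ha ⊢
    rw [h1, h2, h3, Pi.smul_apply, ha, smul_eq_mul]
    ring

/-- The `L²` function underlying an element of `H^{1/2}`. -/
def HHalf.toLp {σ : Measure E3} [SFinite σ] (f : HHalf σ) : Lp ℂ 2 σ := f.1.fst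

/-- An element of `H^{1/2}` is determined by its underlying function. -/
theorem HHalf.toLp_injective {σ : Measure E3} [SFinite σ] :
    Function.Injective (HHalf.toLp (σ := σ)) := by
  rintro ⟨a, ha⟩ ⟨b, hb⟩ h
  have h' : a.fst = b.fst := h
  have h2 : a.snd = b.snd := by
    apply Lp.ext
    have ha' : a.snd =ᵐ[σ.prod σ] halfQuotient a.fst := ha
    have hb' : b.snd =ᵐ[σ.prod σ] halfQuotient b.fst := hb
    rw [h'] at ha'
    exact ha'.trans hb'.symm
  exact Subtype.ext ((WithLp.equiv 2 _).injective (Prod.ext h' h2))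

/-! ### The Neumann–Poincaré operator -/

/-- The kernel `⟨y - x, ν(y)⟩ / (4π |x - y|³)` of the double layer potential, where `ν` is the
outward unit normal. -/
def npKernel (ν : E3 → E3) (x y : E3) : ℝ :=
  1 / (4 * Real.pi) * (inner ℝ (y - x) (ν y) / ‖x - y‖ ^ 3)

/-- `K` is the Neumann–Poincaré operator on `H^{1/2}` of the surface with surface measure `σ` and
outward unit normal `ν`: `(K f)(x) = ∫ ⟨y - x, ν(y)⟩ / (4π |x - y|³) f(y) dσ(y)` for almost every
`x`, the integral being absolutely convergent. -/
def IsNPOperator (σ : Measure E3) [SFinite σ] (ν : E3 → E3) (K : HHalf σ →L[ℂ] HHalf σ) : Prop :=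
  ∀ f : HHalf σ, ∀ᵐ x ∂σ,
    Integrable (fun y => (npKernel ν x y : ℂ) * HHalf.toLp f y) σ ∧
      HHalf.toLp (K f) x = ∫ y, (npKernel ν x y : ℂ) * HHalf.toLp f y ∂σ

/-- There is at most one Neumann–Poincaré operator on `H^{1/2}`. -/
theorem IsNPOperator.unique {σ : Measure E3} [SFinite σ] {ν : E3 → E3}
    {K K' : HHalf σ →L[ℂ] HHalf σ} (h : IsNPOperator σ ν K) (h' : IsNPOperator σ ν K') :
    K = K' := by
  ext1 f
  apply HHalf.toLp_injective
  apply Lp.ext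
  filter_upwards [h f, h' f] with x hx hx'
  rw [hx.2, hx'.2]

/-! ### Prolate spheroids -/

/-- The quadratic form `x₁² + x₂² + x₃²/R²`. -/
def prolateForm (R : ℝ) (x : E3) : ℝ := x 0 ^ 2 + x 1 ^ 2 + x 2 ^ 2 / R ^ 2

/-- The prolate spheroid `Π_R = {x₁² + x₂² + x₃²/R² < 1}`. -/
def prolateSpheroid (R : ℝ) : Set E3 := {x | prolateForm R x < 1}

/-- The outward unit normal of `∂Π_R`: the normalized gradient of its defining function. -/
def prolateNormal (R : ℝ) (y : E3) : E3 :=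
  ‖gradient (prolateForm R) y‖⁻¹ • gradient (prolateForm R) y

/-- The parametrization `(θ, t) ↦ (η cos θ, η sin θ, t)`, `η = √(1 - t²/R²)`, of `∂Π_R`. -/
def prolateParam (R : ℝ) (p : ℝ × ℝ) : E3 :=
  !₂[Real.sqrt (1 - p.2 ^ 2 / R ^ 2) * Real.cos p.1,
    Real.sqrt (1 - p.2 ^ 2 / R ^ 2) * Real.sin p.1, p.2]

/-- The surface measure of `∂Π_R`. The parametrization is one-to-one on `(-π, π) × (-R, R)`, and
it misses only one meridian with its end points, a set of zero area. -/
abbrev prolateMeasure (R : ℝ) : Measure E3 :=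
  surfaceMeasure (prolateParam R) (Ioo (-Real.pi) Real.pi ×ˢ Ioo (-R) R)

/-- The parametrization, on the closed rectangle, covers exactly the boundary of `Π_R`. -/
theorem image_prolateParam {R : ℝ} (hR : 1 ≤ R) :
    prolateParam R '' (Icc (-Real.pi) Real.pi ×ˢ Icc (-R) R) = frontier (prolateSpheroid R) := by
  have hR0 : 0 < R := by linarith
  have hR2 : 0 < R ^ 2 := by positivity
  have hc : Continuous (prolateForm R) := by unfold prolateForm; fun_prop
  have hfr : frontier (prolateSpheroid R) = {x | prolateForm R x = 1} := by
    apply Subset.antisymm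
    · exact frontier_lt_subset_eq hc continuous_const
    · intro x hx
      have hx1 : prolateForm R x = 1 := hx
      have hopen : IsOpen (prolateSpheroid R) := isOpen_lt hc continuous_const
      rw [hopen.frontier_eq]
      refine ⟨?_, fun h => ?_⟩
      · have ht : Tendsto (fun s : ℝ => s • x) (𝓝[<] 1) (𝓝 x) := by
          have : Tendsto (fun s : ℝ => s • x) (𝓝 1) (𝓝 ((1 : ℝ) • x)) :=
            (continuous_id.smul continuous_const).tendsto 1
          rw [one_smul] at this
          exact this.mono_left nhdsWithin_le_nhds
        refine mem_closure_of_tendsto ht ?_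
        filter_upwards [Ioo_mem_nhdsLT (show (0 : ℝ) < 1 by norm_num)] with s hs
        have : prolateForm R (s • x) = s ^ 2 * prolateForm R x := by
          simp only [prolateForm, PiLp.smul_apply, smul_eq_mul]; ring
        show prolateForm R (s • x) < 1
        rw [this, hx1]
        nlinarith [hs.1, hs.2]
      · have : prolateForm R x < 1 := h
        linarith
  rw [hfr]
  ext x
  constructor
  · rintro ⟨⟨a, t⟩, ⟨_, ht⟩, rfl⟩
    have h1 : t ^ 2 / R ^ 2 ≤ 1 := by
      rw [div_le_one hR2]
      exact sq_le_sq' ht.1 ht.2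
    have h2 := Real.sq_sqrt (sub_nonneg.2 h1)
    have h3 := Real.sin_sq_add_cos_sq a
    simp only [mem_ofPred_eq, prolateForm, prolateParam]
    simp
    rw [mul_pow, mul_pow, h2]
    linear_combination (1 - t ^ 2 / R ^ 2) * h3
  · intro hx
    have hx1 : x 0 ^ 2 + x 1 ^ 2 + x 2 ^ 2 / R ^ 2 = 1 := hx
    set z : ℂ := ⟨x 0, x 1⟩ with hz
    have hn : Real.sqrt (1 - x 2 ^ 2 / R ^ 2) = ‖z‖ := by
      rw [Complex.norm_def, Complex.normSq_mk]
      congr 1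
      linarith
    refine ⟨(z.arg, x 2), ⟨⟨(Complex.neg_pi_lt_arg z).le, Complex.arg_le_pi z⟩, ?_⟩, ?_⟩
    · refine abs_le.1 (sq_le_sq₀ (abs_nonneg _) hR0.le |>.1 ?_)
      rw [sq_abs, ← div_le_one hR2]
      nlinarith [sq_nonneg (x 0), sq_nonneg (x 1)]
    · ext i
      fin_cases i
      · simp [prolateParam, hn, Complex.norm_mul_cos_arg, hz]
      · simp [prolateParam, hn, Complex.norm_mul_sin_arg, hz]
      · simp [prolateParam]

end

/-! Write q for `prolateForm R` and n for half its gradient. Two facts about ∂Π_R drive everything.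
In the coordinates (θ, t) the surface measure is |n| dθ dt. For x, y on the surface, polarization of
q gives ⟨y - x, n(y)⟩ = q(x - y)/2. Hence, relative to dθ dt, the Neumann–Poincaré operator has the
symmetric nonnegative kernel q(x - y)/(8π|x - y|³) (`npKernel_mul_gradLength`), and it can be
studied on L²(dθ dt), whose norm is equivalent to that of L²(dS).

Boundedness and reduction to L². The kernel has homogeneity -1 and is Hölder of order 3/4 in x at
the cost of |x - z|^(-7/4), which is still integrable on a surface. Since 3/4 > 1/2, the potential
maps L² boundedly into H^{1/2} (`exists_lintegral_halfQuotient_layerPotential_le`). The operator on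
H^{1/2} is therefore a product PE, with E the embedding into L² and P the potential, while EP is the
symmetrized operator on L². The two products have the same nonzero spectrum
(`mem_spectrum_npOperator`).

Upper inclusion. The kernel integrates to at most 1/2, because a point of a convex surface sees the
surface within a half-space (`lintegral_conic_le`, `lintegral_symKernel_le`); Schur's test gives
norm at most 1/2. The operator is also positive: q(v)/|v|³ is a nonnegative combination of the
second derivatives ∂ᵢ²|v|, each of which is a superposition of products φ(x)φ(y) of Gaussian
features (`integral_featureWeight`, `isPositive_symOperator`). So the spectrum lies in [0, 1/2].

Density. As R → ∞ the spheroid looks like the infinite cylinder, whose kernel is a convolution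
kernel with total mass exactly 1/2. The waves exp(iξt) are its eigenfunctions, with eigenvalue
`cylSymbol ξ`, which is continuous, equals 1/2 at ξ = 0 and tends to 0 by Riemann–Lebesgue; it thus
takes every value in (0, 1/2). A wave truncated to |t| < L has squared norm 4πL, while truncation
costs a squared error bounded independently of L, and replacing the cylinder by the spheroid costs
o(1) as R → ∞ for fixed L. It is therefore an approximate eigenfunction, and selfadjointness turns
it into a nearby point of the spectrum (`eventually_exists_mem_spectrum_near`). -/

/-! ### The spheroid in cylindrical coordinates -/

/-- The domain of the cylindrical coordinates `(θ, t)` of the spheroid. -/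
def cylinderDomain (R : ℝ) : Set (ℝ × ℝ) := Ioo (-Real.pi) Real.pi ×ˢ Ioo (-R) R

/-- The image of `dθ dt` on the spheroid: the surface measure divided by the length of half the
gradient of the defining function. -/
noncomputable def coneMeasure (R : ℝ) : Measure E3 :=
  (volume.restrict (cylinderDomain R)).map (prolateParam R)

/-- The Neumann–Poincaré kernel relative to `coneMeasure`, which is symmetric. -/
noncomputable def symKernel (R : ℝ) (x y : E3) : ℝ :=
  1 / (8 * Real.pi) * (prolateForm R (x - y) / ‖x - y‖ ^ 3)

/-- Half the length of the gradient of the defining function of the spheroid. -/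
noncomputable def gradLength (R : ℝ) (x : E3) : ℝ :=
  Real.sqrt (x 0 ^ 2 + x 1 ^ 2 + x 2 ^ 2 / R ^ 4)

theorem measurableSet_cylinderDomain (R : ℝ) : MeasurableSet (cylinderDomain R) :=
  measurableSet_Ioo.prod measurableSet_Ioo

theorem E3.norm_sq (x : E3) : ‖x‖ ^ 2 = x 0 ^ 2 + x 1 ^ 2 + x 2 ^ 2 := by
  rw [EuclideanSpace.norm_sq_eq, Fin.sum_univ_three]
  simp

theorem E3.inner_eq (x y : E3) : inner ℝ x y = x 0 * y 0 + x 1 * y 1 + x 2 * y 2 := by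
  simp [PiLp.inner_apply, Fin.sum_univ_three, mul_comm]

theorem E3.hasDerivAt_iff {f : ℝ → E3} {v : E3} {t : ℝ} :
    HasDerivAt f v t ↔ ∀ i, HasDerivAt (fun s => f s i) (v i) t := by
  simp only [hasDerivAt_iff_hasFDerivAt]
  rw [← hasFDerivWithinAt_univ, hasFDerivWithinAt_euclidean]
  simp only [hasFDerivWithinAt_univ]
  refine forall_congr' fun i => iff_of_eq (congrArg (fun L => HasFDerivAt _ L t) ?_)
  ext
  simp

theorem continuous_prolateForm (R : ℝ) : Continuous (prolateForm R) := by
  unfold prolateForm; fun_prop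

theorem continuous_gradLength (R : ℝ) : Continuous (gradLength R) := by
  unfold gradLength; fun_prop

theorem continuous_prolateParam (R : ℝ) : Continuous (prolateParam R) := by
  unfold prolateParam
  refine (PiLp.continuous_toLp 2 _).comp (continuous_pi fun i => ?_)
  fin_cases i
  · show Continuous fun p : ℝ × ℝ => Real.sqrt (1 - p.2 ^ 2 / R ^ 2) * Real.cos p.1
    fun_prop
  · show Continuous fun p : ℝ × ℝ => Real.sqrt (1 - p.2 ^ 2 / R ^ 2) * Real.sin p.1
    fun_prop
  · show Continuous fun p : ℝ × ℝ => p.2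
    fun_prop

@[simp] theorem prolateParam_zero (R : ℝ) (p : ℝ × ℝ) :
    prolateParam R p 0 = Real.sqrt (1 - p.2 ^ 2 / R ^ 2) * Real.cos p.1 := rfl

@[simp] theorem prolateParam_one (R : ℝ) (p : ℝ × ℝ) :
    prolateParam R p 1 = Real.sqrt (1 - p.2 ^ 2 / R ^ 2) * Real.sin p.1 := rfl

@[simp] theorem prolateParam_two (R : ℝ) (p : ℝ × ℝ) : prolateParam R p 2 = p.2 := rfl

theorem measurable_symKernel (R : ℝ) : Measurable fun z : E3 × E3 => symKernel R z.1 z.2 := by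
  have := (continuous_prolateForm R).measurable
  unfold symKernel
  fun_prop

theorem prolateForm_nonneg (R : ℝ) (x : E3) : 0 ≤ prolateForm R x := by
  unfold prolateForm; positivity

theorem prolateForm_neg (R : ℝ) (x : E3) : prolateForm R (-x) = prolateForm R x := by
  simp [prolateForm]

theorem symKernel_nonneg (R : ℝ) (x y : E3) : 0 ≤ symKernel R x y := by
  have := prolateForm_nonneg R (x - y)
  have := Real.pi_pos
  unfold symKernel; positivity

theorem symKernel_comm (R : ℝ) (x y : E3) : symKernel R x y = symKernel R y x := by
  unfold symKernel
  rw [← neg_sub y x, prolateForm_neg, norm_neg]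

theorem prolateForm_le_norm_sq {R : ℝ} (hR : 1 ≤ R) (x : E3) : prolateForm R x ≤ ‖x‖ ^ 2 := by
  rw [E3.norm_sq, prolateForm]
  have : x 2 ^ 2 / R ^ 2 ≤ x 2 ^ 2 := div_le_self (sq_nonneg _) (one_le_pow₀ hR)
  linarith

theorem norm_sq_le_prolateForm {R : ℝ} (hR : 1 ≤ R) (x : E3) :
    ‖x‖ ^ 2 ≤ R ^ 2 * prolateForm R x := by
  rw [E3.norm_sq, prolateForm]
  have hR2 : 1 ≤ R ^ 2 := one_le_pow₀ hR
  have : R ^ 2 * (x 0 ^ 2 + x 1 ^ 2 + x 2 ^ 2 / R ^ 2) = R ^ 2 * (x 0 ^ 2 + x 1 ^ 2) + x 2 ^ 2 := by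
    field_simp
  rw [this]
  nlinarith [sq_nonneg (x 0), sq_nonneg (x 1)]

theorem prolateForm_prolateParam {R : ℝ} {p : ℝ × ℝ} (hp : p ∈ cylinderDomain R) :
    prolateForm R (prolateParam R p) = 1 := by
  obtain ⟨-, h1, h2⟩ := hp
  have hR : 0 < R := by linarith
  have h : 0 ≤ 1 - p.2 ^ 2 / R ^ 2 := by
    rw [sub_nonneg, div_le_one (by positivity)]
    nlinarith
  simp only [prolateForm, prolateParam_zero, prolateParam_one, prolateParam_two, mul_pow,
    Real.sq_sqrt h]
  linear_combination (1 - p.2 ^ 2 / R ^ 2) * Real.sin_sq_add_cos_sq p.1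

theorem ae_coneMeasure_iff {R : ℝ} {P : E3 → Prop} (hP : MeasurableSet {x | P x}) :
    (∀ᵐ x ∂coneMeasure R, P x) ↔
      ∀ᵐ p ∂volume.restrict (cylinderDomain R), P (prolateParam R p) :=
  ae_map_iff (continuous_prolateParam R).aemeasurable hP

theorem ae_coneMeasure_prolateForm (R : ℝ) : ∀ᵐ x ∂coneMeasure R, prolateForm R x = 1 := by
  have hP : MeasurableSet {x | prolateForm R x = 1} :=
    ((isClosed_singleton (x := (1 : ℝ))).preimage (continuous_prolateForm R)).measurableSet
  rw [ae_coneMeasure_iff hP]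
  filter_upwards [ae_restrict_mem (measurableSet_cylinderDomain R)] with p hp
  exact prolateForm_prolateParam hp

theorem lintegral_coneMeasure (R : ℝ) {f : E3 → ENNReal} (hf : Measurable f) :
    ∫⁻ x, f x ∂coneMeasure R = ∫⁻ p in cylinderDomain R, f (prolateParam R p) :=
  lintegral_map hf (continuous_prolateParam R).measurable

instance coneMeasure.instIsFiniteMeasure (R : ℝ) : IsFiniteMeasure (coneMeasure R) := by
  have : IsFiniteMeasure (volume.restrict (cylinderDomain R) : Measure (ℝ × ℝ)) := by
    refine ⟨?_⟩
    rw [Measure.restrict_apply_univ, cylinderDomain, Measure.volume_eq_prod, Measure.prod_prod]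
    simp [ENNReal.mul_lt_top]
  unfold coneMeasure
  infer_instance

theorem sqrt_pos_of_mem_cylinderDomain {R : ℝ} {p : ℝ × ℝ} (hp : p ∈ cylinderDomain R) :
    0 < 1 - p.2 ^ 2 / R ^ 2 := by
  obtain ⟨-, h1, h2⟩ := hp
  have hR : 0 < R := by linarith
  rw [sub_pos, div_lt_one (by positivity)]
  nlinarith

theorem hasDerivAt_profile {R t : ℝ} (ht : 0 < 1 - t ^ 2 / R ^ 2) :
    HasDerivAt (fun t : ℝ => Real.sqrt (1 - t ^ 2 / R ^ 2))
      (-(t / R ^ 2) / Real.sqrt (1 - t ^ 2 / R ^ 2)) t := by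
  have h : HasDerivAt (fun t : ℝ => 1 - t ^ 2 / R ^ 2) (-(2 * t / R ^ 2)) t := by
    simpa using (((hasDerivAt_id t).pow 2).div_const (R ^ 2)).const_sub 1
  convert h.sqrt ht.ne' using 1
  field_simp

theorem hasDerivAt_prolateParam_fst (R : ℝ) (p : ℝ × ℝ) :
    HasDerivAt (fun s => prolateParam R (s, p.2))
      (!₂[-(Real.sqrt (1 - p.2 ^ 2 / R ^ 2) * Real.sin p.1),
        Real.sqrt (1 - p.2 ^ 2 / R ^ 2) * Real.cos p.1, 0] : E3) p.1 := by
  rw [E3.hasDerivAt_iff]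
  intro i
  fin_cases i
  · simpa using (Real.hasDerivAt_cos p.1).const_mul (Real.sqrt (1 - p.2 ^ 2 / R ^ 2))
  · simpa using (Real.hasDerivAt_sin p.1).const_mul (Real.sqrt (1 - p.2 ^ 2 / R ^ 2))
  · simpa using hasDerivAt_const p.1 p.2

theorem hasDerivAt_prolateParam_snd {R : ℝ} {p : ℝ × ℝ} (hp : p ∈ cylinderDomain R) :
    HasDerivAt (fun t => prolateParam R (p.1, t))
      (!₂[-(p.2 / R ^ 2) / Real.sqrt (1 - p.2 ^ 2 / R ^ 2) * Real.cos p.1,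
        -(p.2 / R ^ 2) / Real.sqrt (1 - p.2 ^ 2 / R ^ 2) * Real.sin p.1, 1] : E3) p.2 := by
  have h := hasDerivAt_profile (sqrt_pos_of_mem_cylinderDomain hp)
  rw [E3.hasDerivAt_iff]
  intro i
  fin_cases i
  · simpa using h.mul_const (Real.cos p.1)
  · simpa using h.mul_const (Real.sin p.1)
  · simpa using hasDerivAt_id' p.2

/-- The coordinate directions are orthogonal, so the density is the product of the two lengths: η²(1
+ t²/(R⁴η²)) = η² + t²/R⁴ under the root. -/
theorem areaDensity_prolateParam {R : ℝ} {p : ℝ × ℝ} (hp : p ∈ cylinderDomain R) :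
    areaDensity (prolateParam R) p = gradLength R (prolateParam R p) := by
  have h := sqrt_pos_of_mem_cylinderDomain hp
  have hs := Real.sq_sqrt h.le
  have hs0 := Real.sqrt_pos.2 h
  unfold areaDensity gradLength
  rw [(hasDerivAt_prolateParam_fst R p).deriv, (hasDerivAt_prolateParam_snd hp).deriv,
    E3.norm_sq, E3.norm_sq, E3.inner_eq]
  congr 1
  simp only [prolateParam_zero, prolateParam_one, prolateParam_two]
  simp
  set η := Real.sqrt (1 - p.2 ^ 2 / R ^ 2)
  have hc := Real.sin_sq_add_cos_sq p.1
  set S := Real.sin p.1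
  set C := Real.cos p.1
  have hC : C ^ 2 = 1 - S ^ 2 := by linarith
  field_simp
  rw [add_comm (C ^ 2), hc]
  ring

theorem hasGradientAt_prolateForm (R : ℝ) (y : E3) :
    HasGradientAt (prolateForm R) (!₂[2 * y 0, 2 * y 1, 2 * y 2 / R ^ 2] : E3) y := by
  rw [hasGradientAt_iff_hasFDerivAt]
  have h : ∀ i : Fin 3, HasFDerivAt (fun x : E3 => x i)
      (EuclideanSpace.proj i : E3 →L[ℝ] ℝ) y :=
    fun i => (EuclideanSpace.proj i : E3 →L[ℝ] ℝ).hasFDerivAt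
  have := (((h 0).pow 2).add ((h 1).pow 2)).add (((h 2).pow 2).mul_const (R ^ 2)⁻¹)
  refine this.congr_fderiv ?_ |>.congr_of_eventuallyEq ?_
  · ext v
    simp [InnerProductSpace.toDual_apply_apply, E3.inner_eq]
    ring
  · exact Eventually.of_forall fun x => by simp [prolateForm, div_eq_mul_inv]

theorem norm_gradient_prolateForm (R : ℝ) (y : E3) :
    ‖gradient (prolateForm R) y‖ = 2 * gradLength R y := by
  rw [(hasGradientAt_prolateForm R y).gradient, gradLength, ← Real.sqrt_sq (norm_nonneg _),
    E3.norm_sq, show (2 : ℝ) = Real.sqrt (2 ^ 2) by rw [Real.sqrt_sq]; norm_num,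
    ← Real.sqrt_mul (by norm_num)]
  congr 1
  simp
  ring

theorem gradLength_pos {R : ℝ} (hR : 1 ≤ R) {x : E3} (hx : prolateForm R x = 1) :
    1 / R ≤ gradLength R x := by
  have hR0 : 0 < R := by linarith
  unfold gradLength
  unfold prolateForm at hx
  apply Real.le_sqrt_of_sq_le
  have h1 : x 2 ^ 2 / R ^ 4 = x 2 ^ 2 / R ^ 2 / R ^ 2 := by field_simp
  have h2 : (1 / R) ^ 2 = 1 / R ^ 2 := by field_simp
  rw [h1, h2, ← hx]
  have h3 : (x 0 ^ 2 + x 1 ^ 2 + x 2 ^ 2 / R ^ 2) / R ^ 2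
    = (x 0 ^ 2 + x 1 ^ 2) / R ^ 2 + x 2 ^ 2 / R ^ 2 / R ^ 2 := by ring
  rw [h3]
  gcongr
  exact div_le_self (by positivity) (one_le_pow₀ hR)

theorem gradLength_le_one {R : ℝ} (hR : 1 ≤ R) {x : E3} (hx : prolateForm R x = 1) :
    gradLength R x ≤ 1 := by
  have hR0 : 0 < R := by linarith
  unfold gradLength
  unfold prolateForm at hx
  rw [Real.sqrt_le_one, ← hx]
  have h1 : x 2 ^ 2 / R ^ 4 = x 2 ^ 2 / R ^ 2 / R ^ 2 := by field_simp
  rw [h1]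
  gcongr
  exact div_le_self (by positivity) (one_le_pow₀ hR)

/-- `⟨y - x, ν(y)⟩` is, up to the length of the gradient, a symmetric function of `x` and `y`. -/
theorem npKernel_mul_gradLength {R : ℝ} (hR : 1 ≤ R) {x y : E3} (hx : prolateForm R x = 1)
    (hy : prolateForm R y = 1) :
    npKernel (prolateNormal R) x y * gradLength R y = symKernel R x y := by
  have hR0 : 0 < R := by linarith
  have hg : 0 < gradLength R y := lt_of_lt_of_le (by positivity) (gradLength_pos hR hy)
  unfold npKernel symKernel prolateNormal
  rw [inner_smul_right, norm_gradient_prolateForm, (hasGradientAt_prolateForm R y).gradient,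
    E3.inner_eq]
  -- In general the left side is q(x - y) + q(y) - q(x), with q the quadratic form; on the surface
  -- the last two terms cancel.
  have key : (y - x) 0 * (2 * y 0) + (y - x) 1 * (2 * y 1) + (y - x) 2 * (2 * y 2 / R ^ 2)
      = prolateForm R (x - y) := by
    unfold prolateForm at *
    simp only [PiLp.sub_apply]
    linear_combination hy - hx
  simp only [Matrix.cons_val_zero, Matrix.cons_val_one, Matrix.cons_val]
  rw [key]
  field_simp
  ring

/-! ### Comparison of the two measures -/

theorem prolateMeasure_eq_withDensity (R : ℝ) :
    prolateMeasure R = (coneMeasure R).withDensity fun x => ENNReal.ofReal (gradLength R x) := by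
  have hm : Measurable fun x => ENNReal.ofReal (gradLength R x) :=
    (continuous_gradLength R).measurable.ennreal_ofReal
  ext s hs
  have hΦ := (continuous_prolateParam R).measurable
  rw [prolateMeasure, surfaceMeasure, Measure.map_apply hΦ hs, withDensity_apply _ (hΦ hs),
    withDensity_apply _ hs, coneMeasure, setLIntegral_map hs hm hΦ]
  refine lintegral_congr_ae ?_
  filter_upwards [ae_restrict_of_ae (ae_restrict_mem (measurableSet_cylinderDomain R))] with p hp
  rw [areaDensity_prolateParam hp]

/-- On the surface the density `gradLength` lies in [1/R, 1]. This bound and `coneMeasure_le` make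
the two L² norms equivalent, so the reference measure that symmetrizes the kernel may be used
throughout. -/
theorem prolateMeasure_le (R : ℝ) (hR : 1 ≤ R) : prolateMeasure R ≤ coneMeasure R := by
  rw [prolateMeasure_eq_withDensity]
  conv_rhs => rw [← withDensity_one (μ := coneMeasure R)]
  refine withDensity_mono ?_
  filter_upwards [ae_coneMeasure_prolateForm R] with x hx
  exact ENNReal.ofReal_le_one.2 (gradLength_le_one hR hx)

theorem coneMeasure_le (R : ℝ) (hR : 1 ≤ R) :
    coneMeasure R ≤ ENNReal.ofReal R • prolateMeasure R := by
  have hR0 : 0 < R := by linarith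
  have hm : Measurable fun x => ENNReal.ofReal (gradLength R x) :=
    (continuous_gradLength R).measurable.ennreal_ofReal
  rw [prolateMeasure_eq_withDensity, ← withDensity_smul _ hm]
  conv_lhs => rw [← withDensity_one (μ := coneMeasure R)]
  refine withDensity_mono ?_
  filter_upwards [ae_coneMeasure_prolateForm R] with x hx
  simp only [Pi.one_apply, Pi.smul_apply, smul_eq_mul]
  rw [← ENNReal.ofReal_mul hR0.le, ENNReal.one_le_ofReal]
  calc (1 : ℝ) = R * (1 / R) := by field_simp
    _ ≤ _ := by gcongr; exact gradLength_pos hR hx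

theorem coneMeasure_absolutelyContinuous {R : ℝ} (hR : 1 ≤ R) :
    coneMeasure R ≪ prolateMeasure R :=
  Measure.absolutelyContinuous_of_le_smul (coneMeasure_le R hR)

theorem prolateMeasure_absolutelyContinuous {R : ℝ} (hR : 1 ≤ R) :
    prolateMeasure R ≪ coneMeasure R :=
  Measure.absolutelyContinuous_of_le (prolateMeasure_le R hR)

/-- Integrals against the Neumann–Poincaré kernel in terms of the symmetric kernel. -/
theorem npKernel_integral {R : ℝ} (hR : 1 ≤ R) {x : E3} (hx : prolateForm R x = 1)
    (f : E3 → ℂ) :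
    (Integrable (fun y => (npKernel (prolateNormal R) x y : ℂ) * f y) (prolateMeasure R) ↔
      Integrable (fun y => (symKernel R x y : ℂ) * f y) (coneMeasure R)) ∧
    ∫ y, (npKernel (prolateNormal R) x y : ℂ) * f y ∂prolateMeasure R
      = ∫ y, (symKernel R x y : ℂ) * f y ∂coneMeasure R := by
  have hm : Measurable fun x => (gradLength R x).toNNReal :=
    (continuous_gradLength R).measurable.real_toNNReal
  have h : (fun y => (gradLength R y).toNNReal • ((npKernel (prolateNormal R) x y : ℂ) * f y))
      =ᵐ[coneMeasure R] fun y => (symKernel R x y : ℂ) * f y := by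
    filter_upwards [ae_coneMeasure_prolateForm R] with y hy
    rw [← npKernel_mul_gradLength hR hx hy, NNReal.smul_def,
      Real.coe_toNNReal _ (by unfold gradLength; positivity), Complex.real_smul]
    push_cast
    ring
  rw [prolateMeasure_eq_withDensity]
  constructor
  · exact (integrable_withDensity_iff_integrable_smul hm).trans (integrable_congr h)
  · exact (integral_withDensity_eq_integral_smul hm _).trans (integral_congr_ae h)

/-! ### Lebesgue measure on `ℝ³` -/

theorem E3.measurePreserving_coord :
    MeasurePreserving (fun w : ℝ × ℝ × ℝ => (!₂[w.1, w.2.1, w.2.2] : E3)) volume volume := by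
  have h1 := (EuclideanSpace.volume_preserving_symm_measurableEquiv_toLp (Fin 3)).symm
  have h2 := (volume_preserving_piFinSuccAbove (fun _ : Fin 3 => ℝ) 0).symm
  have h3 : MeasurePreserving (Prod.map id (MeasurableEquiv.piFinTwo fun _ : Fin 2 => ℝ).symm)
      (volume : Measure (ℝ × ℝ × ℝ)) (volume : Measure (ℝ × (Fin 2 → ℝ))) :=
    (MeasurePreserving.id volume).prod (volume_preserving_piFinTwo fun _ : Fin 2 => ℝ).symm
  have h := h1.comp (h2.comp h3)
  have e : (fun w : ℝ × ℝ × ℝ => (!₂[w.1, w.2.1, w.2.2] : E3)) =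
      (MeasurableEquiv.toLp 2 (Fin 3 → ℝ)).symm.symm ∘
        (MeasurableEquiv.piFinSuccAbove (fun _ : Fin 3 => ℝ) 0).symm ∘
          Prod.map id (MeasurableEquiv.piFinTwo fun _ : Fin 2 => ℝ).symm := by
    funext w
    ext i
    fin_cases i
    exacts [rfl, rfl, rfl]
  exact e ▸ h

/-- Fubini's theorem for `ℝ³`. -/
theorem E3.lintegral_eq {g : E3 → ENNReal} (hg : Measurable g) :
    ∫⁻ w, g w = ∫⁻ p : ℝ × ℝ, ∫⁻ r : ℝ, g !₂[r, p.1, p.2] := by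
  have h := E3.measurePreserving_coord
  rw [← h.lintegral_comp hg, Measure.volume_eq_prod]
  exact lintegral_prod_symm _ (hg.comp h.measurable).aemeasurable

theorem E3.hasFDerivAt_iff {f : E3 → E3} {L : E3 →L[ℝ] E3} {w : E3} :
    HasFDerivAt f L w ↔ ∀ i, HasFDerivAt (fun s => f s i) ((EuclideanSpace.proj i) ∘L L) w := by
  rw [← hasFDerivWithinAt_univ, hasFDerivWithinAt_euclidean]
  simp only [hasFDerivWithinAt_univ]

/-! ### Polar coordinates centred at a point of the spheroid -/

/-- Half the gradient of the defining function of the spheroid. -/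
noncomputable def conormal (R : ℝ) (x : E3) : E3 := !₂[x 0, x 1, x 2 / R ^ 2]

theorem norm_conormal (R : ℝ) (x : E3) : ‖conormal R x‖ = gradLength R x := by
  rw [gradLength, ← Real.sqrt_sq (norm_nonneg (conormal R x)), E3.norm_sq]
  congr 1
  simp [conormal]
  ring

theorem inner_conormal (R : ℝ) (x z : E3) :
    inner ℝ (conormal R x) z = x 0 * z 0 + x 1 * z 1 + x 2 * z 2 / R ^ 2 := by
  rw [E3.inner_eq]
  simp [conormal]
  ring

/-- This is convexity in quantitative form: the surface lies on the inner side of the tangent plane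
at x, at a depth governed by the quadratic form of y - x. -/
theorem inner_conormal_sub {R : ℝ} {x y : E3} (hx : prolateForm R x = 1)
    (hy : prolateForm R y = 1) :
    inner ℝ (conormal R x) (y - x) = -(prolateForm R (y - x) / 2) := by
  rw [inner_conormal]
  unfold prolateForm at *
  simp only [PiLp.sub_apply]
  linear_combination (-1 / 2 : ℝ) * hx + (1 / 2 : ℝ) * hy

theorem prolateForm_smul (R r : ℝ) (x : E3) : prolateForm R (r • x) = r ^ 2 * prolateForm R x := by
  simp only [prolateForm, PiLp.smul_apply, smul_eq_mul]
  ring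

theorem prolateForm_pos {R : ℝ} (hR : 1 ≤ R) {x : E3} (hx : x ≠ 0) : 0 < prolateForm R x := by
  have h1 := norm_sq_le_prolateForm hR x
  have h2 : 0 < ‖x‖ ^ 2 := by positivity
  by_contra h
  nlinarith [sq_nonneg R]

theorem injOn_prolateParam (R : ℝ) : InjOn (prolateParam R) (cylinderDomain R) := by
  rintro ⟨a, s⟩ hp ⟨b, t⟩ hq h
  have hst : s = t := by simpa using congrArg (fun x : E3 => x 2) h
  subst hst
  have hpos := Real.sqrt_pos.2 (sqrt_pos_of_mem_cylinderDomain hp)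
  have hc : Real.cos a = Real.cos b := by
    have := congrArg (fun x : E3 => x 0) h
    exact mul_left_cancel₀ hpos.ne' this
  have hs : Real.sin a = Real.sin b := by
    have := congrArg (fun x : E3 => x 1) h
    exact mul_left_cancel₀ hpos.ne' this
  have ha := Complex.arg_cos_add_sin_mul_I (Ioo_subset_Ioc_self hp.1)
  have hb := Complex.arg_cos_add_sin_mul_I (Ioo_subset_Ioc_self hq.1)
  rw [← Complex.ofReal_cos, ← Complex.ofReal_sin] at ha hb
  rw [hc, hs, hb] at ha
  exact Prod.ext ha.symm rfl

/-- The Jacobian matrix of `w ↦ w₀ (Φ(w₁, w₂) - x)`. -/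
noncomputable def conicJacobian (R : ℝ) (x w : E3) : Matrix (Fin 3) (Fin 3) ℝ :=
  let η := Real.sqrt (1 - w 2 ^ 2 / R ^ 2)
  let η' := -(w 2 / R ^ 2) / η
  !![η * Real.cos (w 1) - x 0, -(w 0 * (η * Real.sin (w 1))), w 0 * (η' * Real.cos (w 1));
    η * Real.sin (w 1) - x 1, w 0 * (η * Real.cos (w 1)), w 0 * (η' * Real.sin (w 1));
    w 2 - x 2, 0, w 0]

/-- The determinant is r² times the triple product of Φ - x, ∂θΦ and ∂tΦ. The cross product of the
tangent vectors is the conormal at Φ, and its pairing with Φ - x is half the quadratic form. -/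
theorem det_conicJacobian {R : ℝ} {x w : E3} (hx : prolateForm R x = 1)
    (hw : (w 1, w 2) ∈ cylinderDomain R) :
    (conicJacobian R x w).det
      = w 0 ^ 2 * (prolateForm R (prolateParam R (w 1, w 2) - x) / 2) := by
  have hy := prolateForm_prolateParam hw
  have h := sqrt_pos_of_mem_cylinderDomain hw
  have hs0 := Real.sqrt_pos.2 h
  have hR : R ≠ 0 := by
    rintro rfl
    have := hw.2
    simp at this
  have e1 : prolateForm R (prolateParam R (w 1, w 2) - x) / 2
      = inner ℝ (conormal R (prolateParam R (w 1, w 2))) (prolateParam R (w 1, w 2) - x) := by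
    have := inner_conormal_sub hy hx
    rw [← neg_sub x, inner_neg_right, this, neg_neg, prolateForm_neg]
  rw [e1, inner_conormal, Matrix.det_fin_three]
  simp only [conicJacobian, PiLp.sub_apply, prolateParam_zero, prolateParam_one, prolateParam_two]
  have hs := Real.sq_sqrt h.le
  simp only at hs hs0
  set η := Real.sqrt (1 - w 2 ^ 2 / R ^ 2)
  have hc := Real.sin_sq_add_cos_sq (w 1)
  simp
  set S := Real.sin (w 1)
  set C := Real.cos (w 1)
  have e2 : η * (w 2 / R ^ 2 / η) = w 2 / R ^ 2 := by field_simp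
  linear_combination (w 0 ^ 2 * (w 2 - x 2) * (w 2 / R ^ 2)) * hc +
    (w 0 ^ 2 * (w 2 - x 2) * (S ^ 2 + C ^ 2)) * e2

theorem hasFDerivAt_conic {R : ℝ} (x : E3) {w : E3} (hw : (w 1, w 2) ∈ cylinderDomain R) :
    HasFDerivAt (fun w : E3 => w 0 • (prolateParam R (w 1, w 2) - x))
      (Matrix.toEuclideanCLM (𝕜 := ℝ) (conicJacobian R x w)) w := by
  rw [E3.hasFDerivAt_iff]
  have h : ∀ i : Fin 3, HasFDerivAt (fun x : E3 => x i)
      (EuclideanSpace.proj i : E3 →L[ℝ] ℝ) w :=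
    fun i => (EuclideanSpace.proj i : E3 →L[ℝ] ℝ).hasFDerivAt
  have hη := (hasDerivAt_profile (sqrt_pos_of_mem_cylinderDomain hw)).comp_hasFDerivAt w (h 2)
  have hcos := (Real.hasDerivAt_cos (w 1)).comp_hasFDerivAt w (h 1)
  have hsin := (Real.hasDerivAt_sin (w 1)).comp_hasFDerivAt w (h 1)
  intro i
  fin_cases i
  · refine ((h 0).mul ((hη.mul hcos).sub_const (x 0))).congr_fderiv ?_
    ext v
    simp [conicJacobian, Matrix.mulVec, dotProduct, Fin.sum_univ_three]
    ring
  · refine ((h 0).mul ((hη.mul hsin).sub_const (x 1))).congr_fderiv ?_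
    ext v
    simp [conicJacobian, Matrix.mulVec, dotProduct, Fin.sum_univ_three]
    ring
  · refine ((h 0).mul ((h 2).sub_const (x 2))).congr_fderiv ?_
    ext v
    simp [conicJacobian, Matrix.mulVec, dotProduct, Fin.sum_univ_three]
    ring

theorem det_toEuclideanCLM (M : Matrix (Fin 3) (Fin 3) ℝ) :
    (Matrix.toEuclideanCLM (𝕜 := ℝ) M).det = M.det := by
  rw [ContinuousLinearMap.det, Matrix.coe_toEuclideanCLM_eq_toEuclideanLin,
    Matrix.toEuclideanLin_eq_toLin_orthonormal, LinearMap.det_toLin]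

/-- Integration in polar coordinates centred at a point `x` of the spheroid, which is seen from
`x` under the solid angle of a half-space. -/
theorem lintegral_conic_le {R : ℝ} (hR : 1 ≤ R) {x : E3} (hx : prolateForm R x = 1)
    {F : E3 → ENNReal} (hF : Measurable F) :
    ∫⁻ p in cylinderDomain R, ∫⁻ r in Ioi (0 : ℝ),
        ENNReal.ofReal (r ^ 2 * (prolateForm R (prolateParam R p - x) / 2)) *
          F (r • (prolateParam R p - x))
      ≤ ∫⁻ z in {z | inner ℝ (conormal R x) z < 0}, F z := by
  set G : E3 → E3 := fun w => w 0 • (prolateParam R (w 1, w 2) - x) with hG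
  have hcΦ := continuous_prolateParam R
  have hmG : Measurable G := by
    have : Continuous G := by fun_prop
    exact this.measurable
  -- Over a parameter with Φ = x the whole ray collapses to the origin. Removing it restores
  -- injectivity and loses nothing, since the Jacobian factor vanishes there.
  set D : Set E3 := {w | 0 < w 0 ∧ (w 1, w 2) ∈ cylinderDomain R ∧ prolateParam R (w 1, w 2) ≠ x}
    with hD
  have hmD : MeasurableSet D := by
    have h0 : MeasurableSet {w : E3 | 0 < w 0} := measurableSet_lt (by fun_prop) (by fun_prop)
    have h1 : MeasurableSet {w : E3 | (w 1, w 2) ∈ cylinderDomain R} :=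
      (show Measurable fun w : E3 => (w 1, w 2) by fun_prop) (measurableSet_cylinderDomain R)
    have h2 : MeasurableSet {w : E3 | prolateParam R (w 1, w 2) ≠ x} :=
      ((isClosed_singleton (x := x)).preimage
        (show Continuous fun w : E3 => prolateParam R (w 1, w 2) by
          fun_prop)).measurableSet.compl
    exact h0.inter (h1.inter h2)
  have hinner : ∀ w ∈ D, inner ℝ (conormal R x) (G w)
      = -(prolateForm R (G w) / (2 * w 0)) ∧ 0 < prolateForm R (G w) := by
    rintro w ⟨h0, h1, h2⟩
    have hpos := prolateForm_pos hR (sub_ne_zero.2 h2)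
    simp only [hG, inner_smul_right, prolateForm_smul,
      inner_conormal_sub hx (prolateForm_prolateParam h1)]
    exact ⟨by field_simp, by positivity⟩
  have hinj : InjOn G D := by
    intro w hw w' hw' heq
    obtain ⟨i1, i2⟩ := hinner w hw
    obtain ⟨i1', -⟩ := hinner w' hw'
    rw [← heq] at i1'
    have h0 := hw.1
    have h0' := hw'.1
    -- The radius can be read off from the image z: it is -q(z)/(2⟨n(x), z⟩), with q the quadratic
    -- form and n the conormal.
    have e0 : w 0 = w' 0 := by
      have := i1.symm.trans i1'
      field_simp at this
      linarith
    have e1 : prolateParam R (w 1, w 2) = prolateParam R (w' 1, w' 2) := by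
      have h4 : w 0 • (prolateParam R (w 1, w 2) - x) = w' 0 • (prolateParam R (w' 1, w' 2) - x) :=
        heq
      rw [← e0] at h4
      exact sub_left_injective (smul_right_injective E3 h0.ne' h4)
    have e2 := injOn_prolateParam R hw.2.1 hw'.2.1 e1
    simp only [Prod.mk.injEq] at e2
    ext i
    fin_cases i
    · exact e0
    · exact e2.1
    · exact e2.2
  have hcov := lintegral_image_eq_lintegral_abs_det_fderiv_mul volume hmD
    (fun w hw => (hasFDerivAt_conic x hw.2.1).hasFDerivWithinAt) hinj F
  have himg : G '' D ⊆ {z | inner ℝ (conormal R x) z < 0} := by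
    rintro _ ⟨w, hw, rfl⟩
    obtain ⟨i1, i2⟩ := hinner w hw
    have h0 := hw.1
    show inner ℝ (conormal R x) (G w) < 0
    rw [i1, neg_lt_zero]
    positivity
  refine le_trans (le_of_eq ?_) (lintegral_mono_set himg)
  rw [hcov]
  set q : E3 → ENNReal := fun w =>
    ENNReal.ofReal (w 0 ^ 2 * (prolateForm R (prolateParam R (w 1, w 2) - x) / 2)) * F (G w)
    with hq
  have hmq : Measurable q := by
    have h1 : Continuous fun w : E3 =>
        w 0 ^ 2 * (prolateForm R (prolateParam R (w 1, w 2) - x) / 2) := by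
      have := continuous_prolateForm R
      fun_prop
    exact h1.measurable.ennreal_ofReal.mul (hF.comp hmG)
  have hdet : ∀ w ∈ D, ENNReal.ofReal |(Matrix.toEuclideanCLM (𝕜 := ℝ) (conicJacobian R x w)).det|
      * F (G w) = q w := by
    rintro w hw
    have := prolateForm_nonneg R (prolateParam R (w 1, w 2) - x)
    rw [det_toEuclideanCLM, det_conicJacobian hx hw.2.1, abs_of_nonneg (by positivity)]
  rw [setLIntegral_congr_fun hmD hdet, ← lintegral_indicator hmD,
    E3.lintegral_eq (hmq.indicator hmD), ← lintegral_indicator (measurableSet_cylinderDomain R)]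
  refine lintegral_congr fun p => ?_
  by_cases hp : p ∈ cylinderDomain R
  · rw [indicator_of_mem hp, ← lintegral_indicator measurableSet_Ioi]
    refine lintegral_congr fun r => ?_
    by_cases hr : r ∈ Ioi (0 : ℝ)
    · rw [indicator_of_mem hr]
      by_cases hpx : prolateParam R p = x
      · have : (!₂[r, p.1, p.2] : E3) ∉ D := fun h => h.2.2 (by simpa using hpx)
        rw [indicator_of_notMem this, hpx]
        simp [prolateForm]
      · have : (!₂[r, p.1, p.2] : E3) ∈ D := by
          refine ⟨?_, ?_, ?_⟩
          · simpa using hr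
          · simpa using hp
          · simpa using hpx
        rw [indicator_of_mem this]
        simp [hq, hG]
    · rw [indicator_of_notMem hr, indicator_of_notMem]
      intro h
      exact hr (by simpa using h.1)
  · rw [indicator_of_notMem hp]
    refine (lintegral_eq_zero_of_ae_eq_zero (Eventually.of_forall fun r => ?_)).symm
    refine indicator_of_notMem ?_ _
    intro h
    exact hp (by simpa using h.2.1)

/-! ### Bounds for integrals of kernels over the spheroid -/

theorem lintegral_rpow_mul_exp_neg_mul_sq {s b : ℝ} (hs : -1 < s) (hb : 0 < b) :
    ∫⁻ r in Ioi (0 : ℝ), ENNReal.ofReal (r ^ s * Real.exp (-b * r ^ 2))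
      = ENNReal.ofReal (b ^ (-(s + 1) / 2) * (1 / 2) * Real.Gamma ((s + 1) / 2)) := by
  rw [← integral_rpow_mul_exp_neg_mul_rpow two_pos hs hb]
  simp only [Real.rpow_two]
  rw [ofReal_integral_eq_lintegral_ofReal (integrableOn_rpow_mul_exp_neg_mul_sq hb hs)]
  filter_upwards [ae_restrict_mem measurableSet_Ioi] with r hr
  have : (0 : ℝ) < r := hr
  positivity

theorem Real.Gamma_three_halves : Real.Gamma (3 / 2) = Real.sqrt Real.pi / 2 := by
  rw [show (3 / 2 : ℝ) = 1 / 2 + 1 by norm_num, Real.Gamma_add_one (by norm_num),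
    Real.Gamma_one_half_eq]
  ring

theorem E3.lintegral_gaussian :
    ∫⁻ z : E3, ENNReal.ofReal (Real.exp (-‖z‖ ^ 2)) = ENNReal.ofReal (Real.pi ^ (3 / 2 : ℝ)) := by
  have h := GaussianFourier.integral_rexp_neg_mul_sq_norm (V := E3) one_pos
  have hi : Integrable (fun z : E3 => Real.exp (-1 * ‖z‖ ^ 2)) := by
    by_contra hc
    rw [integral_undef hc] at h
    have : (0 : ℝ) < (Real.pi / 1) ^ ((Module.finrank ℝ E3 : ℝ) / 2) := by positivity
    linarith
  have hf : (Module.finrank ℝ E3 : ℝ) = 3 := by simp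
  rw [hf, div_one] at h
  rw [← h, ofReal_integral_eq_lintegral_ofReal hi (Eventually.of_forall fun z => by positivity)]
  simp

/-- The Gaussian mass of an open half-space is at most one half. -/
theorem E3.lintegral_gaussian_halfspace (a : E3) :
    ∫⁻ z in {z : E3 | inner ℝ a z < 0}, ENNReal.ofReal (Real.exp (-‖z‖ ^ 2))
      ≤ ENNReal.ofReal (Real.pi ^ (3 / 2 : ℝ) / 2) := by
  set F : E3 → ENNReal := fun z => ENNReal.ofReal (Real.exp (-‖z‖ ^ 2)) with hF
  have hm : MeasurableSet {z : E3 | inner ℝ a z < 0} :=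
    measurableSet_lt (by fun_prop) measurable_const
  have hm' : MeasurableSet {z : E3 | 0 < inner ℝ a z} :=
    measurableSet_lt measurable_const (by fun_prop)
  have h1 : ∫⁻ z in {z : E3 | 0 < inner ℝ a z}, F z = ∫⁻ z in {z : E3 | inner ℝ a z < 0}, F z := by
    rw [← lintegral_indicator hm, ← lintegral_indicator hm',
      ← lintegral_neg_eq_self (μ := (volume : Measure E3))]
    refine lintegral_congr fun z => ?_
    simp [indicator, hF]
  have hd : Disjoint {z : E3 | inner ℝ a z < 0} {z : E3 | 0 < inner ℝ a z} := by
    rw [Set.disjoint_left]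
    intro z hz hz'
    exact lt_asymm (mem_ofPred_eq ▸ hz) hz'
  have h2 := lintegral_union (μ := (volume : Measure E3)) (f := F) hm' hd
  have h3 : ∫⁻ z in {z : E3 | inner ℝ a z < 0} ∪ {z : E3 | 0 < inner ℝ a z}, F z
      ≤ ENNReal.ofReal (Real.pi ^ (3 / 2 : ℝ)) := by
    rw [← E3.lintegral_gaussian]
    exact setLIntegral_le_lintegral _ _
  rw [h2, h1, ← two_mul] at h3
  rw [ENNReal.ofReal_div_of_pos two_pos, ENNReal.le_div_iff_mul_le (by simp) (by simp), mul_comm]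
  simpa using h3

/-- The constant function is mapped to at most `1 / 2`: the total solid angle is at most `2π`. -/
theorem lintegral_symKernel_le {R : ℝ} (hR : 1 ≤ R) {x : E3} (hx : prolateForm R x = 1) :
    ∫⁻ y, ENNReal.ofReal (symKernel R x y) ∂coneMeasure R ≤ ENNReal.ofReal (1 / 2) := by
  have hm : Measurable fun y => ENNReal.ofReal (symKernel R x y) :=
    ((measurable_symKernel R).comp measurable_prodMk_left).ennreal_ofReal
  have hF : Measurable fun z : E3 => ENNReal.ofReal (Real.exp (-‖z‖ ^ 2)) := by fun_prop
  have h := (lintegral_conic_le hR hx hF).trans (E3.lintegral_gaussian_halfspace _)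
  -- The solid angle is measured by a normalized Gaussian: ∫ r² exp(-r²|v|²) dr = √π/(4|v|³)
  -- produces the cubic denominator, and c is the reciprocal of the total Gaussian mass.
  set c : ℝ := 1 / Real.pi ^ (3 / 2 : ℝ) with hc
  have hpi := Real.pi_pos
  have hπ : Real.pi ^ (3 / 2 : ℝ) = Real.pi * Real.sqrt Real.pi := by
    rw [Real.sqrt_eq_rpow, ← Real.rpow_one_add' hpi.le (by norm_num)]
    norm_num
  have hkey : ∀ p, ENNReal.ofReal (symKernel R x (prolateParam R p)) = ENNReal.ofReal c *
      ∫⁻ r in Ioi (0 : ℝ),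
        ENNReal.ofReal (r ^ 2 * (prolateForm R (prolateParam R p - x) / 2)) *
          ENNReal.ofReal (Real.exp (-‖r • (prolateParam R p - x)‖ ^ 2)) := by
    intro p
    rw [symKernel_comm, symKernel]
    set v := prolateParam R p - x
    have hq := prolateForm_nonneg R v
    rcases eq_or_ne v 0 with hv | hv
    · simp [hv, prolateForm]
    have hv' : 0 < ‖v‖ := norm_pos_iff.2 hv
    have h1 : ∀ r ∈ Ioi (0 : ℝ), ENNReal.ofReal (r ^ 2 * (prolateForm R v / 2)) *
        ENNReal.ofReal (Real.exp (-‖r • v‖ ^ 2)) = ENNReal.ofReal (prolateForm R v / 2) *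
          ENNReal.ofReal (r ^ (2 : ℝ) * Real.exp (-(‖v‖ ^ 2) * r ^ 2)) := by
      intro r hr
      rw [← ENNReal.ofReal_mul (by positivity), ← ENNReal.ofReal_mul (by positivity), norm_smul,
        mul_pow, Real.norm_eq_abs, sq_abs, Real.rpow_two]
      congr 1
      rw [show -(r ^ 2 * ‖v‖ ^ 2) = -(‖v‖ ^ 2) * r ^ 2 by ring]
      ring
    rw [setLIntegral_congr_fun measurableSet_Ioi h1, lintegral_const_mul' _ _ ENNReal.ofReal_ne_top,
      lintegral_rpow_mul_exp_neg_mul_sq (by norm_num) (by positivity),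
      ← ENNReal.ofReal_mul (by positivity), ← ENNReal.ofReal_mul (by positivity)]
    congr 1
    have h2 : (‖v‖ ^ 2) ^ (-(2 + 1) / 2 : ℝ) = (‖v‖ ^ 3)⁻¹ := by
      rw [← Real.rpow_natCast, ← Real.rpow_mul hv'.le, ← Real.rpow_natCast, ← Real.rpow_neg hv'.le]
      norm_num
    rw [h2, show ((2 : ℝ) + 1) / 2 = 3 / 2 by norm_num, Real.Gamma_three_halves, hc, hπ]
    have := Real.sqrt_pos.2 hpi
    field_simp
    ring
  rw [lintegral_coneMeasure R hm]
  simp only [hkey]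
  rw [lintegral_const_mul' _ _ ENNReal.ofReal_ne_top]
  calc _ ≤ ENNReal.ofReal c * ENNReal.ofReal (Real.pi ^ (3 / 2 : ℝ) / 2) := by gcongr
    _ = ENNReal.ofReal (1 / 2) := by
      rw [← ENNReal.ofReal_mul (by positivity), hc]
      congr 1
      have : (0 : ℝ) < Real.pi ^ (3 / 2 : ℝ) := by positivity
      field_simp

/-! ### Integrability of the kernel |x - y|^(-7/4) on the spheroid. -/

/-- There is a linear isometry of `ℝ³` that maps a given vector to a multiple of `e₀`. -/
theorem E3.exists_isometry (a : E3) :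
    ∃ T : E3 ≃ₗᵢ[ℝ] E3, ∀ z, inner ℝ a (T z) = ‖a‖ * z 0 := by
  set b : E3 := ‖a‖ • EuclideanSpace.single 0 1 with hb
  have hab : ‖a‖ = ‖b‖ := by simp [hb, norm_smul]
  -- Two vectors of equal length are exchanged by the reflection in the plane orthogonal to their
  -- difference.
  set T : E3 ≃ₗᵢ[ℝ] E3 := Submodule.reflection (Submodule.span ℝ {a - b})ᗮ with hT
  have h : T a = b := Submodule.reflection_sub hab
  refine ⟨T, fun z => ?_⟩
  rw [← LinearIsometryEquiv.inner_map_map T, h, hT, Submodule.reflection_reflection, hb,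
    inner_smul_left]
  simp [EuclideanSpace.inner_single_left]

theorem lintegral_abs_rpow_mul_exp_neg_sq_lt_top {s : ℝ} (hs : -1 < s) :
    ∫⁻ r : ℝ, ENNReal.ofReal (|r| ^ s * Real.exp (-r ^ 2)) < ⊤ := by
  have h1 := lintegral_rpow_mul_exp_neg_mul_sq hs one_pos
  have h2 : ∫⁻ r in Ioi (0 : ℝ), ENNReal.ofReal (|r| ^ s * Real.exp (-r ^ 2)) < ⊤ := by
    have : ∀ r ∈ Ioi (0 : ℝ), ENNReal.ofReal (|r| ^ s * Real.exp (-r ^ 2))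
        = ENNReal.ofReal (r ^ s * Real.exp (-1 * r ^ 2)) := by
      intro r hr
      rw [abs_of_pos hr, neg_one_mul]
    rw [setLIntegral_congr_fun measurableSet_Ioi this, h1]
    exact ENNReal.ofReal_lt_top
  have h3 : ∫⁻ r in Iio (0 : ℝ), ENNReal.ofReal (|r| ^ s * Real.exp (-r ^ 2))
      = ∫⁻ r in Ioi (0 : ℝ), ENNReal.ofReal (|r| ^ s * Real.exp (-r ^ 2)) := by
    rw [← lintegral_indicator measurableSet_Ioi, ← lintegral_indicator measurableSet_Iio,
      ← lintegral_neg_eq_self (μ := (volume : Measure ℝ))]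
    refine lintegral_congr fun z => ?_
    simp [indicator]
  rw [← lintegral_add_compl _ (measurableSet_Ioi (a := (0 : ℝ))), compl_Ioi,
    setLIntegral_congr (Iio_ae_eq_Iic (a := (0 : ℝ))).symm, h3]
  exact ENNReal.add_lt_top.2 ⟨h2, h2⟩

theorem E3.lintegral_exp_mul_rpow_lt_top {s : ℝ} (hs : -1 < s) :
    ∫⁻ z : E3, ENNReal.ofReal (Real.exp (-‖z‖ ^ 2) * |z 0| ^ s) < ⊤ := by
  rw [E3.lintegral_eq (by fun_prop)]
  have h : ∀ p : ℝ × ℝ, ∀ r : ℝ,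
      ENNReal.ofReal (Real.exp (-‖(!₂[r, p.1, p.2] : E3)‖ ^ 2) * |(!₂[r, p.1, p.2] : E3) 0| ^ s)
      = ENNReal.ofReal (Real.exp (-p.1 ^ 2)) * ENNReal.ofReal (Real.exp (-p.2 ^ 2)) *
        ENNReal.ofReal (|r| ^ s * Real.exp (-r ^ 2)) := by
    intro p r
    rw [← ENNReal.ofReal_mul (by positivity), ← ENNReal.ofReal_mul (by positivity), E3.norm_sq]
    congr 1
    simp only [Matrix.cons_val_zero, Matrix.cons_val_one, Matrix.cons_val]
    rw [show -(r ^ 2 + p.1 ^ 2 + p.2 ^ 2) = -p.1 ^ 2 + -p.2 ^ 2 + -r ^ 2 by ring, Real.exp_add,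
      Real.exp_add]
    ring
  simp only [h]
  have hG : ∫⁻ r : ℝ, ENNReal.ofReal (Real.exp (-r ^ 2)) < ⊤ := by
    simpa using lintegral_abs_rpow_mul_exp_neg_sq_lt_top (s := 0) (by norm_num)
  have hf := lintegral_abs_rpow_mul_exp_neg_sq_lt_top hs
  have h2 : ∀ p : ℝ × ℝ, ∫⁻ r : ℝ, ENNReal.ofReal (Real.exp (-p.1 ^ 2)) *
      ENNReal.ofReal (Real.exp (-p.2 ^ 2)) * ENNReal.ofReal (|r| ^ s * Real.exp (-r ^ 2))
      = ENNReal.ofReal (Real.exp (-p.1 ^ 2)) * ENNReal.ofReal (Real.exp (-p.2 ^ 2)) *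
        ∫⁻ r : ℝ, ENNReal.ofReal (|r| ^ s * Real.exp (-r ^ 2)) :=
    fun p => lintegral_const_mul' _ _ (by finiteness)
  simp only [h2]
  rw [lintegral_mul_const' _ _ hf.ne, Measure.volume_eq_prod,
    lintegral_prod_mul (f := fun r : ℝ => ENNReal.ofReal (Real.exp (-r ^ 2)))
      (g := fun r : ℝ => ENNReal.ofReal (Real.exp (-r ^ 2))) (by fun_prop) (by fun_prop)]
  exact ENNReal.mul_lt_top (ENNReal.mul_lt_top hG hG) hf

/-- The weakly singular kernel `|x - y|^(-7/4)`. -/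
noncomputable def rieszKernel (x y : E3) : ENNReal := ENNReal.ofReal (‖x - y‖ ^ (-(7 / 4) : ℝ))

theorem rieszKernel_comm (x y : E3) : rieszKernel x y = rieszKernel y x := by
  rw [rieszKernel, norm_sub_rev, rieszKernel]

theorem measurable_rieszKernel : Measurable fun z : E3 × E3 => rieszKernel z.1 z.2 := by
  unfold rieszKernel; fun_prop

/-- Rotation invariance reduces a general direction to e₀. As the exponent is not positive, a lower
bound on ‖a‖ is what yields a bound uniform in a; it is applied to the conormal. -/
theorem E3.lintegral_exp_mul_inner_rpow_le {s κ : ℝ} (hs : s ≤ 0) (hκ : 0 < κ) {a : E3}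
    (ha : κ ≤ ‖a‖) :
    ∫⁻ z : E3, ENNReal.ofReal (Real.exp (-‖z‖ ^ 2) * |inner ℝ a z| ^ s)
      ≤ ENNReal.ofReal (κ ^ s) *
        ∫⁻ z : E3, ENNReal.ofReal (Real.exp (-‖z‖ ^ 2) * |z 0| ^ s) := by
  have hF : Measurable fun z : E3 =>
    ENNReal.ofReal (Real.exp (-‖z‖ ^ 2) * |inner ℝ a z| ^ s) := by fun_prop
  obtain ⟨T, hT⟩ := E3.exists_isometry a
  rw [← T.measurePreserving.lintegral_comp hF, ← lintegral_const_mul' _ _ ENNReal.ofReal_ne_top]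
  refine lintegral_mono fun z => ?_
  rw [hT, T.norm_map, ← ENNReal.ofReal_mul (by positivity), abs_mul, abs_norm,
    Real.mul_rpow (by positivity) (by positivity)]
  refine ENNReal.ofReal_le_ofReal ?_
  have : ‖a‖ ^ s ≤ κ ^ s := Real.rpow_le_rpow_of_nonpos hκ ha hs
  calc _ = ‖a‖ ^ s * (Real.exp (-‖z‖ ^ 2) * |z 0| ^ s) := by ring
    _ ≤ _ := by gcongr

/-- The radial integral that produces the kernel `|v|^(-7/4)`. -/
theorem rpow_norm_le_lintegral_radial {R : ℝ} (hR : 1 ≤ R) {v a : E3}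
    (ha : inner ℝ a v = -(prolateForm R v / 2)) :
    ENNReal.ofReal (‖v‖ ^ (-(7 / 4) : ℝ)) ≤
      ENNReal.ofReal (2 / Real.Gamma ((5 / 4 + 1) / 2) * (2 * R ^ 2) ^ (1 / 4 : ℝ)) *
        ∫⁻ r in Ioi (0 : ℝ), ENNReal.ofReal (r ^ 2 * (prolateForm R v / 2)) *
          ENNReal.ofReal (Real.exp (-‖r • v‖ ^ 2) * |inner ℝ a (r • v)| ^ (-(3 / 4) : ℝ)) := by
  have hR0 : 0 < R := by linarith
  have hg0 : 0 < Real.Gamma ((5 / 4 + 1) / 2) := Real.Gamma_pos_of_pos (by norm_num)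
  rcases eq_or_ne v 0 with hv | hv
  · simp only [hv, norm_zero]
    rw [Real.zero_rpow (by norm_num)]
    simp
  have hv' : 0 < ‖v‖ := norm_pos_iff.2 hv
  have hq := prolateForm_pos hR hv
  have hvq := norm_sq_le_prolateForm hR v
  -- On the ray the weight is r^(-3/4)(q/2)^(-3/4), with q the form at v, so r^(5/4)(q/2)^(1/4)
  -- remains. The radial integral gives |v|^(-9/4), and q ≥ |v|²/R² turns q^(1/4) into at least a
  -- multiple of |v|^(1/2): in total |v|^(-7/4).
  have h1 : ∀ r ∈ Ioi (0 : ℝ), ENNReal.ofReal (r ^ 2 * (prolateForm R v / 2)) *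
      ENNReal.ofReal (Real.exp (-‖r • v‖ ^ 2) * |inner ℝ a (r • v)| ^ (-(3 / 4) : ℝ))
        = ENNReal.ofReal ((prolateForm R v / 2) ^ (1 / 4 : ℝ)) *
        ENNReal.ofReal (r ^ (5 / 4 : ℝ) * Real.exp (-(‖v‖ ^ 2) * r ^ 2)) := by
    intro r hr
    have hr0 : (0 : ℝ) < r := hr
    rw [inner_smul_right, ha, ← ENNReal.ofReal_mul (by positivity),
      ← ENNReal.ofReal_mul (by positivity), norm_smul, mul_pow, Real.norm_eq_abs, sq_abs,
      abs_mul, abs_neg, abs_of_pos hr0, abs_of_pos (by positivity),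
      Real.mul_rpow hr0.le (by positivity)]
    congr 1
    rw [show -(r ^ 2 * ‖v‖ ^ 2) = -(‖v‖ ^ 2) * r ^ 2 by ring,
      show (5 / 4 : ℝ) = 2 + -(3 / 4) by norm_num, Real.rpow_add hr0, Real.rpow_two,
      show (1 / 4 : ℝ) = 1 + -(3 / 4) by norm_num, Real.rpow_add (by positivity), Real.rpow_one]
    ring
  rw [setLIntegral_congr_fun measurableSet_Ioi h1,
    lintegral_const_mul' _ _ ENNReal.ofReal_ne_top,
    lintegral_rpow_mul_exp_neg_mul_sq (by norm_num) (by positivity),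
    ← ENNReal.ofReal_mul (by positivity), ← ENNReal.ofReal_mul (by positivity)]
  refine ENNReal.ofReal_le_ofReal ?_
  have h2 : (‖v‖ ^ 2) ^ (-(5 / 4 + 1) / 2 : ℝ) = ‖v‖ ^ (-(9 / 4) : ℝ) := by
    rw [← Real.rpow_natCast, ← Real.rpow_mul hv'.le]
    norm_num
  have h3 : ‖v‖ ^ (1 / 2 : ℝ) ≤
      (2 * R ^ 2) ^ (1 / 4 : ℝ) * (prolateForm R v / 2) ^ (1 / 4 : ℝ) := by
    rw [← Real.mul_rpow (by positivity) (by positivity)]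
    calc ‖v‖ ^ (1 / 2 : ℝ) = (‖v‖ ^ 2) ^ (1 / 4 : ℝ) := by
          rw [← Real.rpow_natCast, ← Real.rpow_mul hv'.le]
          norm_num
      _ ≤ _ := by
          gcongr
          linarith
  rw [h2]
  generalize Real.Gamma ((5 / 4 + 1) / 2) = g at hg0 ⊢
  calc ‖v‖ ^ (-(7 / 4) : ℝ) = ‖v‖ ^ (1 / 2 : ℝ) * ‖v‖ ^ (-(9 / 4) : ℝ) := by
        rw [← Real.rpow_add hv']
        norm_num
    _ ≤ ((2 * R ^ 2) ^ (1 / 4 : ℝ) * (prolateForm R v / 2) ^ (1 / 4 : ℝ)) *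
        ‖v‖ ^ (-(9 / 4) : ℝ) := by gcongr
    _ = _ := by field_simp

theorem lintegral_rieszKernel_le {R : ℝ} (hR : 1 ≤ R) {x : E3} (hx : prolateForm R x = 1) :
    ∫⁻ y, rieszKernel x y ∂coneMeasure R ≤
      ENNReal.ofReal (2 / Real.Gamma ((5 / 4 + 1) / 2) * (2 * R ^ 2) ^ (1 / 4 : ℝ)) *
        (ENNReal.ofReal ((1 / R) ^ (-(3 / 4) : ℝ)) *
          ∫⁻ z : E3, ENNReal.ofReal (Real.exp (-‖z‖ ^ 2) * |z 0| ^ (-(3 / 4) : ℝ))) := by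
  have hR0 : 0 < R := by linarith
  have ha : 1 / R ≤ ‖conormal R x‖ := by rw [norm_conormal]; exact gradLength_pos hR hx
  have hm : Measurable fun y => rieszKernel x y := by
    unfold rieszKernel; fun_prop
  have hF : Measurable fun z : E3 =>
    ENNReal.ofReal (Real.exp (-‖z‖ ^ 2) * |inner ℝ (conormal R x) z| ^ (-(3 / 4) : ℝ)) := by
    fun_prop
  have h := ((lintegral_conic_le hR hx hF).trans (setLIntegral_le_lintegral _ _)).trans
    (E3.lintegral_exp_mul_inner_rpow_le (by norm_num) (by positivity) ha)
  rw [lintegral_coneMeasure R hm]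
  refine le_trans ?_ (mul_le_mul_right h _)
  rw [← lintegral_const_mul' _ _ ENNReal.ofReal_ne_top]
  refine setLIntegral_mono' (measurableSet_cylinderDomain R) fun p hp => ?_
  rw [rieszKernel_comm, rieszKernel]
  exact rpow_norm_le_lintegral_radial hR (inner_conormal_sub hx (prolateForm_prolateParam hp))

theorem exists_lintegral_rieszKernel_le {R : ℝ} (hR : 1 ≤ R) :
    ∃ C : ENNReal, C ≠ ⊤ ∧ ∀ x, prolateForm R x = 1 →
      ∫⁻ y, rieszKernel x y ∂coneMeasure R ≤ C := by
  have hA := E3.lintegral_exp_mul_rpow_lt_top (s := -(3 / 4)) (by norm_num)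
  exact ⟨_, ENNReal.mul_ne_top ENNReal.ofReal_ne_top
    (ENNReal.mul_ne_top ENNReal.ofReal_ne_top hA.ne), fun x hx => lintegral_rieszKernel_le hR hx⟩

/-! ### Schur's test -/

/-- Cauchy–Schwarz for the splitting N g = N^(1/2) · (N^(1/2) g). -/
theorem MeasureTheory.sq_lintegral_mul_le {α : Type*} [MeasurableSpace α] (μ : Measure α)
    {N g : α → ENNReal} (hN : AEMeasurable N μ) (hg : AEMeasurable g μ) :
    (∫⁻ x, N x * g x ∂μ) ^ 2 ≤ (∫⁻ x, N x ∂μ) * ∫⁻ x, N x * g x ^ 2 ∂μ := by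
  have h := ENNReal.lintegral_mul_le_Lp_mul_Lq μ Real.HolderConjugate.two_two
    (f := fun x => N x ^ (1 / 2 : ℝ)) (g := fun x => N x ^ (1 / 2 : ℝ) * g x)
    (hN.pow_const _) ((hN.pow_const _).mul hg)
  have e1 : ∀ a : ENNReal, a ^ (1 / 2 : ℝ) * a ^ (1 / 2 : ℝ) = a := fun a => by
    rw [← ENNReal.rpow_add_of_nonneg _ _ (by norm_num) (by norm_num)]
    norm_num
  have e2 : ∀ a : ENNReal, (a ^ (1 / 2 : ℝ)) ^ (2 : ℝ) = a := fun a => by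
    rw [← ENNReal.rpow_mul]
    norm_num
  simp only [Pi.mul_apply, ← mul_assoc, e1, e2, ENNReal.mul_rpow_of_nonneg _ _ zero_le_two,
    ENNReal.rpow_two] at h
  calc _ ≤ _ := pow_le_pow_left' h 2
    _ = _ := by rw [mul_pow, ← ENNReal.rpow_two, ← ENNReal.rpow_two, e2, e2]

/-- Schur's test. -/
theorem MeasureTheory.lintegral_sq_lintegral_mul_le {α : Type*} [MeasurableSpace α]
    (μ : Measure α) [SFinite μ] {N : α → α → ENNReal} {g : α → ENNReal}
    (hN : Measurable fun z : α × α => N z.1 z.2) (hg : Measurable g) {A : ENNReal}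
    (h1 : ∀ᵐ x ∂μ, ∫⁻ y, N x y ∂μ ≤ A) (h2 : ∀ᵐ y ∂μ, ∫⁻ x, N x y ∂μ ≤ A) :
    ∫⁻ x, (∫⁻ y, N x y * g y ∂μ) ^ 2 ∂μ ≤ A * (A * ∫⁻ y, g y ^ 2 ∂μ) := by
  have hm : Measurable fun z : α × α => N z.1 z.2 * g z.2 ^ 2 := by fun_prop
  calc _ ≤ ∫⁻ x, A * ∫⁻ y, N x y * g y ^ 2 ∂μ ∂μ := by
        refine lintegral_mono_ae (h1.mono fun x hx => ?_)
        have hNx : Measurable fun y => N x y := hN.comp measurable_prodMk_left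
        exact (sq_lintegral_mul_le μ hNx.aemeasurable hg.aemeasurable).trans (by gcongr)
    _ = A * ∫⁻ y, ∫⁻ x, N x y * g y ^ 2 ∂μ ∂μ := by
        rw [lintegral_const_mul _ hm.lintegral_prod_right', lintegral_lintegral_swap hm.aemeasurable]
    _ ≤ A * ∫⁻ y, A * g y ^ 2 ∂μ := by
        refine mul_le_mul_right ?_ _
        refine lintegral_mono_ae (h2.mono fun y hy => ?_)
        have hNy : Measurable fun x => N x y := hN.comp measurable_prodMk_right
        rw [lintegral_mul_const _ hNy]
        gcongr
    _ = _ := by rw [lintegral_const_mul _ (hg.pow_const 2)]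

theorem MeasureTheory.eLpNorm_two_sq {α E : Type*} [MeasurableSpace α] [NormedAddCommGroup E]
    (f : α → E) (μ : Measure α) : eLpNorm f 2 μ ^ 2 = ∫⁻ x, ‖f x‖ₑ ^ 2 ∂μ := by
  have h := eLpNorm_nnreal_pow_eq_lintegral (f := f) (μ := μ) (p := 2) two_ne_zero
  simpa using h

theorem MeasureTheory.Lp.enorm_sq_eq {α E : Type*} [MeasurableSpace α] [NormedAddCommGroup E]
    {μ : Measure α} (f : Lp E 2 μ) : ‖f‖ₑ ^ 2 = ∫⁻ x, ‖f x‖ₑ ^ 2 ∂μ := by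
  rw [Lp.enorm_def, eLpNorm_two_sq]

theorem MeasureTheory.memLp_two_of_lintegral {α E : Type*} [MeasurableSpace α]
    [NormedAddCommGroup E] {μ : Measure α} {f : α → E} (hf : AEStronglyMeasurable f μ)
    (h : ∫⁻ x, ‖f x‖ₑ ^ 2 ∂μ ≠ ⊤) : MemLp f 2 μ := by
  refine ⟨hf, ?_⟩
  rw [← eLpNorm_two_sq] at h
  exact lt_top_iff_ne_top.2 fun ht => h (by simp [ht])

/-! ### Regularity of the kernel -/

/-- The difference of the two values is the associated bilinear form at (u - v, u + v), and that
form has norm at most 1 because R ≥ 1. -/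
theorem abs_prolateForm_sub_le {R : ℝ} (hR : 1 ≤ R) (u v : E3) :
    |prolateForm R u - prolateForm R v| ≤ ‖u - v‖ * (‖u‖ + ‖v‖) := by
  have h : prolateForm R u - prolateForm R v = inner ℝ (conormal R (u - v)) (u + v) := by
    rw [inner_conormal]
    simp only [prolateForm, PiLp.sub_apply, PiLp.add_apply]
    ring
  have h2 : ‖conormal R (u - v)‖ ≤ ‖u - v‖ := by
    rw [norm_conormal, gradLength]
    refine Real.sqrt_le_iff.2 ⟨norm_nonneg _, ?_⟩
    rw [E3.norm_sq]
    have : (u - v) 2 ^ 2 / R ^ 4 ≤ (u - v) 2 ^ 2 := div_le_self (sq_nonneg _) (one_le_pow₀ hR)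
    linarith
  rw [h]
  calc _ ≤ ‖conormal R (u - v)‖ * ‖u + v‖ := abs_real_inner_le_norm _ _
    _ ≤ _ := by gcongr; exact norm_add_le _ _

/-- The Lipschitz-type bound 5d/(ab) is interpolated: d = d^(3/4) d^(1/4), with d ≤ 2b and b^(-3/4)
≤ a^(-3/4). The Hölder exponent 3/4 must exceed 1/2 for the Gagliardo quotient to be controlled, and
be below 1 for a^(-1-3/4) to be integrable on a surface. -/
theorem abs_div_pow_three_sub_le {A B a b d : ℝ} (ha : 0 < a) (hab : a ≤ b) (hA : 0 ≤ A)
    (hAa : A ≤ a ^ 2) (hd : |A - B| ≤ d * (a + b)) (hba : b - a ≤ d) (hdb : d ≤ a + b) :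
    |A / a ^ 3 - B / b ^ 3| ≤ 10 * d ^ (3 / 4 : ℝ) * a ^ (-(7 / 4) : ℝ) := by
  have hb : 0 < b := ha.trans_le hab
  have hd0 : 0 ≤ d := by linarith
  have h1 : A / a ^ 3 - B / b ^ 3 = (A - B) / b ^ 3 + A * (b ^ 3 - a ^ 3) / (a ^ 3 * b ^ 3) := by
    field_simp
    ring
  have h2 : |(A - B) / b ^ 3| ≤ 2 * d / (a * b) := by
    rw [abs_div, abs_of_pos (by positivity : 0 < b ^ 3), div_le_div_iff₀ (by positivity)
      (by positivity)]
    calc |A - B| * (a * b) ≤ d * (b + b) * (b * b) := by gcongr; exact hd.trans (by gcongr)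
      _ = _ := by ring
  have h3 : |A * (b ^ 3 - a ^ 3) / (a ^ 3 * b ^ 3)| ≤ 3 * d / (a * b) := by
    have h4 : 0 ≤ b ^ 3 - a ^ 3 := by
      have := pow_le_pow_left₀ ha.le hab 3
      linarith
    have h5 : b ^ 3 - a ^ 3 ≤ d * (3 * b ^ 2) := by
      have : b ^ 3 - a ^ 3 = (b - a) * (b ^ 2 + a * b + a ^ 2) := by ring
      rw [this]
      gcongr
      nlinarith
    rw [abs_of_nonneg (by positivity), div_le_div_iff₀ (by positivity) (by positivity)]
    calc A * (b ^ 3 - a ^ 3) * (a * b) ≤ a ^ 2 * (d * (3 * b ^ 2)) * (a * b) := by gcongr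
      _ = _ := by ring
  have h6 : d ≤ d ^ (3 / 4 : ℝ) * (2 * b ^ (1 / 4 : ℝ)) := by
    calc d = d ^ (3 / 4 : ℝ) * d ^ (1 / 4 : ℝ) := by
          rw [← Real.rpow_add_of_nonneg hd0 (by norm_num) (by norm_num)]
          norm_num
      _ ≤ d ^ (3 / 4 : ℝ) * (2 * b) ^ (1 / 4 : ℝ) := by
          gcongr
          linarith
      _ ≤ _ := by
          rw [Real.mul_rpow two_pos.le hb.le]
          gcongr
          exact Real.rpow_le_self_of_one_le one_le_two (by norm_num)
  have h7 : b ^ (1 / 4 : ℝ) / (a * b) ≤ a ^ (-(7 / 4) : ℝ) := by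
    calc b ^ (1 / 4 : ℝ) / (a * b) = b ^ (-(3 / 4) : ℝ) * a⁻¹ := by
          rw [show (-(3 / 4) : ℝ) = 1 / 4 - 1 by norm_num, Real.rpow_sub_one hb.ne']
          field_simp
      _ ≤ a ^ (-(3 / 4) : ℝ) * a⁻¹ := by
          gcongr ?_ * _
          exact Real.rpow_le_rpow_of_nonpos ha hab (by norm_num)
      _ = _ := by
          rw [← div_eq_mul_inv, ← Real.rpow_sub_one ha.ne']
          norm_num
  rw [h1]
  calc _ ≤ _ := (abs_add_le _ _).trans (add_le_add h2 h3)
    _ = 5 * d / (a * b) := by ring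
    _ ≤ 5 * (d ^ (3 / 4 : ℝ) * (2 * b ^ (1 / 4 : ℝ))) / (a * b) := by gcongr
    _ = 10 * d ^ (3 / 4 : ℝ) * (b ^ (1 / 4 : ℝ) / (a * b)) := by ring
    _ ≤ _ := by gcongr

theorem abs_prolateForm_div_sub_le {R : ℝ} (hR : 1 ≤ R) (u v : E3) :
    |prolateForm R u / ‖u‖ ^ 3 - prolateForm R v / ‖v‖ ^ 3|
      ≤ 10 * ‖u - v‖ ^ (3 / 4 : ℝ) * (‖u‖ ^ (-(7 / 4) : ℝ) + ‖v‖ ^ (-(7 / 4) : ℝ)) := by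
  wlog h : ‖u‖ ≤ ‖v‖ generalizing u v
  · have := this v u (le_of_not_ge h)
    rwa [abs_sub_comm, norm_sub_rev, add_comm] at this
  -- At u = 0 both the quotient and 0^(-7/4) are 0 by convention, so the term of v alone has to
  -- dominate the quotient at v, which is at most 1/‖v‖.
  rcases eq_or_ne u 0 with rfl | hu
  · rcases eq_or_ne v 0 with rfl | hv
    · simp [prolateForm]
    have hv0 : 0 < ‖v‖ := norm_pos_iff.2 hv
    have hq := prolateForm_le_norm_sq hR v
    have hq0 := prolateForm_nonneg R v
    have e : ‖v‖ ^ (3 / 4 : ℝ) * ‖v‖ ^ (-(7 / 4) : ℝ) = ‖v‖⁻¹ := by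
      rw [← Real.rpow_add hv0, ← Real.rpow_neg_one]
      norm_num
    rw [zero_sub, norm_neg, norm_zero, Real.zero_rpow (by norm_num), zero_add, mul_assoc, e]
    simp only [prolateForm, PiLp.zero_apply]
    rw [← prolateForm]
    simp only [ne_eq, OfNat.ofNat_ne_zero, not_false_eq_true, zero_pow, zero_div, add_zero,
      zero_sub, abs_neg]
    rw [abs_of_nonneg (by positivity), div_le_iff₀ (by positivity)]
    calc prolateForm R v ≤ ‖v‖ ^ 2 := hq
      _ ≤ 10 * ‖v‖ ^ 2 := by nlinarith [sq_nonneg ‖v‖]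
      _ = _ := by field_simp
  · have hu0 : 0 < ‖u‖ := norm_pos_iff.2 hu
    refine (abs_div_pow_three_sub_le hu0 h (prolateForm_nonneg R u) (prolateForm_le_norm_sq hR u)
      (abs_prolateForm_sub_le hR u v) ?_ (norm_sub_le u v)).trans ?_
    · rw [norm_sub_rev]
      exact norm_sub_norm_le v u
    · gcongr
      have : 0 ≤ ‖v‖ ^ (-(7 / 4) : ℝ) := by positivity
      linarith

theorem abs_symKernel_sub_le {R : ℝ} (hR : 1 ≤ R) (x y z : E3) :
    |symKernel R x z - symKernel R y z|
      ≤ ‖x - y‖ ^ (3 / 4 : ℝ) * (‖x - z‖ ^ (-(7 / 4) : ℝ) + ‖y - z‖ ^ (-(7 / 4) : ℝ)) := by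
  have h := abs_prolateForm_div_sub_le hR (x - z) (y - z)
  rw [sub_sub_sub_cancel_right] at h
  -- The prefactor 1/(8π) absorbs the constant 10.
  have hpi := Real.pi_gt_three
  rw [symKernel, symKernel, ← mul_sub, abs_mul, abs_of_pos (by positivity), one_div,
    inv_mul_le_iff₀ (by positivity)]
  refine h.trans ?_
  have : 0 ≤ ‖x - y‖ ^ (3 / 4 : ℝ) * (‖x - z‖ ^ (-(7 / 4) : ℝ) + ‖y - z‖ ^ (-(7 / 4) : ℝ)) := by
    positivity
  nlinarith

theorem norm_sub_le_of_prolateForm {R : ℝ} (hR : 1 ≤ R) {x y : E3} (hx : prolateForm R x = 1)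
    (hy : prolateForm R y = 1) : ‖x - y‖ ≤ 2 * R := by
  have hR0 : 0 < R := by linarith
  have hb : ∀ z, prolateForm R z = 1 → ‖z‖ ≤ R := fun z hz => by
    have := norm_sq_le_prolateForm hR z
    rw [hz, mul_one] at this
    exact le_of_sq_le_sq this hR0.le
  calc _ ≤ ‖x‖ + ‖y‖ := norm_sub_le _ _
    _ ≤ R + R := add_le_add (hb x hx) (hb y hy)
    _ = _ := by ring

/-- The diameter is at most 2R, so a weaker singularity is dominated by the stronger one, and the
single kernel `rieszKernel` serves for all estimates. -/
theorem norm_sub_rpow_le {R : ℝ} (hR : 1 ≤ R) {x y : E3} (hx : prolateForm R x = 1)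
    (hy : prolateForm R y = 1) :
    ‖x - y‖ ^ (-(3 / 2) : ℝ) ≤ 2 * R * ‖x - y‖ ^ (-(7 / 4) : ℝ) := by
  have hR0 : 0 < R := by linarith
  rcases eq_or_ne x y with rfl | hxy
  · simp only [sub_self, norm_zero]
    rw [Real.zero_rpow (by norm_num), Real.zero_rpow (by norm_num)]
    simp
  have h0 : 0 < ‖x - y‖ := norm_pos_iff.2 (sub_ne_zero.2 hxy)
  have hd := norm_sub_le_of_prolateForm hR hx hy
  calc ‖x - y‖ ^ (-(3 / 2) : ℝ) = ‖x - y‖ ^ (1 / 4 : ℝ) * ‖x - y‖ ^ (-(7 / 4) : ℝ) := by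
        rw [← Real.rpow_add h0]
        norm_num
    _ ≤ (2 * R) ^ (1 / 4 : ℝ) * ‖x - y‖ ^ (-(7 / 4) : ℝ) := by gcongr
    _ ≤ _ := by
        gcongr
        exact Real.rpow_le_self_of_one_le (by linarith) (by norm_num)

/-! ### The potential operator from `L²` to `H^{1/2}` -/

/-- The double layer potential on the spheroid, relative to `coneMeasure`. -/
noncomputable def layerPotential (R : ℝ) (f : E3 → ℂ) (x : E3) : ℂ :=
  ∫ y, (symKernel R x y : ℂ) * f y ∂coneMeasure R

theorem stronglyMeasurable_layerPotential (R : ℝ) {f : E3 → ℂ} (hf : StronglyMeasurable f) :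
    StronglyMeasurable (layerPotential R f) := by
  refine StronglyMeasurable.integral_prod_right'
    (f := fun z : E3 × E3 => (symKernel R z.1 z.2 : ℂ) * f z.2) ?_
  exact (Complex.measurable_ofReal.comp (measurable_symKernel R)).stronglyMeasurable.mul
    (hf.comp_measurable measurable_snd)

theorem enorm_symKernel_mul (R : ℝ) (x y : E3) (w : ℂ) :
    ‖(symKernel R x y : ℂ) * w‖ₑ = ENNReal.ofReal (symKernel R x y) * ‖w‖ₑ := by
  rw [enorm_mul, ← ofReal_norm, Complex.norm_real, Real.norm_eq_abs,
    abs_of_nonneg (symKernel_nonneg R x y)]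

theorem enorm_layerPotential_le (R : ℝ) (f : E3 → ℂ) (x : E3) :
    ‖layerPotential R f x‖ₑ
      ≤ ∫⁻ y, ENNReal.ofReal (symKernel R x y) * ‖f y‖ₑ ∂coneMeasure R := by
  refine (enorm_integral_le_lintegral_enorm _).trans_eq (lintegral_congr fun y => ?_)
  rw [enorm_symKernel_mul]

theorem lintegral_sq_symKernel_le {R : ℝ} (hR : 1 ≤ R) {f : E3 → ℂ} (hf : StronglyMeasurable f) :
    ∫⁻ x, (∫⁻ y, ENNReal.ofReal (symKernel R x y) * ‖f y‖ₑ ∂coneMeasure R) ^ 2 ∂coneMeasure R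
      ≤ ENNReal.ofReal (1 / 2) * (ENNReal.ofReal (1 / 2) * ∫⁻ y, ‖f y‖ₑ ^ 2 ∂coneMeasure R) := by
  refine lintegral_sq_lintegral_mul_le (coneMeasure R) (measurable_symKernel R).ennreal_ofReal
    hf.enorm ?_ ?_
  · filter_upwards [ae_coneMeasure_prolateForm R] with x hx
    exact lintegral_symKernel_le hR hx
  · filter_upwards [ae_coneMeasure_prolateForm R] with y hy
    simp only [symKernel_comm R _ y]
    exact lintegral_symKernel_le hR hy

theorem lintegral_layerPotential_sq_le {R : ℝ} (hR : 1 ≤ R) {f : E3 → ℂ}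
    (hf : StronglyMeasurable f) :
    ∫⁻ x, ‖layerPotential R f x‖ₑ ^ 2 ∂coneMeasure R
      ≤ ENNReal.ofReal (1 / 2) * (ENNReal.ofReal (1 / 2) * ∫⁻ y, ‖f y‖ₑ ^ 2 ∂coneMeasure R) := by
  refine le_trans (lintegral_mono fun x => ?_) (lintegral_sq_symKernel_le hR hf)
  exact pow_le_pow_left' (enorm_layerPotential_le R f x) 2

theorem ae_integrable_symKernel_mul {R : ℝ} (hR : 1 ≤ R) {f : E3 → ℂ} (hf : StronglyMeasurable f)
    (hf2 : ∫⁻ y, ‖f y‖ₑ ^ 2 ∂coneMeasure R ≠ ⊤) :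
    ∀ᵐ x ∂coneMeasure R, Integrable (fun y => (symKernel R x y : ℂ) * f y) (coneMeasure R) := by
  have h := (lintegral_sq_symKernel_le hR hf).trans_lt (by finiteness)
  have hm : Measurable fun x =>
      ∫⁻ y, ENNReal.ofReal (symKernel R x y) * ‖f y‖ₑ ∂coneMeasure R := by
    refine Measurable.lintegral_prod_right'
      (f := fun z : E3 × E3 => ENNReal.ofReal (symKernel R z.1 z.2) * ‖f z.2‖ₑ) ?_
    exact (measurable_symKernel R).ennreal_ofReal.mul (hf.enorm.comp measurable_snd)
  filter_upwards [ae_lt_top (hm.pow_const 2) h.ne] with x hx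
  refine ⟨?_, ?_⟩
  · exact ((Complex.measurable_ofReal.comp ((measurable_symKernel R).comp
      measurable_prodMk_left)).stronglyMeasurable.mul hf).aestronglyMeasurable
  · rw [hasFiniteIntegral_iff_enorm]
    simp only [enorm_symKernel_mul]
    exact (ENNReal.pow_lt_top_iff.1 hx).resolve_right two_ne_zero

theorem ENNReal.add_sq_le (a b : ENNReal) : (a + b) ^ 2 ≤ 2 * (a ^ 2 + b ^ 2) := by
  have h := ENNReal.rpow_add_le_mul_rpow_add_rpow a b (p := 2) one_le_two
  simp only [ENNReal.rpow_two] at h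
  rwa [show (2 : ℝ) - 1 = 1 by norm_num, ENNReal.rpow_one] at h

/-- Absolute value potential of the weakly singular kernel `|x - y|^(-7/4)`. -/
noncomputable def rieszPotential (R : ℝ) (f : E3 → ℂ) (x : E3) : ENNReal :=
  ∫⁻ z, rieszKernel x z * ‖f z‖ₑ ∂coneMeasure R

theorem measurable_rieszPotential (R : ℝ) {f : E3 → ℂ} (hf : StronglyMeasurable f) :
    Measurable (rieszPotential R f) :=
  Measurable.lintegral_prod_right' (f := fun z : E3 × E3 => rieszKernel z.1 z.2 * ‖f z.2‖ₑ)
    (measurable_rieszKernel.mul (hf.enorm.comp measurable_snd))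

theorem enorm_layerPotential_sub_le {R : ℝ} (hR : 1 ≤ R) {f : E3 → ℂ} (hf : StronglyMeasurable f)
    {x y : E3} (hx : Integrable (fun z => (symKernel R x z : ℂ) * f z) (coneMeasure R))
    (hy : Integrable (fun z => (symKernel R y z : ℂ) * f z) (coneMeasure R)) :
    ‖layerPotential R f x - layerPotential R f y‖ₑ
      ≤ ENNReal.ofReal (‖x - y‖ ^ (3 / 4 : ℝ)) * (rieszPotential R f x + rieszPotential R f y) := by
  have hm : ∀ x, Measurable fun z => rieszKernel x z * ‖f z‖ₑ := fun x => by
    have := hf.enorm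
    unfold rieszKernel
    fun_prop
  rw [layerPotential, layerPotential, ← integral_sub hx hy, rieszPotential, rieszPotential,
    ← lintegral_add_left (hm x), ← lintegral_const_mul' _ _ ENNReal.ofReal_ne_top]
  refine (enorm_integral_le_lintegral_enorm _).trans (lintegral_mono fun z => ?_)
  rw [← sub_mul, enorm_mul, ← add_mul, ← mul_assoc]
  gcongr
  rw [← Complex.ofReal_sub, ← ofReal_norm, Complex.norm_real, Real.norm_eq_abs,
    rieszKernel, rieszKernel, ← ENNReal.ofReal_add (by positivity) (by positivity),
    ← ENNReal.ofReal_mul (by positivity)]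
  exact ENNReal.ofReal_le_ofReal (abs_symKernel_sub_le hR x y z)

/-- The Hölder gain leaves |x - y|^(3/4 - 3/2) in the quotient, hence |x - y|^(-3/2) after squaring,
which is still integrable on the surface. -/
theorem enorm_halfQuotient_sq_le {R : ℝ} (hR : 1 ≤ R) {x y : E3} (hx : prolateForm R x = 1)
    (hy : prolateForm R y = 1) {g : E3 → ℂ} {U : E3 → ENNReal}
    (h : ‖g x - g y‖ₑ ≤ ENNReal.ofReal (‖x - y‖ ^ (3 / 4 : ℝ)) * (U x + U y)) :
    ‖halfQuotient g (x, y)‖ₑ ^ 2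
      ≤ ENNReal.ofReal (4 * R) * (rieszKernel x y * (U x ^ 2 + U y ^ 2)) := by
  rcases eq_or_ne x y with rfl | hxy
  · simp [halfQuotient]
  have h0 : 0 < ‖x - y‖ := norm_pos_iff.2 (sub_ne_zero.2 hxy)
  have hR0 : 0 < R := by linarith
  have e1 : ‖halfQuotient g (x, y)‖ₑ
      = ENNReal.ofReal (‖x - y‖ ^ (-(3 / 2) : ℝ)) * ‖g x - g y‖ₑ := by
    rw [halfQuotient, div_eq_mul_inv, enorm_mul, mul_comm, ← Complex.ofReal_inv,
      ← Real.rpow_neg h0.le, ← ofReal_norm (((_ : ℝ) : ℂ)), Complex.norm_real,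
      Real.norm_eq_abs, abs_of_nonneg (by positivity)]
  have e2 : ‖halfQuotient g (x, y)‖ₑ
      ≤ ENNReal.ofReal (‖x - y‖ ^ (-(3 / 4) : ℝ)) * (U x + U y) := by
    rw [e1]
    refine (mul_le_mul_right h _).trans_eq ?_
    rw [← mul_assoc, ← ENNReal.ofReal_mul (by positivity), ← Real.rpow_add h0]
    norm_num
  calc _ ≤ _ := pow_le_pow_left' e2 2
    _ = ENNReal.ofReal (‖x - y‖ ^ (-(3 / 2) : ℝ)) * (U x + U y) ^ 2 := by
        rw [mul_pow, ← ENNReal.ofReal_pow (by positivity), ← Real.rpow_natCast,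
          ← Real.rpow_mul h0.le]
        norm_num
    _ ≤ ENNReal.ofReal (2 * R * ‖x - y‖ ^ (-(7 / 4) : ℝ)) * (2 * (U x ^ 2 + U y ^ 2)) := by
        gcongr
        · exact norm_sub_rpow_le hR hx hy
        · exact ENNReal.add_sq_le _ _
    _ = _ := by
        rw [ENNReal.ofReal_mul (by positivity), ← rieszKernel, show 4 * R = 2 * R * 2 by ring,
          ENNReal.ofReal_mul (by positivity) (q := 2)]
        norm_num
        ring

/-- The Gagliardo seminorm of a layer potential is bounded by the `L²` norm of its density. -/
theorem exists_lintegral_halfQuotient_layerPotential_le {R : ℝ} (hR : 1 ≤ R) :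
    ∃ C : ENNReal, C ≠ ⊤ ∧ ∀ f : E3 → ℂ, StronglyMeasurable f →
      ∫⁻ y, ‖f y‖ₑ ^ 2 ∂coneMeasure R ≠ ⊤ →
      ∫⁻ z, ‖halfQuotient (layerPotential R f) z‖ₑ ^ 2 ∂(coneMeasure R).prod (coneMeasure R)
        ≤ C * ∫⁻ y, ‖f y‖ₑ ^ 2 ∂coneMeasure R := by
  obtain ⟨A, hA, hAx⟩ := exists_lintegral_rieszKernel_le hR
  -- Two factors A come from Schur's test for U and the third from integrating out the variable on
  -- which U does not depend; the 2 counts the terms U(x)² and U(y)².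
  refine ⟨ENNReal.ofReal (4 * R) * (2 * (A * (A * A))), by finiteness, fun f hf hf2 => ?_⟩
  set τ := coneMeasure R with hτ
  set U := rieszPotential R f with hU
  have hUm : Measurable U := measurable_rieszPotential R hf
  have hN := measurable_rieszKernel
  have hA1 : ∀ᵐ x ∂τ, ∫⁻ y, rieszKernel x y ∂τ ≤ A := by
    filter_upwards [ae_coneMeasure_prolateForm R] with x hx using hAx x hx
  have hA2 : ∀ᵐ y ∂τ, ∫⁻ x, rieszKernel x y ∂τ ≤ A := by
    filter_upwards [ae_coneMeasure_prolateForm R] with x hx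
    simp only [rieszKernel_comm _ x]
    exact hAx x hx
  have hU2 : ∫⁻ x, U x ^ 2 ∂τ ≤ A * (A * ∫⁻ y, ‖f y‖ₑ ^ 2 ∂τ) :=
    lintegral_sq_lintegral_mul_le τ hN hf.enorm hA1 hA2
  have hgood : ∀ᵐ x ∂τ, prolateForm R x = 1 ∧
      Integrable (fun y => (symKernel R x y : ℂ) * f y) τ :=
    (ae_coneMeasure_prolateForm R).and (ae_integrable_symKernel_mul hR hf hf2)
  have hgood2 : ∀ᵐ z ∂τ.prod τ, ‖halfQuotient (layerPotential R f) z‖ₑ ^ 2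
      ≤ ENNReal.ofReal (4 * R) * (rieszKernel z.1 z.2 * (U z.1 ^ 2 + U z.2 ^ 2)) := by
    filter_upwards [Measure.quasiMeasurePreserving_fst.ae hgood,
      Measure.quasiMeasurePreserving_snd.ae hgood] with z h1 h2
    exact enorm_halfQuotient_sq_le hR h1.1 h2.1 (enorm_layerPotential_sub_le hR hf h1.2 h2.2)
  have hI1 : ∫⁻ z, rieszKernel z.1 z.2 * U z.1 ^ 2 ∂τ.prod τ ≤ A * ∫⁻ x, U x ^ 2 ∂τ := by
    rw [lintegral_prod _ (by fun_prop), ← lintegral_const_mul _ (by fun_prop)]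
    refine lintegral_mono_ae (hA1.mono fun x hx => ?_)
    have hNx : Measurable fun y => rieszKernel x y := by unfold rieszKernel; fun_prop
    dsimp only
    rw [lintegral_mul_const _ hNx]
    gcongr
  have hI2 : ∫⁻ z, rieszKernel z.1 z.2 * U z.2 ^ 2 ∂τ.prod τ ≤ A * ∫⁻ x, U x ^ 2 ∂τ := by
    rw [lintegral_prod_symm _ (by fun_prop), ← lintegral_const_mul _ (by fun_prop)]
    refine lintegral_mono_ae (hA2.mono fun y hy => ?_)
    have hNy : Measurable fun x => rieszKernel x y := by unfold rieszKernel; fun_prop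
    dsimp only
    rw [lintegral_mul_const _ hNy]
    gcongr
  calc _ ≤ ∫⁻ z, ENNReal.ofReal (4 * R) * (rieszKernel z.1 z.2 * (U z.1 ^ 2 + U z.2 ^ 2))
          ∂τ.prod τ := lintegral_mono_ae hgood2
    _ = ENNReal.ofReal (4 * R) * (∫⁻ z, rieszKernel z.1 z.2 * U z.1 ^ 2 ∂τ.prod τ
          + ∫⁻ z, rieszKernel z.1 z.2 * U z.2 ^ 2 ∂τ.prod τ) := by
        rw [lintegral_const_mul _ (by fun_prop), ← lintegral_add_left (by fun_prop)]
        simp only [mul_add]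
    _ ≤ ENNReal.ofReal (4 * R) * (A * (A * (A * ∫⁻ y, ‖f y‖ₑ ^ 2 ∂τ))
          + A * (A * (A * ∫⁻ y, ‖f y‖ₑ ^ 2 ∂τ))) := by
        gcongr
        · exact hI1.trans (by gcongr)
        · exact hI2.trans (by gcongr)
    _ = _ := by ring

/-! ### Factorization of the Neumann–Poincaré operator through `L²` -/

/-- The element of `H^{1/2}` with given underlying function. -/
noncomputable def HHalf.mk {σ : Measure E3} [SFinite σ] (g : E3 → ℂ) (hg : MemLp g 2 σ)
    (hq : MemLp (halfQuotient g) 2 (σ.prod σ)) : HHalf σ :=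
  ⟨WithLp.toLp 2 (hg.toLp g, hq.toLp (halfQuotient g)), by
    have h := hg.coeFn_toLp
    refine hq.coeFn_toLp.trans ?_
    filter_upwards [Measure.quasiMeasurePreserving_fst.ae h,
      Measure.quasiMeasurePreserving_snd.ae h] with z h1 h2
    simp only [halfQuotient]
    rw [← h1, ← h2]
    rfl⟩

theorem HHalf.coeFn_toLp_mk {σ : Measure E3} [SFinite σ] (g : E3 → ℂ) (hg : MemLp g 2 σ)
    (hq : MemLp (halfQuotient g) 2 (σ.prod σ)) : HHalf.toLp (HHalf.mk g hg hq) =ᵐ[σ] g :=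
  hg.coeFn_toLp

theorem HHalf.norm_mk_sq {σ : Measure E3} [SFinite σ] (g : E3 → ℂ) (hg : MemLp g 2 σ)
    (hq : MemLp (halfQuotient g) 2 (σ.prod σ)) :
    ‖HHalf.mk g hg hq‖ ^ 2 = ‖hg.toLp g‖ ^ 2 + ‖hq.toLp (halfQuotient g)‖ ^ 2 :=
  WithLp.prod_norm_sq_eq_of_L2 _

theorem norm_sq_le_of_enorm_sq_le {E F : Type*} [NormedAddCommGroup E] [NormedAddCommGroup F]
    {a : E} {b : F} {C : ENNReal} (hC : C ≠ ⊤) (h : ‖a‖ₑ ^ 2 ≤ C * ‖b‖ₑ ^ 2) :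
    ‖a‖ ^ 2 ≤ C.toReal * ‖b‖ ^ 2 := by
  have h2 := ENNReal.toReal_mono (by finiteness) h
  simpa using h2

theorem MeasureTheory.Lp.lintegral_enorm_sq_ne_top {α E : Type*} [MeasurableSpace α]
    [NormedAddCommGroup E] {μ : Measure α} (f : Lp E 2 μ) : ∫⁻ x, ‖f x‖ₑ ^ 2 ∂μ ≠ ⊤ := by
  rw [← Lp.enorm_sq_eq]
  finiteness

theorem MeasureTheory.enorm_toLp_sq {α E : Type*} [MeasurableSpace α] [NormedAddCommGroup E]
    {μ : Measure α} {f : α → E} (hf : MemLp f 2 μ) :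
    ‖hf.toLp f‖ₑ ^ 2 = ∫⁻ x, ‖f x‖ₑ ^ 2 ∂μ := by
  rw [Lp.enorm_toLp, eLpNorm_two_sq]

theorem layerPotential_congr (R : ℝ) {f g : E3 → ℂ} (h : f =ᵐ[coneMeasure R] g) :
    layerPotential R f = layerPotential R g := by
  funext x
  exact integral_congr_ae (h.mono fun y hy => by simp only [hy])

theorem measurable_halfQuotient {g : E3 → ℂ} (hg : Measurable g) : Measurable (halfQuotient g) := by
  unfold halfQuotient
  fun_prop

theorem memLp_layerPotential {R : ℝ} (hR : 1 ≤ R) (f : Lp ℂ 2 (coneMeasure R)) :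
    MemLp (layerPotential R f) 2 (coneMeasure R) := by
  have hf := Lp.stronglyMeasurable f
  refine memLp_two_of_lintegral (stronglyMeasurable_layerPotential R hf).aestronglyMeasurable ?_
  have h2 := Lp.lintegral_enorm_sq_ne_top f
  exact ((lintegral_layerPotential_sq_le hR hf).trans_lt (by finiteness)).ne

theorem memLp_halfQuotient_layerPotential {R : ℝ} (hR : 1 ≤ R) (f : Lp ℂ 2 (coneMeasure R)) :
    MemLp (halfQuotient (layerPotential R f)) 2 ((coneMeasure R).prod (coneMeasure R)) := by
  have hf := Lp.stronglyMeasurable f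
  refine memLp_two_of_lintegral (measurable_halfQuotient
    (stronglyMeasurable_layerPotential R hf).measurable).aestronglyMeasurable ?_
  have h2 := Lp.lintegral_enorm_sq_ne_top f
  obtain ⟨C, hC, h⟩ := exists_lintegral_halfQuotient_layerPotential_le hR
  exact ((h f hf h2).trans_lt (by finiteness)).ne

theorem layerPotential_add {R : ℝ} (hR : 1 ≤ R) (f g : Lp ℂ 2 (coneMeasure R)) :
    layerPotential R (f + g : Lp ℂ 2 (coneMeasure R))
      =ᵐ[coneMeasure R] layerPotential R f + layerPotential R g := by
  rw [layerPotential_congr R (Lp.coeFn_add f g)]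
  filter_upwards [ae_integrable_symKernel_mul hR (Lp.stronglyMeasurable f)
      (Lp.lintegral_enorm_sq_ne_top f), ae_integrable_symKernel_mul hR (Lp.stronglyMeasurable g)
      (Lp.lintegral_enorm_sq_ne_top g)] with x hf hg
  simp only [layerPotential, Pi.add_apply, mul_add]
  exact integral_add hf hg

theorem layerPotential_smul (R : ℝ) (c : ℂ) (f : Lp ℂ 2 (coneMeasure R)) :
    layerPotential R (c • f : Lp ℂ 2 (coneMeasure R)) = c • layerPotential R f := by
  rw [layerPotential_congr R (Lp.coeFn_smul c f)]
  funext x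
  simp only [layerPotential, Pi.smul_apply, smul_eq_mul]
  rw [← integral_const_mul]
  simp only [mul_left_comm]

/-- The layer potential as an element of `H^{1/2}`. -/
noncomputable def potentialHHalf {R : ℝ} (hR : 1 ≤ R) (f : Lp ℂ 2 (coneMeasure R)) :
    HHalf (prolateMeasure R) :=
  HHalf.mk (layerPotential R f)
    ((memLp_layerPotential hR f).mono_measure (prolateMeasure_le R hR))
    ((memLp_halfQuotient_layerPotential hR f).mono_measure
      (Measure.prod_mono (prolateMeasure_le R hR) (prolateMeasure_le R hR)))

theorem coeFn_potentialHHalf {R : ℝ} (hR : 1 ≤ R) (f : Lp ℂ 2 (coneMeasure R)) :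
    HHalf.toLp (potentialHHalf hR f) =ᵐ[prolateMeasure R] layerPotential R f :=
  HHalf.coeFn_toLp_mk _ _ _

theorem exists_norm_potentialHHalf_le {R : ℝ} (hR : 1 ≤ R) :
    ∃ C : ℝ, ∀ f, ‖potentialHHalf hR f‖ ≤ C * ‖f‖ := by
  obtain ⟨C, hC, h⟩ := exists_lintegral_halfQuotient_layerPotential_le hR
  set c : ENNReal := ENNReal.ofReal (1 / 2) * ENNReal.ofReal (1 / 2)
  have hc : c ≠ ⊤ := by finiteness
  refine ⟨Real.sqrt (c.toReal + C.toReal), fun f => ?_⟩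
  have hσ := prolateMeasure_le R hR
  have h1 := norm_sq_le_of_enorm_sq_le (b := f) hc
    (a := ((memLp_layerPotential hR f).mono_measure hσ).toLp _) (by
      rw [enorm_toLp_sq, Lp.enorm_sq_eq, mul_assoc]
      exact (lintegral_mono' hσ le_rfl).trans
        (lintegral_layerPotential_sq_le hR (Lp.stronglyMeasurable f)))
  have h2 := norm_sq_le_of_enorm_sq_le (b := f) hC
    (a := ((memLp_halfQuotient_layerPotential hR f).mono_measure
      (Measure.prod_mono hσ hσ)).toLp _) (by
      rw [enorm_toLp_sq, Lp.enorm_sq_eq]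
      exact (lintegral_mono' (Measure.prod_mono hσ hσ) le_rfl).trans
        (h f (Lp.stronglyMeasurable f) (Lp.lintegral_enorm_sq_ne_top f)))
  refine le_of_sq_le_sq ?_ (by positivity)
  rw [potentialHHalf, HHalf.norm_mk_sq, mul_pow, Real.sq_sqrt (by positivity), add_mul]
  exact add_le_add h1 h2

/-- The layer potential as a bounded operator from `L²` to `H^{1/2}`. -/
noncomputable def potentialCLM {R : ℝ} (hR : 1 ≤ R) :
    Lp ℂ 2 (coneMeasure R) →L[ℂ] HHalf (prolateMeasure R) :=
  LinearMap.mkContinuousOfExistsBound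
    { toFun := potentialHHalf hR
      map_add' := fun f g => by
        apply HHalf.toLp_injective
        apply Lp.ext
        refine (coeFn_potentialHHalf hR _).trans ?_
        refine ((prolateMeasure_absolutelyContinuous hR).ae_eq (layerPotential_add hR f g)).trans ?_
        refine EventuallyEq.trans ?_ (Lp.coeFn_add (HHalf.toLp (potentialHHalf hR f))
          (HHalf.toLp (potentialHHalf hR g))).symm
        exact ((coeFn_potentialHHalf hR f).add (coeFn_potentialHHalf hR g)).symm
      map_smul' := fun c f => by
        apply HHalf.toLp_injective
        apply Lp.ext
        refine (coeFn_potentialHHalf hR _).trans ?_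
        rw [layerPotential_smul]
        refine EventuallyEq.trans ?_ (Lp.coeFn_smul c (HHalf.toLp (potentialHHalf hR f))).symm
        exact ((coeFn_potentialHHalf hR f).const_smul c).symm }
    (exists_norm_potentialHHalf_le hR)

theorem coeFn_potentialCLM {R : ℝ} (hR : 1 ≤ R) (f : Lp ℂ 2 (coneMeasure R)) :
    HHalf.toLp (potentialCLM hR f) =ᵐ[prolateMeasure R] layerPotential R f :=
  coeFn_potentialHHalf hR f

/-- The `L²` class, with respect to `coneMeasure`, of an element of `H^{1/2}`. -/
noncomputable def embedL2 {R : ℝ} (hR : 1 ≤ R) (f : HHalf (prolateMeasure R)) :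
    Lp ℂ 2 (coneMeasure R) :=
  ((Lp.memLp (HHalf.toLp f)).of_measure_le_smul ENNReal.ofReal_ne_top (coneMeasure_le R hR)).toLp _

theorem coeFn_embedL2 {R : ℝ} (hR : 1 ≤ R) (f : HHalf (prolateMeasure R)) :
    embedL2 hR f =ᵐ[coneMeasure R] HHalf.toLp f :=
  MemLp.coeFn_toLp _

theorem norm_embedL2_le {R : ℝ} (hR : 1 ≤ R) (f : HHalf (prolateMeasure R)) :
    ‖embedL2 hR f‖ ≤ Real.sqrt R * ‖f‖ := by
  have hR0 : 0 ≤ R := by linarith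
  have h1 := norm_sq_le_of_enorm_sq_le (b := HHalf.toLp f) (C := ENNReal.ofReal R)
    ENNReal.ofReal_ne_top (a := embedL2 hR f) (by
      rw [embedL2, enorm_toLp_sq, Lp.enorm_sq_eq, ← smul_eq_mul, ← lintegral_smul_measure]
      exact lintegral_mono' (coneMeasure_le R hR) le_rfl)
  have h2 : ‖HHalf.toLp f‖ ≤ ‖f‖ := WithLp.norm_fst_le _ f.1
  refine le_of_sq_le_sq ?_ (by positivity)
  rw [mul_pow, Real.sq_sqrt hR0]
  rw [ENNReal.toReal_ofReal hR0] at h1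
  exact h1.trans (by gcongr)

/-- The inclusion of `H^{1/2}` into `L²`. -/
noncomputable def embedCLM {R : ℝ} (hR : 1 ≤ R) :
    HHalf (prolateMeasure R) →L[ℂ] Lp ℂ 2 (coneMeasure R) :=
  LinearMap.mkContinuousOfExistsBound
    { toFun := embedL2 hR
      map_add' := fun f g => by
        apply Lp.ext
        refine (coeFn_embedL2 hR _).trans ?_
        refine ((coneMeasure_absolutelyContinuous hR).ae_eq
          (Lp.coeFn_add (HHalf.toLp f) (HHalf.toLp g))).trans ?_
        refine EventuallyEq.trans ?_ (Lp.coeFn_add _ _).symm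
        exact ((coeFn_embedL2 hR f).add (coeFn_embedL2 hR g)).symm
      map_smul' := fun c f => by
        apply Lp.ext
        refine (coeFn_embedL2 hR _).trans ?_
        refine ((coneMeasure_absolutelyContinuous hR).ae_eq
          (Lp.coeFn_smul c (HHalf.toLp f))).trans ?_
        refine EventuallyEq.trans ?_ (Lp.coeFn_smul _ _).symm
        exact ((coeFn_embedL2 hR f).const_smul c).symm }
    ⟨_, norm_embedL2_le hR⟩

theorem coeFn_embedCLM {R : ℝ} (hR : 1 ≤ R) (f : HHalf (prolateMeasure R)) :
    embedCLM hR f =ᵐ[coneMeasure R] HHalf.toLp f :=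
  coeFn_embedL2 hR f

/-- The Neumann–Poincaré operator on `H^{1/2}` of the spheroid. -/
noncomputable def npOperator {R : ℝ} (hR : 1 ≤ R) :
    HHalf (prolateMeasure R) →L[ℂ] HHalf (prolateMeasure R) :=
  potentialCLM hR ∘L embedCLM hR

theorem isNPOperator_npOperator {R : ℝ} (hR : 1 ≤ R) :
    IsNPOperator (prolateMeasure R) (prolateNormal R) (npOperator hR) := by
  intro f
  have hf := coeFn_embedCLM hR f
  filter_upwards [coeFn_potentialCLM hR (embedCLM hR f),
    (prolateMeasure_absolutelyContinuous hR).ae_le (ae_coneMeasure_prolateForm R),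
    (prolateMeasure_absolutelyContinuous hR).ae_le (ae_integrable_symKernel_mul hR
      (Lp.stronglyMeasurable (embedCLM hR f)) (Lp.lintegral_enorm_sq_ne_top _))] with x h1 hx h2
  obtain ⟨h3, h4⟩ := npKernel_integral hR hx (HHalf.toLp f)
  refine ⟨h3.2 (h2.congr (hf.mono fun y hy => by simp only [hy])), ?_⟩
  rw [h4, npOperator, ContinuousLinearMap.comp_apply, h1, layerPotential_congr R hf]
  rfl

/-- The symmetrized Neumann–Poincaré operator on `L²`. -/
noncomputable def symOperator {R : ℝ} (hR : 1 ≤ R) :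
    Lp ℂ 2 (coneMeasure R) →L[ℂ] Lp ℂ 2 (coneMeasure R) :=
  embedCLM hR ∘L potentialCLM hR

theorem coeFn_symOperator {R : ℝ} (hR : 1 ≤ R) (f : Lp ℂ 2 (coneMeasure R)) :
    symOperator hR f =ᵐ[coneMeasure R] layerPotential R f :=
  (coeFn_embedCLM hR _).trans
    ((coneMeasure_absolutelyContinuous hR).ae_eq (coeFn_potentialCLM hR f))

/-- Schur's test: the kernel is symmetric, so the solid-angle bound controls its rows and its
columns alike. -/
theorem norm_symOperator_le {R : ℝ} (hR : 1 ≤ R) : ‖symOperator hR‖ ≤ 1 / 2 := by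
  refine ContinuousLinearMap.opNorm_le_bound _ (by norm_num) fun f => ?_
  have h1 := norm_sq_le_of_enorm_sq_le (b := f) (a := symOperator hR f)
    (C := ENNReal.ofReal (1 / 2) * ENNReal.ofReal (1 / 2)) (by finiteness) (by
      rw [Lp.enorm_sq_eq, Lp.enorm_sq_eq, mul_assoc]
      refine le_trans (le_of_eq ?_)
        (lintegral_layerPotential_sq_le hR (Lp.stronglyMeasurable f))
      exact lintegral_congr_ae ((coeFn_symOperator hR f).mono fun x hx => by simp only [hx]))
  refine le_of_sq_le_sq (h1.trans_eq ?_) (by positivity)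
  rw [ENNReal.toReal_mul, ENNReal.toReal_ofReal (by norm_num)]
  ring

/-! ### Spectra of the two products of two operators -/

/-- If c inverts z - AB, then z⁻¹(1 + BcA) inverts z - BA, as the Neumann series suggests. -/
theorem isUnit_sub_comp_of_isUnit {𝕜 E F : Type*} [NontriviallyNormedField 𝕜]
    [NormedAddCommGroup E] [NormedSpace 𝕜 E] [NormedAddCommGroup F] [NormedSpace 𝕜 F]
    (A : E →L[𝕜] F) (B : F →L[𝕜] E) {z : 𝕜} (hz : z ≠ 0)
    (h : IsUnit (algebraMap 𝕜 (F →L[𝕜] F) z - A ∘L B)) :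
    IsUnit (algebraMap 𝕜 (E →L[𝕜] E) z - B ∘L A) := by
  obtain ⟨c, h1, h2⟩ := isUnit_iff_exists.1 h
  have h1' : ∀ y, z • c y - A (B (c y)) = y := fun y => by
    simpa [Algebra.algebraMap_eq_smul_one] using DFunLike.congr_fun h1 y
  have h2' : ∀ y, z • c y - c (A (B y)) = y := fun y => by
    simpa [Algebra.algebraMap_eq_smul_one] using DFunLike.congr_fun h2 y
  refine isUnit_iff_exists.2 ⟨z⁻¹ • (1 + B ∘L c ∘L A), ?_, ?_⟩
  · ext x
    have := congrArg B (h1' (A x))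
    rw [map_sub, map_smul] at this
    simp only [Algebra.algebraMap_eq_smul_one, mul_apply_eq_comp, sub_apply, smul_apply,
      one_apply_eq_self, add_apply, ContinuousLinearMap.comp_apply, map_smul, map_add]
    rw [← this]
    simp only [smul_add, smul_sub, smul_smul, inv_mul_cancel₀ hz, one_smul]
    abel
  · ext x
    have := congrArg B (h2' (A x))
    rw [map_sub, map_smul] at this
    simp only [Algebra.algebraMap_eq_smul_one, mul_apply_eq_comp, sub_apply, smul_apply,
      one_apply_eq_self, add_apply, ContinuousLinearMap.comp_apply, map_smul, map_sub]
    rw [← sub_eq_iff_eq_add.1 this, smul_smul, smul_smul, mul_inv_cancel₀ hz, inv_mul_cancel₀ hz,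
      one_smul, one_smul, add_sub_cancel_right]

theorem mem_spectrum_comp_comm {𝕜 E F : Type*} [NontriviallyNormedField 𝕜]
    [NormedAddCommGroup E] [NormedSpace 𝕜 E] [NormedAddCommGroup F] [NormedSpace 𝕜 F]
    (A : E →L[𝕜] F) (B : F →L[𝕜] E) {z : 𝕜} (hz : z ≠ 0) :
    z ∈ spectrum 𝕜 (B ∘L A) ↔ z ∈ spectrum 𝕜 (A ∘L B) := by
  rw [spectrum.mem_iff, spectrum.mem_iff, not_iff_not]
  exact ⟨isUnit_sub_comp_of_isUnit B A hz, isUnit_sub_comp_of_isUnit A B hz⟩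

/-- Moves the question from H^{1/2}, whose inner product does not symmetrize the operator in an
evident way, to a selfadjoint operator on L². The excluded point 0 is harmless: it belongs to [0,
1/2], and density is needed only near positive values. -/
theorem mem_spectrum_npOperator {R : ℝ} (hR : 1 ≤ R) {z : ℂ} (hz : z ≠ 0) :
    z ∈ spectrum ℂ (npOperator hR) ↔ z ∈ spectrum ℂ (symOperator hR) :=
  mem_spectrum_comp_comm (embedCLM hR) (potentialCLM hR) hz

/-! ### Gaussian integrals -/

theorem integrable_sq_mul_exp_neg_mul_sq {b : ℝ} (hb : 0 < b) :
    Integrable fun r : ℝ => r ^ 2 * Real.exp (-b * r ^ 2) := by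
  simpa using integrable_rpow_mul_exp_neg_mul_sq hb (s := 2) (by norm_num)

theorem integral_Ioi_sq_mul_exp_neg_mul_sq {b : ℝ} (hb : 0 < b) :
    ∫ r in Ioi (0 : ℝ), r ^ 2 * Real.exp (-b * r ^ 2) = Real.sqrt (Real.pi / b) / (4 * b) := by
  have h := integral_rpow_mul_exp_neg_mul_rpow two_pos (q := 2) (by norm_num) hb
  simp only [Real.rpow_two] at h
  rw [h, show ((2 : ℝ) + 1) / 2 = 3 / 2 by norm_num, Real.Gamma_three_halves,
    show (-((2 : ℝ) + 1) / 2) = -(1 / 2) - 1 by norm_num, Real.rpow_sub_one hb.ne',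
    Real.rpow_neg hb.le, ← Real.sqrt_eq_rpow, Real.sqrt_div Real.pi_pos.le]
  have := Real.sqrt_pos.2 hb
  field_simp
  norm_num

theorem integral_sq_mul_exp_neg_mul_sq {b : ℝ} (hb : 0 < b) :
    ∫ r : ℝ, r ^ 2 * Real.exp (-b * r ^ 2) = Real.sqrt (Real.pi / b) / (2 * b) := by
  have h := integral_comp_abs (f := fun r : ℝ => r ^ 2 * Real.exp (-b * r ^ 2))
  simp only [sq_abs] at h
  rw [h, integral_Ioi_sq_mul_exp_neg_mul_sq hb]
  field_simp
  norm_num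

theorem E3.integrable_prod_coord {g : Fin 3 → ℝ → ℝ} (hg : ∀ i, Integrable (g i)) :
    Integrable fun w : E3 => g 0 (w 0) * g 1 (w 1) * g 2 (w 2) := by
  have h := Integrable.fintype_prod (f := g) (μ := fun _ => volume) hg
  have h2 := (PiLp.volume_preserving_ofLp (Fin 3)).integrable_comp_of_integrable h
  simp only [Fin.prod_univ_three] at h2
  exact h2

theorem E3.integral_prod_coord (g : Fin 3 → ℝ → ℝ) :
    ∫ w : E3, g 0 (w 0) * g 1 (w 1) * g 2 (w 2) = (∫ r, g 0 r) * (∫ r, g 1 r) * ∫ r, g 2 r := by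
  have h := integral_fintype_prod_volume_eq_prod (fun i => g i)
  rw [← (PiLp.volume_preserving_ofLp (Fin 3)).integral_comp
    (MeasurableEquiv.toLp 2 (Fin 3 → ℝ)).symm.measurableEmbedding] at h
  simpa only [Fin.prod_univ_three] using h

theorem E3.exp_neg_mul_norm_sq (b : ℝ) (w : E3) : Real.exp (-b * ‖w‖ ^ 2) =
    Real.exp (-b * w 0 ^ 2) * Real.exp (-b * w 1 ^ 2) * Real.exp (-b * w 2 ^ 2) := by
  rw [E3.norm_sq, ← Real.exp_add, ← Real.exp_add]
  ring_nf

theorem E3.gaussian {b : ℝ} (hb : 0 < b) :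
    Integrable (fun w : E3 => Real.exp (-b * ‖w‖ ^ 2)) ∧
      ∫ w : E3, Real.exp (-b * ‖w‖ ^ 2) = Real.sqrt (Real.pi / b) ^ 3 := by
  simp only [E3.exp_neg_mul_norm_sq]
  refine ⟨E3.integrable_prod_coord (g := fun _ r => Real.exp (-b * r ^ 2))
    fun _ => integrable_exp_neg_mul_sq hb, ?_⟩
  rw [E3.integral_prod_coord (fun _ r => Real.exp (-b * r ^ 2)), integral_gaussian]
  ring

theorem E3.gaussian_coord_sq {b : ℝ} (hb : 0 < b) (i : Fin 3) :
    Integrable (fun w : E3 => w i ^ 2 * Real.exp (-b * ‖w‖ ^ 2)) ∧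
      ∫ w : E3, w i ^ 2 * Real.exp (-b * ‖w‖ ^ 2) = Real.sqrt (Real.pi / b) ^ 3 / (2 * b) := by
  set g : Fin 3 → ℝ → ℝ := fun j r =>
    if j = i then r ^ 2 * Real.exp (-b * r ^ 2) else Real.exp (-b * r ^ 2) with hg
  have hgi : ∀ j, Integrable (g j) := fun j => by
    by_cases h : j = i
    · simpa only [hg, h, if_true] using integrable_sq_mul_exp_neg_mul_sq hb
    · simpa only [hg, h, if_false] using integrable_exp_neg_mul_sq hb
  have he : (fun w : E3 => w i ^ 2 * Real.exp (-b * ‖w‖ ^ 2))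
      = fun w : E3 => g 0 (w 0) * g 1 (w 1) * g 2 (w 2) := by
    funext w
    rw [E3.exp_neg_mul_norm_sq]
    fin_cases i <;> simp [hg] <;> ring
  rw [he]
  refine ⟨E3.integrable_prod_coord hgi, ?_⟩
  rw [E3.integral_prod_coord]
  have h1 := integral_sq_mul_exp_neg_mul_sq hb
  have h2 := integral_gaussian b
  fin_cases i <;> simp [hg] <;> simp only [neg_mul] at h1 h2 <;> rw [h1, h2] <;> ring

/-! ### The kernel as a superposition of squares -/

/-- The features `z ↦ (xᵢ - zᵢ) exp(-2 s² |x - z|²)`. -/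
noncomputable def feature (i : Fin 3) (ζ : ℝ × E3) (x : E3) : ℝ :=
  (x i - ζ.2 i) * Real.exp (-(2 * ζ.1 ^ 2) * ‖x - ζ.2‖ ^ 2)

/-- The parameter space of the features. -/
noncomputable def featureMeasure : Measure (ℝ × E3) :=
  (volume.restrict (Ioi (0 : ℝ))).prod volume

instance featureMeasure.instSFinite : SFinite featureMeasure := by
  unfold featureMeasure; infer_instance

/-- With the centre written as w plus the midpoint of x and y, |x - z|² + |y - z|² = 2|w|² + |x -
y|²/2, and the product of the linear factors is wᵢ² - (x - y)ᵢ²/4. The integral over centres thus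
becomes a Gaussian moment. -/
theorem feature_mul_feature (i : Fin 3) (s : ℝ) (x y w : E3) :
    feature i (s, w + (1 / 2 : ℝ) • (x + y)) x * feature i (s, w + (1 / 2 : ℝ) • (x + y)) y
      = Real.exp (-s ^ 2 * ‖x - y‖ ^ 2) *
        (w i ^ 2 * Real.exp (-(4 * s ^ 2) * ‖w‖ ^ 2)
          - (x - y) i ^ 2 / 4 * Real.exp (-(4 * s ^ 2) * ‖w‖ ^ 2)) := by
  have h : Real.exp (-(2 * s ^ 2) * ‖x - (w + (1 / 2 : ℝ) • (x + y))‖ ^ 2) *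
      Real.exp (-(2 * s ^ 2) * ‖y - (w + (1 / 2 : ℝ) • (x + y))‖ ^ 2)
      = Real.exp (-s ^ 2 * ‖x - y‖ ^ 2) * Real.exp (-(4 * s ^ 2) * ‖w‖ ^ 2) := by
    rw [← Real.exp_add, ← Real.exp_add]
    congr 1
    simp only [E3.norm_sq, PiLp.sub_apply, PiLp.add_apply, PiLp.smul_apply, smul_eq_mul]
    ring
  simp only [feature]
  rw [mul_mul_mul_comm, h]
  simp only [PiLp.sub_apply, PiLp.add_apply, PiLp.smul_apply, smul_eq_mul]
  ring

theorem integral_feature_mul_feature (i : Fin 3) {s : ℝ} (hs : 0 < s) (x y : E3) :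
    ∫ z, feature i (s, z) x * feature i (s, z) y
      = Real.sqrt Real.pi ^ 3 / (64 * s ^ 5) * (Real.exp (-‖x - y‖ ^ 2 * s ^ 2)
          - 2 * (x - y) i ^ 2 * (s ^ 2 * Real.exp (-‖x - y‖ ^ 2 * s ^ 2))) := by
  have hb : 0 < 4 * s ^ 2 := by positivity
  obtain ⟨i0, e0⟩ := E3.gaussian hb
  obtain ⟨i2, e2⟩ := E3.gaussian_coord_sq hb i
  rw [← integral_add_right_eq_self _ ((1 / 2 : ℝ) • (x + y))]
  simp only [feature_mul_feature]
  rw [integral_const_mul, integral_sub i2 (i0.const_mul _), integral_const_mul, e0, e2,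
    Real.sqrt_div Real.pi_pos.le, show 4 * s ^ 2 = (2 * s) ^ 2 by ring,
    Real.sqrt_sq (by positivity), show -s ^ 2 * ‖x - y‖ ^ 2 = -‖x - y‖ ^ 2 * s ^ 2 by ring]
  field_simp
  ring

theorem lintegral_feature_mul_feature_le (i : Fin 3) {s : ℝ} (hs : 0 < s) (x y : E3) :
    ∫⁻ z, ENNReal.ofReal |feature i (s, z) x * feature i (s, z) y|
      ≤ ENNReal.ofReal (Real.sqrt Real.pi ^ 3 / (64 * s ^ 5) *
        (Real.exp (-‖x - y‖ ^ 2 * s ^ 2)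
          + 2 * (x - y) i ^ 2 * (s ^ 2 * Real.exp (-‖x - y‖ ^ 2 * s ^ 2)))) := by
  have hb : 0 < 4 * s ^ 2 := by positivity
  obtain ⟨i0, e0⟩ := E3.gaussian hb
  obtain ⟨i2, e2⟩ := E3.gaussian_coord_sq hb i
  rw [← lintegral_add_right_eq_self _ ((1 / 2 : ℝ) • (x + y))]
  simp only [feature_mul_feature]
  have hi : Integrable fun w : E3 => Real.exp (-s ^ 2 * ‖x - y‖ ^ 2) *
      (w i ^ 2 * Real.exp (-(4 * s ^ 2) * ‖w‖ ^ 2)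
        + (x - y) i ^ 2 / 4 * Real.exp (-(4 * s ^ 2) * ‖w‖ ^ 2)) :=
    (i2.add (i0.const_mul _)).const_mul _
  calc _ ≤ ∫⁻ w : E3, ENNReal.ofReal (Real.exp (-s ^ 2 * ‖x - y‖ ^ 2) *
      (w i ^ 2 * Real.exp (-(4 * s ^ 2) * ‖w‖ ^ 2)
        + (x - y) i ^ 2 / 4 * Real.exp (-(4 * s ^ 2) * ‖w‖ ^ 2))) := by
        refine lintegral_mono fun w => ENNReal.ofReal_le_ofReal ?_
        rw [abs_mul, abs_of_pos (Real.exp_pos _)]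
        gcongr
        refine (abs_sub _ _).trans_eq ?_
        rw [abs_of_nonneg (by positivity), abs_of_nonneg (by positivity)]
    _ = _ := by
        rw [← ofReal_integral_eq_lintegral_ofReal hi
          (Eventually.of_forall fun w => by positivity)]
        congr 1
        rw [integral_const_mul, integral_add i2 (i0.const_mul _), integral_const_mul, e0, e2,
          Real.sqrt_div Real.pi_pos.le, show 4 * s ^ 2 = (2 * s) ^ 2 by ring,
          Real.sqrt_sq (by positivity), show -s ^ 2 * ‖x - y‖ ^ 2 = -‖x - y‖ ^ 2 * s ^ 2 by ring]
        field_simp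
        ring

/-- The weight with which the squares of the features are superposed. -/
noncomputable def featureWeight (ζ : ℝ × E3) : ℝ := 128 / Real.pi ^ 2 * ζ.1 ^ 5

theorem continuous_feature (i : Fin 3) : Continuous fun w : (ℝ × E3) × E3 => feature i w.1 w.2 := by
  unfold feature; fun_prop

theorem sqrt_pi_pow_four : Real.sqrt Real.pi ^ 4 = Real.pi ^ 2 := by
  rw [show 4 = 2 * 2 by norm_num, pow_mul, Real.sq_sqrt Real.pi_pos.le]

theorem radial_integral {d : ℝ} (hd : 0 < d) :
    IntegrableOn (fun s : ℝ => Real.exp (-d ^ 2 * s ^ 2)) (Ioi 0) ∧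
    IntegrableOn (fun s : ℝ => s ^ 2 * Real.exp (-d ^ 2 * s ^ 2)) (Ioi 0) ∧
    ∫ s in Ioi (0 : ℝ), Real.exp (-d ^ 2 * s ^ 2) = Real.sqrt Real.pi / (2 * d) ∧
    ∫ s in Ioi (0 : ℝ), s ^ 2 * Real.exp (-d ^ 2 * s ^ 2) = Real.sqrt Real.pi / (4 * d ^ 3) := by
  have hb : 0 < d ^ 2 := by positivity
  refine ⟨(integrable_exp_neg_mul_sq hb).integrableOn,
    (integrable_sq_mul_exp_neg_mul_sq hb).integrableOn, ?_, ?_⟩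
  · rw [integral_gaussian_Ioi, Real.sqrt_div Real.pi_pos.le, Real.sqrt_sq hd.le]
    field_simp
  · rw [integral_Ioi_sq_mul_exp_neg_mul_sq hb, Real.sqrt_div Real.pi_pos.le, Real.sqrt_sq hd.le]
    field_simp

/-- The absolute version of the superposition, needed to justify Fubini: with plus signs the two
radial terms contribute at most 1/|x - y| each. -/
theorem lintegral_featureWeight_le (i : Fin 3) {x y : E3} (hxy : x ≠ y) :
    ∫⁻ ζ, ENNReal.ofReal (featureWeight ζ * |feature i ζ x * feature i ζ y|) ∂featureMeasure
      ≤ ENNReal.ofReal (2 / ‖x - y‖) := by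
  have hd : 0 < ‖x - y‖ := norm_pos_iff.2 (sub_ne_zero.2 hxy)
  obtain ⟨j0, j2, f0, f2⟩ := radial_integral hd
  have hu : (x - y) i ^ 2 ≤ ‖x - y‖ ^ 2 := by
    rw [← sq_abs]
    gcongr
    exact PiLp.norm_apply_le (x - y) i
  have hpi := Real.pi_pos
  have hsq := Real.sqrt_pos.2 hpi
  have hcx : ∀ x, Continuous fun ζ : ℝ × E3 => feature i ζ x := fun x =>
    (continuous_feature i).comp (by fun_prop : Continuous fun ζ : ℝ × E3 => (ζ, x))
  have hm : Measurable fun ζ : ℝ × E3 =>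
      ENNReal.ofReal (featureWeight ζ * |feature i ζ x * feature i ζ y|) := by
    have h1 := hcx x
    have h2 := hcx y
    have : Continuous fun ζ : ℝ × E3 => featureWeight ζ * |feature i ζ x * feature i ζ y| := by
      unfold featureWeight
      fun_prop
    exact this.measurable.ennreal_ofReal
  rw [featureMeasure, lintegral_prod _ hm.aemeasurable]
  set c : ℝ := 2 / Real.sqrt Real.pi with hc
  have hi : IntegrableOn (fun s : ℝ => c * (Real.exp (-‖x - y‖ ^ 2 * s ^ 2)
      + 2 * (x - y) i ^ 2 * (s ^ 2 * Real.exp (-‖x - y‖ ^ 2 * s ^ 2)))) (Ioi 0) :=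
    (j0.add (j2.const_mul _)).const_mul _
  calc _ ≤ ∫⁻ s in Ioi (0 : ℝ), ENNReal.ofReal (c * (Real.exp (-‖x - y‖ ^ 2 * s ^ 2)
      + 2 * (x - y) i ^ 2 * (s ^ 2 * Real.exp (-‖x - y‖ ^ 2 * s ^ 2)))) := by
        refine setLIntegral_mono' measurableSet_Ioi fun s hs => ?_
        have hs0 : 0 < s := hs
        have hw : 0 ≤ 128 / Real.pi ^ 2 * s ^ 5 := by positivity
        simp only [featureWeight, ENNReal.ofReal_mul hw]
        rw [lintegral_const_mul' _ _ ENNReal.ofReal_ne_top]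
        refine (mul_le_mul_right (lintegral_feature_mul_feature_le i hs0 x y) _).trans_eq ?_
        rw [← ENNReal.ofReal_mul hw, ← mul_assoc]
        congr 2
        rw [hc, ← sqrt_pi_pow_four]
        field_simp
        norm_num
    _ = ENNReal.ofReal (c * (Real.sqrt Real.pi / (2 * ‖x - y‖)
          + 2 * (x - y) i ^ 2 * (Real.sqrt Real.pi / (4 * ‖x - y‖ ^ 3)))) := by
        rw [← ofReal_integral_eq_lintegral_ofReal hi
          (Eventually.of_forall fun s => by positivity)]
        congr 1
        rw [integral_const_mul, integral_add j0 (j2.const_mul _), integral_const_mul, f0, f2]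
    _ ≤ _ := by
        refine ENNReal.ofReal_le_ofReal ?_
        calc _ ≤ c * (Real.sqrt Real.pi / (2 * ‖x - y‖)
          + 2 * ‖x - y‖ ^ 2 * (Real.sqrt Real.pi / (4 * ‖x - y‖ ^ 3))) := by gcongr
          _ = _ := by
            rw [hc]
            field_simp
            norm_num

/-- The weight cancels the factor s^(-5) of the integral over centres and leaves (2/√π)(1 -
2s²vᵢ²)exp(-s²|v|²) with v = x - y. Integration over s > 0 gives 1/|v| - vᵢ²/|v|³ = ∂ᵢ²|v|. -/
theorem integral_featureWeight (i : Fin 3) {x y : E3} (hxy : x ≠ y) :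
    ∫ ζ, featureWeight ζ * (feature i ζ x * feature i ζ y) ∂featureMeasure
      = (‖x - y‖ ^ 2 - (x - y) i ^ 2) / ‖x - y‖ ^ 3 := by
  have hd : 0 < ‖x - y‖ := norm_pos_iff.2 (sub_ne_zero.2 hxy)
  obtain ⟨j0, j2, f0, f2⟩ := radial_integral hd
  have hsq := Real.sqrt_pos.2 Real.pi_pos
  have hcx : ∀ x, Continuous fun ζ : ℝ × E3 => feature i ζ x := fun x =>
    (continuous_feature i).comp (by fun_prop : Continuous fun ζ : ℝ × E3 => (ζ, x))
  have hi : Integrable (fun ζ : ℝ × E3 => featureWeight ζ * (feature i ζ x * feature i ζ y))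
      featureMeasure := by
    refine ⟨?_, ?_⟩
    · have h1 := hcx x
      have h2 := hcx y
      have : Continuous fun ζ : ℝ × E3 => featureWeight ζ * (feature i ζ x * feature i ζ y) := by
        unfold featureWeight
        fun_prop
      exact this.aestronglyMeasurable
    · rw [hasFiniteIntegral_iff_norm]
      refine lt_of_le_of_lt (le_trans (le_of_eq ?_) (lintegral_featureWeight_le i hxy))
        ENNReal.ofReal_lt_top
      have h0 : ∀ᵐ ζ ∂featureMeasure, 0 < ζ.1 :=
        Measure.quasiMeasurePreserving_fst.ae (ae_restrict_mem measurableSet_Ioi)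
      refine lintegral_congr_ae (h0.mono fun ζ hζ => ?_)
      have hw : 0 ≤ featureWeight ζ := by unfold featureWeight; positivity
      simp only [norm_mul, Real.norm_eq_abs, abs_mul, abs_of_nonneg hw]
  rw [featureMeasure] at hi ⊢
  rw [integral_prod _ hi]
  have h : ∀ s ∈ Ioi (0 : ℝ), ∫ z, featureWeight (s, z) * (feature i (s, z) x * feature i (s, z) y)
      = 2 / Real.sqrt Real.pi * (Real.exp (-‖x - y‖ ^ 2 * s ^ 2)
          - 2 * (x - y) i ^ 2 * (s ^ 2 * Real.exp (-‖x - y‖ ^ 2 * s ^ 2))) := by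
    intro s hs
    have hs0 : 0 < s := hs
    simp only [featureWeight]
    rw [integral_const_mul, integral_feature_mul_feature i hs0, ← mul_assoc]
    congr 1
    rw [← sqrt_pi_pow_four]
    field_simp
    norm_num
  rw [setIntegral_congr_fun measurableSet_Ioi h, integral_const_mul,
    integral_sub j0 (j2.const_mul _), integral_const_mul, f0, f2]
  field_simp
  ring

/-! ### Positivity of the symmetrized operator -/

/-- A superposition of squares is a positive kernel. -/
theorem exists_integral_kernel_eq {α β : Type*} [MeasurableSpace α] [MeasurableSpace β]
    {τ : Measure α} [SFinite τ] {μ : Measure β} [SFinite μ] {w : β → ℝ} {φ : β → α → ℝ}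
    {κ : α → α → ℝ} {f : α → ℂ} (hw : ∀ᵐ ζ ∂μ, 0 ≤ w ζ)
    (hκ : ∀ᵐ z ∂τ.prod τ, ∫ ζ, w ζ * (φ ζ z.1 * φ ζ z.2) ∂μ = κ z.1 z.2)
    (hi : Integrable (fun q : (α × α) × β => ((w q.2 * (φ q.2 q.1.1 * φ q.2 q.1.2) : ℝ) : ℂ) *
      (f q.1.1 * star (f q.1.2))) ((τ.prod τ).prod μ)) :
    Integrable (fun z : α × α => (κ z.1 z.2 : ℂ) * (f z.1 * star (f z.2))) (τ.prod τ) ∧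
      ∃ r : ℝ, 0 ≤ r ∧
        ∫ z, (κ z.1 z.2 : ℂ) * (f z.1 * star (f z.2)) ∂τ.prod τ = (r : ℂ) := by
  have h1 : ∀ᵐ z ∂τ.prod τ, ∫ ζ, ((w ζ * (φ ζ z.1 * φ ζ z.2) : ℝ) : ℂ) * (f z.1 * star (f z.2)) ∂μ
      = (κ z.1 z.2 : ℂ) * (f z.1 * star (f z.2)) := by
    filter_upwards [hκ] with z hz
    rw [integral_mul_const, integral_complex_ofReal, hz]
  -- By Fubini, for each parameter ζ the double integral factors into a number times its conjugate.
  refine ⟨hi.integral_prod_left.congr h1, ∫ ζ, w ζ * ‖∫ x, (φ ζ x : ℂ) * f x ∂τ‖ ^ 2 ∂μ, ?_, ?_⟩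
  · exact integral_nonneg_of_ae (hw.mono fun ζ hζ => by
      simp only [Pi.zero_apply]
      positivity)
  · rw [← integral_congr_ae h1, integral_integral_swap hi, ← integral_complex_ofReal]
    refine integral_congr_ae (Eventually.of_forall fun ζ => ?_)
    have h2 : ∀ z : α × α, ((w ζ * (φ ζ z.1 * φ ζ z.2) : ℝ) : ℂ) * (f z.1 * star (f z.2))
        = (w ζ : ℂ) * (((φ ζ z.1 : ℂ) * f z.1) * star ((φ ζ z.2 : ℂ) * f z.2)) := by
      intro z
      simp only [star_mul', RCLike.star_def, Complex.conj_ofReal]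
      push_cast
      ring
    simp only [h2]
    rw [integral_const_mul, integral_prod_mul (f := fun x => (φ ζ x : ℂ) * f x)
      (g := fun y => star ((φ ζ y : ℂ) * f y))]
    have h3 : ∫ y, star ((φ ζ y : ℂ) * f y) ∂τ = star (∫ y, (φ ζ y : ℂ) * f y ∂τ) := by
      simp only [RCLike.star_def]
      exact integral_conj
    rw [h3, RCLike.star_def, Complex.mul_conj, Complex.normSq_eq_norm_sq]
    push_cast
    ring

/-- Each slice of the diagonal pulls back into a line of constant t. The representation by features
holds only off the diagonal. -/
theorem ae_coneMeasure_prod_ne (R : ℝ) :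
    ∀ᵐ z ∂(coneMeasure R).prod (coneMeasure R), z.1 ≠ z.2 := by
  have hm : MeasurableSet {z : E3 × E3 | z.1 = z.2} :=
    measurableSet_eq_fun measurable_fst measurable_snd
  have h0 : (coneMeasure R).prod (coneMeasure R) {z | z.1 = z.2} = 0 := by
    rw [Measure.measure_prod_null hm]
    refine Eventually.of_forall fun x => ?_
    have hs : MeasurableSet (Prod.mk x ⁻¹' {z : E3 × E3 | z.1 = z.2}) :=
      measurable_prodMk_left hm
    change coneMeasure R _ = 0
    rw [coneMeasure, Measure.map_apply (continuous_prolateParam R).measurable hs]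
    refine Measure.restrict_apply_le _ _ |>.trans ?_ |> le_antisymm <| zero_le
    have hsub : prolateParam R ⁻¹' (Prod.mk x ⁻¹' {z : E3 × E3 | z.1 = z.2})
        ⊆ (univ : Set ℝ) ×ˢ {x 2} := by
      intro p hp
      have hp' : x = prolateParam R p := hp
      rw [hp']
      simp
    refine (measure_mono hsub).trans ?_
    rw [Measure.volume_eq_prod, Measure.prod_prod]
    simp
  rw [ae_iff]
  simpa using h0

/-- The majorant of `lintegral_featureWeight_le` is in turn dominated by the kernel itself, whose
bilinear form is already known to converge absolutely. -/
theorem two_div_norm_le_symKernel {R : ℝ} (hR : 1 ≤ R) {x y : E3} (hxy : x ≠ y) :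
    2 / ‖x - y‖ ≤ 16 * Real.pi * R ^ 2 * symKernel R x y := by
  have hd : 0 < ‖x - y‖ := norm_pos_iff.2 (sub_ne_zero.2 hxy)
  have hpi := Real.pi_pos
  have h := norm_sq_le_prolateForm hR (x - y)
  rw [symKernel]
  have e : 16 * Real.pi * R ^ 2 * (1 / (8 * Real.pi) * (prolateForm R (x - y) / ‖x - y‖ ^ 3))
      = 2 * (R ^ 2 * prolateForm R (x - y)) / ‖x - y‖ ^ 3 := by
    field_simp
    ring
  rw [e, div_le_div_iff₀ hd (by positivity)]
  calc 2 * ‖x - y‖ ^ 3 = 2 * ‖x - y‖ ^ 2 * ‖x - y‖ := by ring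
    _ ≤ _ := by gcongr

theorem lintegral_symKernel_bilinear_lt_top {R : ℝ} (hR : 1 ≤ R) {f : E3 → ℂ}
    (hf : StronglyMeasurable f) (hf2 : ∫⁻ y, ‖f y‖ₑ ^ 2 ∂coneMeasure R ≠ ⊤) :
    ∫⁻ z, ENNReal.ofReal (symKernel R z.1 z.2) * (‖f z.1‖ₑ * ‖f z.2‖ₑ)
      ∂(coneMeasure R).prod (coneMeasure R) < ⊤ := by
  have hk := (measurable_symKernel R).ennreal_ofReal
  have hfm := hf.enorm
  have hk2 : ∀ x, Measurable fun y => ENNReal.ofReal (symKernel R x y) := fun x =>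
    ((measurable_symKernel R).comp measurable_prodMk_left).ennreal_ofReal
  rw [lintegral_prod _ (by fun_prop)]
  have hab : ∀ a b : ENNReal, a * b ≤ a ^ 2 + b ^ 2 := fun a b => by
    rcases le_total a b with h | h
    · exact le_add_left (by rw [sq]; gcongr)
    · exact le_add_right (by rw [sq]; gcongr)
  calc _ ≤ ∫⁻ x, (‖f x‖ₑ ^ 2 +
        (∫⁻ y, ENNReal.ofReal (symKernel R x y) * ‖f y‖ₑ ∂coneMeasure R) ^ 2) ∂coneMeasure R := by
        refine lintegral_mono fun x => ?_
        refine le_trans (le_of_eq ?_) (hab _ _)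
        have hm : Measurable fun y => ENNReal.ofReal (symKernel R x y) * ‖f y‖ₑ := (hk2 x).mul hfm
        rw [← lintegral_const_mul _ hm]
        refine lintegral_congr fun y => ?_
        dsimp only
        ring
    _ = _ := lintegral_add_left (hfm.pow_const 2) _
    _ < ⊤ := by
        have := (lintegral_sq_symKernel_le hR hf).trans_lt (by finiteness)
        exact ENNReal.add_lt_top.2 ⟨lt_top_iff_ne_top.2 hf2, this⟩

theorem exists_integral_directional_eq {R : ℝ} (hR : 1 ≤ R) {f : E3 → ℂ}
    (hf : StronglyMeasurable f) (hf2 : ∫⁻ y, ‖f y‖ₑ ^ 2 ∂coneMeasure R ≠ ⊤) (i : Fin 3) :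
    Integrable (fun z : E3 × E3 =>
        (((‖z.1 - z.2‖ ^ 2 - (z.1 - z.2) i ^ 2) / ‖z.1 - z.2‖ ^ 3 : ℝ) : ℂ) *
          (f z.1 * star (f z.2))) ((coneMeasure R).prod (coneMeasure R)) ∧
      ∃ r : ℝ, 0 ≤ r ∧ ∫ z : E3 × E3,
        (((‖z.1 - z.2‖ ^ 2 - (z.1 - z.2) i ^ 2) / ‖z.1 - z.2‖ ^ 3 : ℝ) : ℂ) *
          (f z.1 * star (f z.2)) ∂(coneMeasure R).prod (coneMeasure R) = (r : ℂ) := by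
  have h0 : ∀ᵐ ζ ∂featureMeasure, 0 ≤ featureWeight ζ := by
    have : ∀ᵐ ζ ∂featureMeasure, 0 < ζ.1 :=
      Measure.quasiMeasurePreserving_fst.ae (ae_restrict_mem measurableSet_Ioi)
    exact this.mono fun ζ hζ => by unfold featureWeight; positivity
  refine exists_integral_kernel_eq (μ := featureMeasure) (w := featureWeight) (φ := feature i)
    (κ := fun x y => (‖x - y‖ ^ 2 - (x - y) i ^ 2) / ‖x - y‖ ^ 3) (f := f) h0
    ((ae_coneMeasure_prod_ne R).mono fun z hz => integral_featureWeight i hz) ?_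
  have hc : Continuous fun q : (E3 × E3) × (ℝ × E3) =>
      featureWeight q.2 * (feature i q.2 q.1.1 * feature i q.2 q.1.2) := by
    unfold featureWeight feature
    fun_prop
  have hfm := hf.enorm
  have hm : StronglyMeasurable fun q : (E3 × E3) × (ℝ × E3) =>
      ((featureWeight q.2 * (feature i q.2 q.1.1 * feature i q.2 q.1.2) : ℝ) : ℂ) *
      (f q.1.1 * star (f q.1.2)) := by
    refine (Complex.continuous_ofReal.comp hc).stronglyMeasurable.mul ?_
    exact (hf.comp_measurable (by fun_prop)).mul
      (continuous_star.comp_stronglyMeasurable (hf.comp_measurable (by fun_prop)))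
  refine ⟨hm.aestronglyMeasurable, ?_⟩
  rw [hasFiniteIntegral_iff_enorm, lintegral_prod _ hm.enorm.aemeasurable]
  have hk := (measurable_symKernel R).ennreal_ofReal
  calc _ ≤ ∫⁻ z, ENNReal.ofReal (16 * Real.pi * R ^ 2) * (ENNReal.ofReal (symKernel R z.1 z.2) *
        (‖f z.1‖ₑ * ‖f z.2‖ₑ)) ∂(coneMeasure R).prod (coneMeasure R) := by
        refine lintegral_mono_ae ((ae_coneMeasure_prod_ne R).mono fun z hz => ?_)
        have e : ∀ᵐ ζ ∂featureMeasure,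
            ‖((featureWeight ζ * (feature i ζ z.1 * feature i ζ z.2) : ℝ) : ℂ) *
              (f z.1 * star (f z.2))‖ₑ
            = ENNReal.ofReal (featureWeight ζ * |feature i ζ z.1 * feature i ζ z.2|) *
              (‖f z.1‖ₑ * ‖f z.2‖ₑ) := by
          filter_upwards [h0] with ζ hζ
          rw [enorm_mul, enorm_mul, enorm_eq_nnnorm (star _), nnnorm_star, ← enorm_eq_nnnorm,
            ← ofReal_norm (((_ : ℝ) : ℂ)), Complex.norm_real,
            Real.norm_eq_abs, abs_mul (featureWeight ζ), abs_of_nonneg hζ]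
        rw [lintegral_congr_ae e, lintegral_mul_const' _ _ (by finiteness),
          ← mul_assoc (ENNReal.ofReal (16 * Real.pi * R ^ 2)), ← ENNReal.ofReal_mul (by positivity)]
        gcongr
        exact (lintegral_featureWeight_le i hz).trans
          (ENNReal.ofReal_le_ofReal (two_div_norm_le_symKernel hR hz))
    _ < ⊤ := by
        rw [lintegral_const_mul' _ _ ENNReal.ofReal_ne_top]
        exact ENNReal.mul_lt_top ENNReal.ofReal_lt_top
          (lintegral_symKernel_bilinear_lt_top hR hf hf2)

/-- The kernel of a prolate spheroid is a combination with nonnegative coefficients of the second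
derivatives of `|x - y|` in the directions of the axes. -/
theorem symKernel_eq_sum {R : ℝ} (hR : 1 ≤ R) (x y : E3) :
    symKernel R x y =
      1 / (16 * Real.pi * R ^ 2) * ((‖x - y‖ ^ 2 - (x - y) 0 ^ 2) / ‖x - y‖ ^ 3) +
      1 / (16 * Real.pi * R ^ 2) * ((‖x - y‖ ^ 2 - (x - y) 1 ^ 2) / ‖x - y‖ ^ 3) +
      (2 - 1 / R ^ 2) / (16 * Real.pi) * ((‖x - y‖ ^ 2 - (x - y) 2 ^ 2) / ‖x - y‖ ^ 3) := by
  have hR0 : 0 < R := by linarith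
  have hpi := Real.pi_pos
  rcases eq_or_ne x y with rfl | hxy
  · simp [symKernel]
  have hd : ‖x - y‖ ≠ 0 := norm_ne_zero_iff.2 (sub_ne_zero.2 hxy)
  rw [symKernel, E3.norm_sq, prolateForm]
  field_simp
  ring

/-- The quadratic form splits along `symKernel_eq_sum` into three nonnegative forms. The coefficient
of the x₃ term contains 2 - 1/R², which is where R ≥ 1 enters. -/
theorem isPositive_symOperator {R : ℝ} (hR : 1 ≤ R) : (symOperator hR).IsPositive := by
  rw [ContinuousLinearMap.isPositive_iff_complex]
  intro f
  have hf := Lp.stronglyMeasurable f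
  have hf2 := Lp.lintegral_enorm_sq_ne_top f
  have hR0 : 0 < R := by linarith
  have hpi := Real.pi_pos
  obtain ⟨i0, r0, p0, e0⟩ := exists_integral_directional_eq hR hf hf2 0
  obtain ⟨i1, r1, p1, e1⟩ := exists_integral_directional_eq hR hf hf2 1
  obtain ⟨i2, r2, p2, e2⟩ := exists_integral_directional_eq hR hf hf2 2
  set a : ℝ := 1 / (16 * Real.pi * R ^ 2) with ha
  set b : ℝ := (2 - 1 / R ^ 2) / (16 * Real.pi) with hb
  have ha0 : 0 ≤ a := by positivity
  have hb0 : 0 ≤ b := by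
    have : 1 / R ^ 2 ≤ 1 := by
      rw [div_le_one (by positivity)]
      exact one_le_pow₀ hR
    have : 0 ≤ 2 - 1 / R ^ 2 := by linarith
    positivity
  have hsum : ∀ z : E3 × E3, (symKernel R z.1 z.2 : ℂ) * (f z.1 * star (f z.2)) =
      (a : ℂ) * ((((‖z.1 - z.2‖ ^ 2 - (z.1 - z.2) 0 ^ 2) / ‖z.1 - z.2‖ ^ 3 : ℝ) : ℂ) *
          (f z.1 * star (f z.2))) +
      (a : ℂ) * ((((‖z.1 - z.2‖ ^ 2 - (z.1 - z.2) 1 ^ 2) / ‖z.1 - z.2‖ ^ 3 : ℝ) : ℂ) *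
          (f z.1 * star (f z.2))) +
      (b : ℂ) * ((((‖z.1 - z.2‖ ^ 2 - (z.1 - z.2) 2 ^ 2) / ‖z.1 - z.2‖ ^ 3 : ℝ) : ℂ) *
          (f z.1 * star (f z.2))) := by
    intro z
    rw [symKernel_eq_sum hR, ← ha, ← hb]
    simp only [Complex.ofReal_add, Complex.ofReal_mul]
    ring
  have hi := ((i0.const_mul (a : ℂ)).add (i1.const_mul (a : ℂ))).add (i2.const_mul (b : ℂ))
  have hiK : Integrable (fun z : E3 × E3 => (symKernel R z.1 z.2 : ℂ) * (f z.1 * star (f z.2)))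
      ((coneMeasure R).prod (coneMeasure R)) :=
    hi.congr (Eventually.of_forall fun z => (hsum z).symm)
  have htot : ∫ z, (symKernel R z.1 z.2 : ℂ) * (f z.1 * star (f z.2))
      ∂(coneMeasure R).prod (coneMeasure R) = ((a * r0 + a * r1 + b * r2 : ℝ) : ℂ) := by
    refine (integral_congr_ae (Eventually.of_forall hsum)).trans ?_
    refine (integral_add' ((i0.const_mul (a : ℂ)).add (i1.const_mul (a : ℂ)))
      (i2.const_mul (b : ℂ))).trans ?_
    rw [integral_add' (i0.const_mul (a : ℂ)) (i1.const_mul (a : ℂ)), integral_const_mul,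
      integral_const_mul, integral_const_mul, e0, e1, e2]
    push_cast
    ring
  have hinner : inner ℂ (symOperator hR f) f = ((a * r0 + a * r1 + b * r2 : ℝ) : ℂ) := by
    rw [← htot, L2.inner_def, integral_prod _ hiK]
    refine integral_congr_ae ?_
    filter_upwards [coeFn_symOperator hR f] with x hx
    rw [hx, RCLike.inner_apply, layerPotential, ← integral_conj, ← integral_const_mul]
    refine integral_congr_ae (Eventually.of_forall fun y => ?_)
    simp only [map_mul, Complex.conj_ofReal, RCLike.star_def]
    ring
  rw [hinner]
  refine ⟨by simp, ?_⟩
  simp only [RCLike.re_to_complex, Complex.ofReal_re]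
  positivity

/-! ### Spectra of selfadjoint operators -/

theorem ContinuousLinearMap.IsPositive.spectrum_subset {H : Type*} [NormedAddCommGroup H]
    [InnerProductSpace ℂ H] [CompleteSpace H] {T : H →L[ℂ] H} (hT : T.IsPositive) {c : ℝ}
    (hc : ‖T‖ ≤ c) : spectrum ℂ T ⊆ Complex.ofReal '' Icc 0 c := by
  intro z hz
  have hsa : IsSelfAdjoint T := hT.isSelfAdjoint
  have hre := hsa.mem_spectrum_eq_re hz
  refine ⟨z.re, ⟨?_, ?_⟩, hre.symm⟩
  · have h0 : 0 ≤ T := (ContinuousLinearMap.nonneg_iff_isPositive T).2 hT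
    have := spectrum_nonneg_of_nonneg h0 (x := z.re)
    refine this ?_
    rw [hre] at hz
    exact spectrum.of_algebraMap_mem ℂ hz
  · have h1 : ‖z‖ ≤ ‖T‖ * ‖(1 : H →L[ℂ] H)‖ := spectrum.norm_le_norm_mul_of_mem hz
    have h2 : ‖(1 : H →L[ℂ] H)‖ ≤ 1 := ContinuousLinearMap.norm_id_le
    calc z.re ≤ ‖z‖ := Complex.re_le_norm z
      _ ≤ ‖T‖ * 1 := h1.trans (by gcongr)
      _ ≤ c := by simpa using hc

/-- An approximate eigenvalue of a selfadjoint operator is close to its spectrum. -/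
theorem IsSelfAdjoint.exists_mem_spectrum_near {H : Type*} [NormedAddCommGroup H]
    [InnerProductSpace ℂ H] [CompleteSpace H] {T : H →L[ℂ] H} (hT : IsSelfAdjoint T) {c ε : ℝ}
    (hε : 0 ≤ ε) {g : H} (hg : g ≠ 0) (h : ‖T g - (c : ℂ) • g‖ ≤ ε * ‖g‖) :
    ∃ z ∈ spectrum ℂ T, ‖z - c‖ ≤ ε := by
  have hg0 : 0 < ‖g‖ := norm_pos_iff.2 hg
  have : Nontrivial H := ⟨g, 0, hg⟩
  by_cases hc : (c : ℂ) ∈ spectrum ℂ T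
  · exact ⟨c, hc, by simpa using hε⟩
  rw [spectrum.notMem_iff] at hc
  obtain ⟨a, ha⟩ := hc
  set b : H →L[ℂ] H := ((a⁻¹ : (H →L[ℂ] H)ˣ) : H →L[ℂ] H) with hb
  have hasa : IsSelfAdjoint (a : H →L[ℂ] H) := by
    rw [ha]
    refine IsSelfAdjoint.sub ?_ hT
    rw [Algebra.algebraMap_eq_smul_one]
    exact IsSelfAdjoint.smul (by simp [isSelfAdjoint_iff]) (IsSelfAdjoint.one _)
  have hbsa : IsSelfAdjoint b := by
    rw [hb, isSelfAdjoint_iff, ← Units.coe_star_inv]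
    congr 1
    rw [inv_inj]
    exact Units.ext hasa
  have hba : ∀ x, b ((a : H →L[ℂ] H) x) = x := fun x => by
    exact DFunLike.congr_fun a.inv_mul x
  have hag : ‖(a : H →L[ℂ] H) g‖ ≤ ε * ‖g‖ := by
    rw [ha, sub_apply, Algebra.algebraMap_eq_smul_one, norm_sub_rev]
    simpa using h
  have hbn : 1 ≤ ‖b‖ * ε := by
    have h1 : ‖g‖ ≤ ‖b‖ * (ε * ‖g‖) := by
      calc ‖g‖ = ‖b ((a : H →L[ℂ] H) g)‖ := by rw [hba]
        _ ≤ ‖b‖ * ‖(a : H →L[ℂ] H) g‖ := b.le_opNorm _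
        _ ≤ _ := by gcongr
    by_contra hlt
    push Not at hlt
    nlinarith
  -- The resolvent b is selfadjoint, so its norm, which is at least 1/ε, is attained as |ν| for some
  -- spectral value ν; then c - ν⁻¹ lies in the spectrum of T within ε of c.
  obtain ⟨ν, hν, hνr⟩ := spectrum.exists_nnnorm_eq_spectralRadius b
  rw [hbsa.spectralRadius_eq_nnnorm] at hνr
  have hνb : ‖ν‖ = ‖b‖ := by
    have : ‖ν‖₊ = ‖b‖₊ := by exact_mod_cast hνr
    exact congrArg NNReal.toReal this
  have hν0 : ν ≠ 0 := by
    rintro rfl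
    rw [norm_zero] at hνb
    rw [← hνb] at hbn
    linarith
  have hinv : ν⁻¹ ∈ spectrum ℂ (a : H →L[ℂ] H) := by
    have := (spectrum.inv_mem_iff (r := Units.mk0 ν hν0) (a := a⁻¹)).1 hν
    simpa using this
  refine ⟨c - ν⁻¹, ?_, ?_⟩
  · rw [ha, ← spectrum.singleton_sub_eq] at hinv
    obtain ⟨_, rfl, z, hz, hzν⟩ := hinv
    rw [← hzν]
    simpa using hz
  · have hpos : 0 < ‖b‖ := by rw [← hνb]; exact norm_pos_iff.2 hν0
    rw [sub_sub_cancel_left, norm_neg, norm_inv, hνb, inv_le_iff_one_le_mul₀ hpos, mul_comm]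
    exact hbn

/-! ### Consequences for the Neumann–Poincaré operator on H^{1/2}. -/

theorem spectrum_npOperator_subset {R : ℝ} (hR : 1 ≤ R) :
    spectrum ℂ (npOperator hR) ⊆ Complex.ofReal '' Icc 0 (1 / 2) := by
  intro z hz
  by_cases h0 : z = 0
  · exact ⟨0, by norm_num, by simp [h0]⟩
  · exact (isPositive_symOperator hR).spectrum_subset (norm_symOperator_le hR)
      ((mem_spectrum_npOperator hR h0).1 hz)

/-- Approximate eigenvalues of the symmetrized operator are close to the spectrum of the
Neumann–Poincaré operator. -/
theorem exists_mem_spectrum_npOperator_near {R : ℝ} (hR : 1 ≤ R) {c ε : ℝ} (hε : 0 ≤ ε)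
    (hεc : ε < c) {g : Lp ℂ 2 (coneMeasure R)} (hg : g ≠ 0)
    (h : ‖symOperator hR g - (c : ℂ) • g‖ ≤ ε * ‖g‖) :
    ∃ z ∈ spectrum ℂ (npOperator hR), ‖z - c‖ ≤ ε := by
  obtain ⟨z, hz, hzc⟩ :=
    (isPositive_symOperator hR).isSelfAdjoint.exists_mem_spectrum_near hε hg h
  refine ⟨z, (mem_spectrum_npOperator hR ?_).2 hz, hzc⟩
  rintro rfl
  rw [zero_sub, norm_neg, Complex.norm_real, Real.norm_eq_abs] at hzc
  linarith [le_abs_self c]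

/-! ### The Neumann–Poincaré operator of the infinite cylinder -/

/-- The strip that parametrizes the infinite cylinder. -/
noncomputable def stripMeasure : Measure (ℝ × ℝ) :=
  (volume.restrict (Ioo (-Real.pi) Real.pi)).prod volume

instance stripMeasure.instSFinite : SFinite stripMeasure := by
  unfold stripMeasure; infer_instance

/-- The kernel of the cylinder as a function of the differences of the coordinates. -/
noncomputable def cylProfile (u τ : ℝ) : ℝ :=
  1 / (8 * Real.pi) *
    ((2 - 2 * Real.cos u) / Real.sqrt (2 - 2 * Real.cos u + τ ^ 2) ^ 3)

/-- The Neumann–Poincaré kernel of the cylinder. -/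
noncomputable def cylKernel (p q : ℝ × ℝ) : ℝ := cylProfile (p.1 - q.1) (p.2 - q.2)

theorem two_sub_two_cos_nonneg (u : ℝ) : 0 ≤ 2 - 2 * Real.cos u := by
  linarith [Real.cos_le_one u]

theorem cylProfile_nonneg (u τ : ℝ) : 0 ≤ cylProfile u τ := by
  have := two_sub_two_cos_nonneg u
  have := Real.pi_pos
  unfold cylProfile
  positivity

theorem cylKernel_nonneg (p q : ℝ × ℝ) : 0 ≤ cylKernel p q := cylProfile_nonneg _ _

theorem measurable_cylProfile : Measurable fun q : ℝ × ℝ => cylProfile q.1 q.2 := by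
  unfold cylProfile
  fun_prop

theorem measurable_cylKernel : Measurable fun z : (ℝ × ℝ) × (ℝ × ℝ) => cylKernel z.1 z.2 := by
  unfold cylKernel cylProfile
  fun_prop

theorem cylProfile_neg_right (u τ : ℝ) : cylProfile u (-τ) = cylProfile u τ := by
  simp [cylProfile]

theorem cylProfile_periodic (τ : ℝ) : Function.Periodic (fun u => cylProfile u τ) (2 * Real.pi) :=
  fun u => by simp [cylProfile]

theorem hasDerivAt_div_sqrt_add_sq {a : ℝ} (ha : 0 < a) (τ : ℝ) :
    HasDerivAt (fun τ : ℝ => τ / Real.sqrt (a + τ ^ 2)) (a / Real.sqrt (a + τ ^ 2) ^ 3) τ := by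
  have hp : 0 < a + τ ^ 2 := by positivity
  have h1 : HasDerivAt (fun τ : ℝ => a + τ ^ 2) (2 * τ) τ := by
    simpa using ((hasDerivAt_id τ).pow 2).const_add a
  have hs := Real.sqrt_pos.2 hp
  refine ((hasDerivAt_id' τ).fun_div (h1.sqrt hp.ne') hs.ne').congr_deriv ?_
  have e := Real.sq_sqrt hp.le
  set r := Real.sqrt (a + τ ^ 2)
  field_simp
  linear_combination e

theorem tendsto_div_sqrt_add_sq_atTop {a : ℝ} (ha : 0 < a) :
    Tendsto (fun τ : ℝ => τ / Real.sqrt (a + τ ^ 2)) atTop (𝓝 1) := by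
  have h1 : Tendsto (fun τ : ℝ => 1 / Real.sqrt (a * (τ⁻¹) ^ 2 + 1)) atTop (𝓝 1) := by
    have h2 : Tendsto (fun τ : ℝ => a * (τ⁻¹) ^ 2 + 1) atTop (𝓝 1) := by
      simpa using ((tendsto_inv_atTop_zero (𝕜 := ℝ)).pow 2).const_mul a |>.add_const 1
    simpa [Pi.div_def] using (tendsto_const_nhds (x := (1 : ℝ))).div h2.sqrt (by simp)
  refine h1.congr' ?_
  filter_upwards [eventually_gt_atTop 0] with τ hτ
  have e : a + τ ^ 2 = τ ^ 2 * (a * (τ⁻¹) ^ 2 + 1) := by field_simp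
  rw [e, Real.sqrt_mul (by positivity), Real.sqrt_sq hτ.le]
  field_simp

/-- The antiderivative τ/√(a + τ²) runs from -1 to 1, whatever a is. -/
theorem lintegral_div_sqrt_add_sq {a : ℝ} (ha : 0 < a) :
    ∫⁻ τ : ℝ, ENNReal.ofReal (a / Real.sqrt (a + τ ^ 2) ^ 3) = ENNReal.ofReal 2 := by
  have hpos : ∀ τ : ℝ, 0 ≤ a / Real.sqrt (a + τ ^ 2) ^ 3 := fun τ => by positivity
  have hI := integrableOn_Ioi_deriv_of_nonneg' (a := 0)
    (fun τ _ => hasDerivAt_div_sqrt_add_sq ha τ) (fun τ _ => hpos τ)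
    (tendsto_div_sqrt_add_sq_atTop ha)
  have hV := integral_Ioi_of_hasDerivAt_of_nonneg' (a := 0)
    (fun τ _ => hasDerivAt_div_sqrt_add_sq ha τ) (fun τ _ => hpos τ)
    (tendsto_div_sqrt_add_sq_atTop ha)
  have h1 : ∫⁻ τ in Ioi (0 : ℝ), ENNReal.ofReal (a / Real.sqrt (a + τ ^ 2) ^ 3) = 1 := by
    rw [← ofReal_integral_eq_lintegral_ofReal hI (Eventually.of_forall hpos), hV]
    simp
  have h2 : ∫⁻ τ in Iio (0 : ℝ), ENNReal.ofReal (a / Real.sqrt (a + τ ^ 2) ^ 3)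
      = ∫⁻ τ in Ioi (0 : ℝ), ENNReal.ofReal (a / Real.sqrt (a + τ ^ 2) ^ 3) := by
    rw [← lintegral_indicator measurableSet_Ioi, ← lintegral_indicator measurableSet_Iio,
      ← lintegral_neg_eq_self (μ := (volume : Measure ℝ))]
    refine lintegral_congr fun z => ?_
    simp [indicator]
  rw [← lintegral_add_compl _ (measurableSet_Ioi (a := (0 : ℝ))), compl_Ioi,
    setLIntegral_congr (Iio_ae_eq_Iic (a := (0 : ℝ))).symm, h2, h1]
  norm_num

theorem lintegral_cylProfile {u : ℝ} (hu : Real.cos u ≠ 1) :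
    ∫⁻ τ, ENNReal.ofReal (cylProfile u τ) = ENNReal.ofReal (1 / (4 * Real.pi)) := by
  have ha : 0 < 2 - 2 * Real.cos u := by
    have := lt_of_le_of_ne (Real.cos_le_one u) hu
    linarith
  have hpi := Real.pi_pos
  simp only [cylProfile]
  simp only [ENNReal.ofReal_mul (by positivity : 0 ≤ 1 / (8 * Real.pi))]
  rw [lintegral_const_mul' _ _ ENNReal.ofReal_ne_top, lintegral_div_sqrt_add_sq ha,
    ← ENNReal.ofReal_mul (by positivity)]
  congr 1
  field_simp
  norm_num

theorem integrable_cylProfile (u : ℝ) : Integrable (cylProfile u) := by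
  by_cases hu : Real.cos u = 1
  · have : cylProfile u = fun _ => 0 := by
      funext τ
      simp [cylProfile, hu]
    rw [this]
    exact integrable_zero _ _ _
  · refine ⟨(measurable_cylProfile.comp measurable_prodMk_left).aestronglyMeasurable, ?_⟩
    rw [hasFiniteIntegral_iff_ofReal (Eventually.of_forall (cylProfile_nonneg u)),
      lintegral_cylProfile hu]
    exact ENNReal.ofReal_lt_top

theorem integral_cylProfile_le (u : ℝ) : ∫ τ, cylProfile u τ ≤ 1 / (4 * Real.pi) := by
  have hpi := Real.pi_pos
  by_cases hu : Real.cos u = 1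
  · simp only [cylProfile, hu]
    simp
    positivity
  · rw [integral_eq_lintegral_of_nonneg_ae (Eventually.of_forall (cylProfile_nonneg u))
      (integrable_cylProfile u).aestronglyMeasurable, lintegral_cylProfile hu,
      ENNReal.toReal_ofReal (by positivity)]

/-- Every slice θ ≠ p.1 carries the same mass 1/(4π), and the angles have total length 2π. That the
mass is exactly 1/2, the upper bound valid for every spheroid, is what makes the later comparison of
kernels work. -/
theorem lintegral_cylKernel {p : ℝ × ℝ} (hp : p.1 ∈ Ioo (-Real.pi) Real.pi) :
    ∫⁻ q, ENNReal.ofReal (cylKernel p q) ∂stripMeasure = ENNReal.ofReal (1 / 2) := by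
  have hpi := Real.pi_pos
  have hm : Measurable fun q => ENNReal.ofReal (cylKernel p q) :=
    (measurable_cylKernel.comp measurable_prodMk_left).ennreal_ofReal
  rw [stripMeasure, lintegral_prod _ hm.aemeasurable]
  have h : ∀ᵐ θ ∂volume.restrict (Ioo (-Real.pi) Real.pi),
      ∫⁻ t, ENNReal.ofReal (cylKernel p (θ, t)) = ENNReal.ofReal (1 / (4 * Real.pi)) := by
    have hne : ∀ᵐ θ : ℝ, θ ≠ p.1 := by simp [ae_iff]
    filter_upwards [ae_restrict_mem measurableSet_Ioo, ae_restrict_of_ae hne] with θ hθ hθp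
    simp only [cylKernel]
    rw [lintegral_sub_left_eq_self (fun τ => ENNReal.ofReal (cylProfile (p.1 - θ) τ)) p.2]
    refine lintegral_cylProfile fun hc => ?_
    rw [Real.cos_eq_one_iff_of_lt_of_lt (by linarith [hp.1, hθ.2]) (by linarith [hp.2, hθ.1])]
      at hc
    exact hθp (by linarith)
  rw [lintegral_congr_ae h, lintegral_const, Measure.restrict_apply_univ, Real.volume_Ioo,
    ← ENNReal.ofReal_mul (by positivity)]
  congr 1
  field_simp
  norm_num

theorem integrable_cylKernel {p : ℝ × ℝ} (hp : p.1 ∈ Ioo (-Real.pi) Real.pi) :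
    Integrable (cylKernel p) stripMeasure := by
  refine ⟨(measurable_cylKernel.comp measurable_prodMk_left).aestronglyMeasurable, ?_⟩
  rw [hasFiniteIntegral_iff_ofReal (Eventually.of_forall (cylKernel_nonneg p)),
    lintegral_cylKernel hp]
  exact ENNReal.ofReal_lt_top

/-! ### The symbol of the cylinder operator -/

/-- The Fourier transform of a slice of the cylinder kernel. -/
noncomputable def sliceSymbol (ξ u : ℝ) : ℝ := ∫ τ, cylProfile u τ * Real.cos (ξ * τ)

/-- The eigenvalue of the cylinder operator for the eigenfunction `exp (i ξ t)`. -/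
noncomputable def cylSymbol (ξ : ℝ) : ℝ := ∫ u in (-Real.pi)..Real.pi, sliceSymbol ξ u

theorem abs_sliceSymbol_le (ξ u : ℝ) : |sliceSymbol ξ u| ≤ 1 / (4 * Real.pi) := by
  refine le_trans ?_ (integral_cylProfile_le u)
  change ‖∫ τ, cylProfile u τ * Real.cos (ξ * τ)‖ ≤ _
  refine norm_integral_le_of_norm_le (integrable_cylProfile u) (Eventually.of_forall fun τ => ?_)
  rw [norm_mul, Real.norm_eq_abs, Real.norm_eq_abs, abs_of_nonneg (cylProfile_nonneg u τ)]
  exact mul_le_of_le_one_right (cylProfile_nonneg u τ) (Real.abs_cos_le_one _)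

/-- The profile is even in τ, so its Fourier transform is real and equals the cosine transform. -/
theorem integral_cylProfile_exp (ξ u : ℝ) :
    ∫ τ, (cylProfile u τ : ℂ) * Complex.exp (-(ξ * τ : ℝ) * Complex.I) = (sliceSymbol ξ u : ℂ) := by
  have hint : ∀ c : ℝ, Integrable fun τ : ℝ =>
      (cylProfile u τ : ℂ) * Complex.exp ((c * τ : ℝ) * Complex.I) := fun c => by
    have h0 : Integrable fun τ => (cylProfile u τ : ℂ) := (integrable_cylProfile u).ofReal
    refine h0.mono ?_ (Eventually.of_forall fun τ => ?_)
    · refine h0.aestronglyMeasurable.mul ?_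
      exact Continuous.aestronglyMeasurable (by fun_prop)
    · rw [norm_mul, Complex.norm_exp_ofReal_mul_I, mul_one]
  have h1 : ∫ τ, (cylProfile u τ : ℂ) * Complex.exp (-(ξ * τ : ℝ) * Complex.I)
      = ∫ τ, (cylProfile u τ : ℂ) * Complex.exp ((ξ * τ : ℝ) * Complex.I) := by
    rw [← integral_neg_eq_self]
    refine integral_congr_ae (Eventually.of_forall fun τ => ?_)
    simp only [cylProfile_neg_right]
    push_cast
    ring_nf
  have hneg := hint (-ξ)
  have hpos := hint ξ
  have e : ∀ τ : ℝ, Complex.exp (-(ξ * τ : ℝ) * Complex.I)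
      = Complex.exp ((-ξ * τ : ℝ) * Complex.I) := fun τ => by push_cast; ring_nf
  have h2 : (∫ τ, (cylProfile u τ : ℂ) * Complex.exp (-(ξ * τ : ℝ) * Complex.I))
      + (∫ τ, (cylProfile u τ : ℂ) * Complex.exp ((ξ * τ : ℝ) * Complex.I))
      = 2 * (sliceSymbol ξ u : ℂ) := by
    simp only [e]
    rw [← integral_add hneg hpos, sliceSymbol, ← integral_complex_ofReal, ← integral_const_mul]
    refine integral_congr_ae (Eventually.of_forall fun τ => ?_)
    simp only [Complex.ofReal_mul, Complex.ofReal_cos, Complex.cos]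
    push_cast
    ring_nf
  rw [← h1, ← two_mul] at h2
  exact mul_left_cancel₀ two_ne_zero h2

theorem sliceSymbol_periodic (ξ : ℝ) : Function.Periodic (sliceSymbol ξ) (2 * Real.pi) := by
  intro u
  simp only [sliceSymbol]
  congr 1
  funext τ
  have := cylProfile_periodic τ u
  simp only at this
  rw [this]

theorem integrable_cylKernel_mul_exp {p : ℝ × ℝ} (hp : p.1 ∈ Ioo (-Real.pi) Real.pi) (ξ : ℝ) :
    Integrable (fun q : ℝ × ℝ => (cylKernel p q : ℂ) * Complex.exp ((ξ * q.2 : ℝ) * Complex.I))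
      stripMeasure := by
  have h0 : Integrable (fun q => (cylKernel p q : ℂ)) stripMeasure :=
    (integrable_cylKernel hp).ofReal
  refine h0.mono ?_ (Eventually.of_forall fun q => ?_)
  · refine h0.aestronglyMeasurable.mul ?_
    exact Continuous.aestronglyMeasurable (by fun_prop)
  · rw [norm_mul, Complex.norm_exp_ofReal_mul_I, mul_one]

/-- The kernel depends only on differences: a translation in t extracts the phase, and periodicity
in the angle removes the dependence on θ. -/
theorem integral_cylKernel_mul_exp {p : ℝ × ℝ} (hp : p.1 ∈ Ioo (-Real.pi) Real.pi) (ξ : ℝ) :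
    ∫ q, (cylKernel p q : ℂ) * Complex.exp ((ξ * q.2 : ℝ) * Complex.I) ∂stripMeasure
      = (cylSymbol ξ : ℂ) * Complex.exp ((ξ * p.2 : ℝ) * Complex.I) := by
  have hi := integrable_cylKernel_mul_exp hp ξ
  have hpi := Real.pi_pos
  rw [stripMeasure] at hi ⊢
  rw [integral_prod _ hi]
  have h1 : ∀ θ : ℝ, ∫ t : ℝ, (cylKernel p (θ, t) : ℂ) * Complex.exp ((ξ * t : ℝ) * Complex.I)
      = (sliceSymbol ξ (p.1 - θ) : ℂ) * Complex.exp ((ξ * p.2 : ℝ) * Complex.I) := by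
    intro θ
    rw [← integral_cylProfile_exp, ← integral_mul_const,
      ← integral_sub_left_eq_self (fun τ => (cylProfile (p.1 - θ) τ : ℂ) *
        Complex.exp (-(ξ * τ : ℝ) * Complex.I) * Complex.exp ((ξ * p.2 : ℝ) * Complex.I)) _ p.2]
    refine integral_congr_ae (Eventually.of_forall fun t => ?_)
    simp only [cylKernel]
    rw [mul_assoc, ← Complex.exp_add]
    push_cast
    ring_nf
  simp only [h1]
  rw [integral_mul_const, integral_complex_ofReal, ← integral_Ioc_eq_integral_Ioo,
    ← intervalIntegral.integral_of_le (by linarith),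
    intervalIntegral.integral_comp_sub_left (fun u => sliceSymbol ξ u), cylSymbol]
  -- The substitution has moved the interval to one centred at p.1; it still has the length of a
  -- full period.
  have := (sliceSymbol_periodic ξ).intervalIntegral_add_eq (p.1 - Real.pi) (-Real.pi)
  rw [show p.1 - Real.pi + 2 * Real.pi = p.1 - -Real.pi by ring,
    show -Real.pi + 2 * Real.pi = Real.pi by ring] at this
  rw [this]

theorem zero_mem_strip : ((0 : ℝ × ℝ)).1 ∈ Ioo (-Real.pi) Real.pi :=
  ⟨neg_lt_zero.2 Real.pi_pos, Real.pi_pos⟩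

theorem cylSymbol_eq (ξ : ℝ) : (cylSymbol ξ : ℂ) =
    ∫ q, (cylKernel 0 q : ℂ) * Complex.exp ((ξ * q.2 : ℝ) * Complex.I) ∂stripMeasure := by
  rw [integral_cylKernel_mul_exp zero_mem_strip]
  simp

theorem cylSymbol_zero : cylSymbol 0 = 1 / 2 := by
  have h := cylSymbol_eq 0
  simp only [zero_mul, Complex.ofReal_zero, Complex.exp_zero, mul_one] at h
  rw [integral_complex_ofReal, Complex.ofReal_inj] at h
  rw [h, integral_eq_lintegral_of_nonneg_ae (Eventually.of_forall (cylKernel_nonneg 0))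
    (integrable_cylKernel zero_mem_strip).aestronglyMeasurable, lintegral_cylKernel zero_mem_strip,
    ENNReal.toReal_ofReal (by norm_num)]

theorem continuous_cylSymbol : Continuous cylSymbol := by
  have h : Continuous fun ξ : ℝ =>
      ∫ q, (cylKernel 0 q : ℂ) * Complex.exp ((ξ * q.2 : ℝ) * Complex.I) ∂stripMeasure := by
    refine continuous_of_dominated (bound := cylKernel 0)
      (fun ξ => (integrable_cylKernel_mul_exp zero_mem_strip ξ).aestronglyMeasurable)
      (fun ξ => Eventually.of_forall fun q => ?_) (integrable_cylKernel zero_mem_strip)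
      (Eventually.of_forall fun q => by fun_prop)
    rw [norm_mul, Complex.norm_exp_ofReal_mul_I, mul_one, Complex.norm_real, Real.norm_eq_abs,
      abs_of_nonneg (cylKernel_nonneg 0 q)]
  simp only [← cylSymbol_eq] at h
  exact (Complex.continuous_re.comp h).congr fun ξ => Complex.ofReal_re _

theorem tendsto_sliceSymbol (u : ℝ) : Tendsto (fun ξ => sliceSymbol ξ u) atTop (𝓝 0) := by
  have h := Real.tendsto_integral_exp_smul_cocompact fun τ => (cylProfile u τ : ℂ)
  -- The Riemann–Lebesgue lemma is stated for the characters exp(-2πi wτ), hence the rescaling of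
  -- the frequency.
  have h2 : Tendsto (fun ξ : ℝ => ξ / (2 * Real.pi)) atTop (cocompact ℝ) :=
    (tendsto_id.atTop_div_const (by positivity)).mono_right atTop_le_cocompact
  have h3 := h.comp h2
  have h4 : Tendsto (fun ξ => (sliceSymbol ξ u : ℂ)) atTop (𝓝 0) := by
    refine h3.congr fun ξ => ?_
    rw [← integral_cylProfile_exp]
    refine integral_congr_ae (Eventually.of_forall fun τ => ?_)
    simp only [Circle.smul_def, Real.fourierChar_apply, smul_eq_mul]
    rw [mul_comm]
    congr 2
    have := Real.pi_pos
    push_cast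
    field_simp
  exact ((Complex.continuous_re.tendsto _).comp h4).congr fun ξ => Complex.ofReal_re _

theorem tendsto_cylSymbol : Tendsto cylSymbol atTop (𝓝 0) := by
  have hpi := Real.pi_pos
  have hm : ∀ ξ, AEStronglyMeasurable (sliceSymbol ξ) volume := fun ξ => by
    refine StronglyMeasurable.aestronglyMeasurable ?_
    refine StronglyMeasurable.integral_prod_right'
      (f := fun z : ℝ × ℝ => cylProfile z.1 z.2 * Real.cos (ξ * z.2)) ?_
    exact (measurable_cylProfile.mul (by fun_prop)).stronglyMeasurable
  have h := intervalIntegral.tendsto_integral_filter_of_dominated_convergence (μ := volume)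
    (a := -Real.pi) (b := Real.pi) (l := atTop) (F := fun ξ u => sliceSymbol ξ u)
    (f := fun _ => 0) (fun _ => 1 / (4 * Real.pi))
    (Eventually.of_forall fun ξ => (hm ξ).restrict)
    (Eventually.of_forall fun ξ => Eventually.of_forall fun u _ => abs_sliceSymbol_le ξ u)
    intervalIntegrable_const (Eventually.of_forall fun u _ => tendsto_sliceSymbol u)
  rw [intervalIntegral.integral_zero] at h
  exact h

/-- Intermediate value theorem between ξ = 0, where the symbol is 1/2, and a high frequency, where
it is below c. -/
theorem exists_cylSymbol_eq {c : ℝ} (hc : c ∈ Ioo (0 : ℝ) (1 / 2)) : ∃ ξ, cylSymbol ξ = c := by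
  obtain ⟨ξ, hξ⟩ := (tendsto_cylSymbol.eventually (gt_mem_nhds hc.1)).exists
  have := intermediate_value_univ ξ 0 continuous_cylSymbol
  rw [cylSymbol_zero] at this
  exact this ⟨le_of_lt hξ, hc.2.le⟩

/-! ### Comparison of the spheroid with the cylinder -/

theorem stripMeasure_eq_restrict :
    stripMeasure = volume.restrict (Ioo (-Real.pi) Real.pi ×ˢ univ) := by
  rw [stripMeasure, Measure.volume_eq_prod, ← Measure.prod_restrict, Measure.restrict_univ]

theorem volume_restrict_cylinderDomain (R : ℝ) :
    volume.restrict (cylinderDomain R) = stripMeasure.restrict (Prod.snd ⁻¹' Ioo (-R) R) := by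
  rw [stripMeasure_eq_restrict, Measure.restrict_restrict (measurable_snd measurableSet_Ioo)]
  congr 1
  ext q
  simp [cylinderDomain, and_comm]

theorem ae_stripMeasure_mem : ∀ᵐ q ∂stripMeasure, q.1 ∈ Ioo (-Real.pi) Real.pi := by
  rw [stripMeasure_eq_restrict]
  filter_upwards [ae_restrict_mem (measurableSet_Ioo.prod MeasurableSet.univ)] with q hq
  exact hq.1

theorem ae_stripMeasure_ne (θ : ℝ) : ∀ᵐ q ∂stripMeasure, q.1 ≠ θ := by
  have h : ∀ᵐ s ∂volume.restrict (Ioo (-Real.pi) Real.pi), s ≠ θ :=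
    ae_restrict_of_ae (by simp [ae_iff])
  exact Measure.quasiMeasurePreserving_fst.ae h

theorem lintegral_stripMeasure_comp_snd {f : ℝ → ENNReal} (hf : Measurable f) :
    ∫⁻ q, f q.2 ∂stripMeasure = ENNReal.ofReal (2 * Real.pi) * ∫⁻ t, f t := by
  have hm : Measurable fun q : ℝ × ℝ => f q.2 := hf.comp measurable_snd
  rw [stripMeasure, lintegral_prod _ hm.aemeasurable]
  simp only [lintegral_const, Measure.restrict_apply_univ, Real.volume_Ioo]
  rw [mul_comm]
  congr 2
  ring

/-- The kernel of the spheroid in the coordinates of the strip. -/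
noncomputable def pullKernel (R : ℝ) (p q : ℝ × ℝ) : ℝ :=
  (Prod.snd ⁻¹' Ioo (-R) R).indicator
    (fun q => symKernel R (prolateParam R p) (prolateParam R q)) q

theorem pullKernel_nonneg (R : ℝ) (p q : ℝ × ℝ) : 0 ≤ pullKernel R p q :=
  indicator_nonneg (fun _ _ => symKernel_nonneg _ _ _) _

theorem measurable_pullKernel (R : ℝ) :
    Measurable fun z : (ℝ × ℝ) × (ℝ × ℝ) => pullKernel R z.1 z.2 := by
  have hΦ := (continuous_prolateParam R).measurable
  have hG : Measurable fun z : (ℝ × ℝ) × (ℝ × ℝ) => (prolateParam R z.1, prolateParam R z.2) :=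
    (hΦ.comp measurable_fst).prodMk (hΦ.comp measurable_snd)
  have hS : MeasurableSet (Prod.snd ⁻¹' (Prod.snd ⁻¹' Ioo (-R) R) : Set ((ℝ × ℝ) × (ℝ × ℝ))) :=
    measurable_snd (measurable_snd measurableSet_Ioo)
  have e : (fun z : (ℝ × ℝ) × (ℝ × ℝ) => pullKernel R z.1 z.2)
      = (Prod.snd ⁻¹' (Prod.snd ⁻¹' Ioo (-R) R)).indicator
        fun z => symKernel R (prolateParam R z.1) (prolateParam R z.2) := by
    funext z
    by_cases hz : z.2 ∈ Prod.snd ⁻¹' Ioo (-R) R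
    · rw [pullKernel, indicator_of_mem hz, indicator_of_mem (mem_preimage.2 hz)]
    · rw [pullKernel, indicator_of_notMem hz, indicator_of_notMem (fun h => hz (mem_preimage.1 h))]
  rw [e]
  refine Measurable.indicator ?_ hS
  have h := Measurable.comp (g := fun w : E3 × E3 => symKernel R w.1 w.2)
    (measurable_symKernel R) hG
  simpa only [Function.comp_def] using h

theorem measurable_symKernel_right (R : ℝ) (x : E3) : Measurable (symKernel R x) :=
  Measurable.of_uncurry_left (f := symKernel R) (measurable_symKernel R)

theorem measurable_cylKernel_right (p : ℝ × ℝ) : Measurable (cylKernel p) :=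
  Measurable.of_uncurry_left (f := cylKernel) measurable_cylKernel

theorem measurable_pullKernel_right (R : ℝ) (p : ℝ × ℝ) : Measurable (pullKernel R p) :=
  Measurable.of_uncurry_left (f := pullKernel R) (measurable_pullKernel R)

theorem lintegral_pullKernel_le {R : ℝ} (hR : 1 ≤ R) {p : ℝ × ℝ} (hp : p ∈ cylinderDomain R) :
    ∫⁻ q, ENNReal.ofReal (pullKernel R p q) ∂stripMeasure ≤ ENNReal.ofReal (1 / 2) := by
  refine le_trans (le_of_eq ?_) (lintegral_symKernel_le hR (prolateForm_prolateParam hp))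
  rw [lintegral_coneMeasure R (measurable_symKernel_right R _).ennreal_ofReal, volume_restrict_cylinderDomain, ← lintegral_indicator (measurable_snd measurableSet_Ioo)]
  refine lintegral_congr fun q => ?_
  by_cases hq : q ∈ Prod.snd ⁻¹' Ioo (-R) R
  · simp only [pullKernel, indicator_of_mem hq]
  · simp only [pullKernel, indicator_of_notMem hq, ENNReal.ofReal_zero]

theorem layerPotential_prolateParam (R : ℝ) {f : E3 → ℂ} (hf : Measurable f) (p : ℝ × ℝ) :
    layerPotential R f (prolateParam R p)
      = ∫ q, (pullKernel R p q : ℂ) * f (prolateParam R q) ∂stripMeasure := by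
  have hm : Measurable fun y => (symKernel R (prolateParam R p) y : ℂ) * f y :=
    (Complex.measurable_ofReal.comp (measurable_symKernel_right R _)).mul hf
  rw [layerPotential, coneMeasure, integral_map (continuous_prolateParam R).aemeasurable
    hm.aestronglyMeasurable, volume_restrict_cylinderDomain,
    ← integral_indicator (measurable_snd measurableSet_Ioo)]
  congr 1
  funext q
  by_cases hq : q ∈ Prod.snd ⁻¹' Ioo (-R) R
  · simp only [pullKernel, indicator_of_mem hq]
  · simp only [pullKernel, indicator_of_notMem hq, Complex.ofReal_zero, zero_mul]

/-- Uniform decay for both kernels: the left side is at most a/ρ², and a(1 + τ²) ≤ ρ² + 4ρ². The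
numerators are at most 4, as 2 - 2cos for the cylinder and by the parallelogram law for the
spheroid. -/
theorem abs_mul_div_cube_le {a ρ τ : ℝ} (h4 : a ≤ 4) (ha : a ≤ ρ ^ 2) (ha0 : 0 ≤ a)
    (hτ : |τ| ≤ ρ) : |τ| * (a / ρ ^ 3) ≤ 5 * (1 + τ ^ 2)⁻¹ := by
  have hρ0 : 0 ≤ ρ := (abs_nonneg τ).trans hτ
  rcases hρ0.eq_or_lt with rfl | hρ
  · simp
    positivity
  · have hτ2 : τ ^ 2 ≤ ρ ^ 2 := by rw [← sq_abs]; gcongr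
    have h1 : |τ| * (a / ρ ^ 3) ≤ a / ρ ^ 2 := by
      rw [← mul_div_assoc, div_le_div_iff₀ (by positivity) (by positivity)]
      nlinarith [mul_le_mul_of_nonneg_right hτ (mul_nonneg ha0 (sq_nonneg ρ))]
    refine h1.trans ?_
    rw [← div_eq_mul_inv, div_le_div_iff₀ (by positivity) (by positivity)]
    nlinarith [mul_le_mul_of_nonneg_left hτ2 ha0, mul_le_mul_of_nonneg_right h4 (sq_nonneg ρ)]

theorem prolateForm_sub_le (R : ℝ) (x y : E3) :
    prolateForm R (x - y) ≤ 2 * prolateForm R x + 2 * prolateForm R y := by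
  have h := prolateForm_nonneg R (x + y)
  simp only [prolateForm, PiLp.add_apply, PiLp.sub_apply] at h ⊢
  have e : (x 0 - y 0) ^ 2 + (x 1 - y 1) ^ 2 + (x 2 - y 2) ^ 2 / R ^ 2
      = 2 * (x 0 ^ 2 + x 1 ^ 2 + x 2 ^ 2 / R ^ 2) + 2 * (y 0 ^ 2 + y 1 ^ 2 + y 2 ^ 2 / R ^ 2)
        - ((x 0 + y 0) ^ 2 + (x 1 + y 1) ^ 2 + (x 2 + y 2) ^ 2 / R ^ 2) := by ring
  linarith

theorem abs_mul_symKernel_le {R : ℝ} (hR : 1 ≤ R) {x y : E3} (hx : prolateForm R x = 1)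
    (hy : prolateForm R y = 1) :
    |x 2 - y 2| * symKernel R x y ≤ 5 / (8 * Real.pi) * (1 + (x 2 - y 2) ^ 2)⁻¹ := by
  have hpi := Real.pi_pos
  have h := abs_mul_div_cube_le (τ := x 2 - y 2) (ρ := ‖x - y‖)
    (by linarith [prolateForm_sub_le R x y] : prolateForm R (x - y) ≤ 4)
    (prolateForm_le_norm_sq hR _) (prolateForm_nonneg R _) (by
      refine abs_le_of_sq_le_sq ?_ (norm_nonneg _)
      rw [E3.norm_sq, PiLp.sub_apply, PiLp.sub_apply, PiLp.sub_apply]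
      nlinarith [sq_nonneg (x 0 - y 0), sq_nonneg (x 1 - y 1)])
  calc _ = 1 / (8 * Real.pi) * (|x 2 - y 2| * (prolateForm R (x - y) / ‖x - y‖ ^ 3)) := by
        rw [symKernel]; ring
    _ ≤ 1 / (8 * Real.pi) * (5 * (1 + (x 2 - y 2) ^ 2)⁻¹) := by gcongr
    _ = _ := by ring

theorem abs_mul_cylKernel_le (p q : ℝ × ℝ) :
    |p.2 - q.2| * cylKernel p q ≤ 5 / (8 * Real.pi) * (1 + (p.2 - q.2) ^ 2)⁻¹ := by
  have hpi := Real.pi_pos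
  have h0 := two_sub_two_cos_nonneg (p.1 - q.1)
  have h := abs_mul_div_cube_le (a := 2 - 2 * Real.cos (p.1 - q.1)) (τ := p.2 - q.2)
    (ρ := Real.sqrt (2 - 2 * Real.cos (p.1 - q.1) + (p.2 - q.2) ^ 2))
    (by linarith [Real.neg_one_le_cos (p.1 - q.1)])
    (by rw [Real.sq_sqrt (by positivity)]; linarith [sq_nonneg (p.2 - q.2)]) h0
    (Real.abs_le_sqrt (by linarith))
  calc _ = 1 / (8 * Real.pi) * (|p.2 - q.2| * ((2 - 2 * Real.cos (p.1 - q.1)) /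
        Real.sqrt (2 - 2 * Real.cos (p.1 - q.1) + (p.2 - q.2) ^ 2) ^ 3)) := by
        rw [cylKernel, cylProfile]; ring
    _ ≤ 1 / (8 * Real.pi) * (5 * (1 + (p.2 - q.2) ^ 2)⁻¹) := by gcongr
    _ = _ := by ring

theorem abs_mul_pullKernel_le {R : ℝ} (hR : 1 ≤ R) {p : ℝ × ℝ} (hp : p ∈ cylinderDomain R)
    {q : ℝ × ℝ} (hq : q.1 ∈ Ioo (-Real.pi) Real.pi) :
    |p.2 - q.2| * pullKernel R p q ≤ 5 / (8 * Real.pi) * (1 + (p.2 - q.2) ^ 2)⁻¹ := by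
  have hpi := Real.pi_pos
  by_cases hq2 : q ∈ Prod.snd ⁻¹' Ioo (-R) R
  · rw [pullKernel, indicator_of_mem hq2]
    exact abs_mul_symKernel_le hR (prolateForm_prolateParam hp)
      (prolateForm_prolateParam (p := q) ⟨hq, hq2⟩)
  · rw [pullKernel, indicator_of_notMem hq2, mul_zero]
    positivity

theorem lintegral_inv_one_add_sq :
    ∫⁻ t : ℝ, ENNReal.ofReal ((1 + t ^ 2)⁻¹) = ENNReal.ofReal Real.pi := by
  rw [← ofReal_integral_eq_lintegral_ofReal integrable_inv_one_add_sq
    (Eventually.of_forall fun t => by positivity), integral_univ_inv_one_add_sq]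

/-- The mass of a kernel with cubic decay at distance at least `s`. -/
theorem sq_lintegral_tail_le {k : ℝ × ℝ → ENNReal} {t : ℝ}
    (h1 : ∫⁻ q, k q ∂stripMeasure ≤ ENNReal.ofReal (1 / 2))
    (h2 : ∀ᵐ q ∂stripMeasure, ENNReal.ofReal |t - q.2| * k q
      ≤ ENNReal.ofReal (5 / (8 * Real.pi) * (1 + (t - q.2) ^ 2)⁻¹))
    {s : ℝ} {A : Set (ℝ × ℝ)} (hs : 0 ≤ s) (hA : ∀ q ∈ A, s ≤ |t - q.2|)
    (hAm : MeasurableSet A) :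
    (∫⁻ q in A, k q ∂stripMeasure) ^ 2 ≤ ENNReal.ofReal (20 * (1 + s ^ 2)⁻¹) := by
  have hpi := Real.pi_pos
  set X := ∫⁻ q in A, k q ∂stripMeasure
  have hX : X ≤ ENNReal.ofReal (1 / 2) := (setLIntegral_le_lintegral _ _).trans h1
  -- A Markov-type bound for the first moment; the constant is 5/(8π) · 2π · π, the last two factors
  -- being the angular length and ∫ dt/(1 + t²).
  have hsX : ENNReal.ofReal s * X ≤ ENNReal.ofReal (5 * Real.pi / 4) := by
    calc ENNReal.ofReal s * X = ∫⁻ q in A, ENNReal.ofReal s * k q ∂stripMeasure :=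
          (lintegral_const_mul' _ _ ENNReal.ofReal_ne_top).symm
      _ ≤ ∫⁻ q in A, ENNReal.ofReal (5 / (8 * Real.pi) * (1 + (t - q.2) ^ 2)⁻¹) ∂stripMeasure := by
          refine lintegral_mono_ae ?_
          filter_upwards [ae_restrict_of_ae h2, ae_restrict_mem hAm] with q hq hqA
          refine le_trans ?_ hq
          gcongr
          exact hA q hqA
      _ ≤ ∫⁻ q, ENNReal.ofReal (5 / (8 * Real.pi) * (1 + (t - q.2) ^ 2)⁻¹) ∂stripMeasure :=
          setLIntegral_le_lintegral _ _
      _ = ENNReal.ofReal (5 * Real.pi / 4) := by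
          rw [lintegral_stripMeasure_comp_snd (f := fun r =>
              ENNReal.ofReal (5 / (8 * Real.pi) * (1 + (t - r) ^ 2)⁻¹)) (by fun_prop),
            lintegral_sub_left_eq_self
              (fun r => ENNReal.ofReal (5 / (8 * Real.pi) * (1 + r ^ 2)⁻¹)) t]
          simp only [ENNReal.ofReal_mul (by positivity : 0 ≤ 5 / (8 * Real.pi))]
          rw [lintegral_const_mul' _ _ ENNReal.ofReal_ne_top, lintegral_inv_one_add_sq,
            ← ENNReal.ofReal_mul (by positivity), ← ENNReal.ofReal_mul (by positivity)]
          congr 1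
          field_simp
          norm_num
  have hXtop : X ≠ ⊤ := ne_top_of_le_ne_top ENNReal.ofReal_ne_top hX
  lift X to NNReal using hXtop with x
  have hx : (x : ℝ) ≤ 1 / 2 := by
    rw [← ENNReal.ofReal_coe_nnreal] at hX
    exact (ENNReal.ofReal_le_ofReal_iff (by norm_num)).1 hX
  have hsx : s * x ≤ 5 * Real.pi / 4 := by
    rw [← ENNReal.ofReal_coe_nnreal, ← ENNReal.ofReal_mul hs] at hsX
    exact (ENNReal.ofReal_le_ofReal_iff (by positivity)).1 hsX
  rw [← ENNReal.ofReal_coe_nnreal, ← ENNReal.ofReal_pow x.coe_nonneg]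
  refine ENNReal.ofReal_le_ofReal ?_
  rw [← div_eq_mul_inv, le_div_iff₀ (by positivity)]
  -- Together x ≤ 1/2 and sx ≤ 4 give x²(1 + s²) ≤ 1/4 + 16 ≤ 20.
  have h3 : s * x ≤ 4 := hsx.trans (by linarith [Real.pi_lt_d2])
  have hx0 : (0 : ℝ) ≤ x := x.2
  nlinarith [mul_nonneg hs hx0]

/-! ### The mass missing from the spheroid -/

/-- The mass by which the kernel of the spheroid falls short of that of the cylinder. -/
noncomputable def kernelDefect (R : ℝ) (p : ℝ × ℝ) : ENNReal :=
  ∫⁻ q, ENNReal.ofReal (cylKernel p q - pullKernel R p q) ∂stripMeasure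

theorem measurable_kernelDefect (R : ℝ) : Measurable (kernelDefect R) :=
  Measurable.lintegral_prod_right' (f := fun z : (ℝ × ℝ) × (ℝ × ℝ) =>
    ENNReal.ofReal (cylKernel z.1 z.2 - pullKernel R z.1 z.2))
    (measurable_cylKernel.sub (measurable_pullKernel R)).ennreal_ofReal

theorem ofReal_cylKernel_sub_pullKernel_le (R : ℝ) (p q : ℝ × ℝ) :
    ENNReal.ofReal (cylKernel p q - pullKernel R p q) ≤ ENNReal.ofReal (cylKernel p q) :=
  ENNReal.ofReal_le_ofReal (by linarith [pullKernel_nonneg R p q])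

theorem kernelDefect_le (R : ℝ) {p : ℝ × ℝ} (hp : p.1 ∈ Ioo (-Real.pi) Real.pi) :
    kernelDefect R p ≤ ENNReal.ofReal (1 / 2) :=
  (lintegral_mono fun q => ofReal_cylKernel_sub_pullKernel_le R p q).trans_eq
    (lintegral_cylKernel hp)

/-- Scheffé's argument: |k - c| = 2(c - k)⁺ + k - c, and the spheroid kernel k has mass at most 1/2,
the mass of the cylinder kernel c. Only the defect (c - k)⁺ has to be estimated, and c dominates it.
-/
theorem lintegral_abs_pullKernel_sub_cylKernel_le {R : ℝ} (hR : 1 ≤ R) {p : ℝ × ℝ}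
    (hp : p ∈ cylinderDomain R) :
    ∫⁻ q, ENNReal.ofReal |pullKernel R p q - cylKernel p q| ∂stripMeasure
      ≤ 2 * kernelDefect R p := by
  have hc := measurable_cylKernel_right p
  have hk := measurable_pullKernel_right R p
  have key : (∫⁻ q, ENNReal.ofReal |pullKernel R p q - cylKernel p q| ∂stripMeasure)
      + (∫⁻ q, ENNReal.ofReal (cylKernel p q) ∂stripMeasure)
      = 2 * kernelDefect R p + ∫⁻ q, ENNReal.ofReal (pullKernel R p q) ∂stripMeasure := by
    rw [kernelDefect, ← lintegral_const_mul' _ _ (by finiteness),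
      ← lintegral_add_right _ hc.ennreal_ofReal, ← lintegral_add_right _ hk.ennreal_ofReal]
    refine lintegral_congr fun q => ?_
    have h0 := cylKernel_nonneg p q
    have h1 := pullKernel_nonneg R p q
    rw [← ENNReal.ofReal_add (abs_nonneg _) h0]
    rcases le_total (cylKernel p q) (pullKernel R p q) with h | h
    · rw [ENNReal.ofReal_of_nonpos (by linarith : cylKernel p q - pullKernel R p q ≤ 0),
        abs_of_nonneg (by linarith)]
      simp
    · rw [abs_of_nonpos (by linarith), show (2 : ENNReal) = ENNReal.ofReal 2 by simp,
        ← ENNReal.ofReal_mul (by norm_num), ← ENNReal.ofReal_add (by linarith) h1]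
      congr 1
      ring
  rw [lintegral_cylKernel hp.1] at key
  have h := key.trans_le (add_le_add_right (lintegral_pullKernel_le hR hp) _)
  exact (ENNReal.add_le_add_iff_right ENNReal.ofReal_ne_top).1 h

theorem tendsto_pullKernel {p q : ℝ × ℝ} (h : Real.cos (p.1 - q.1) ≠ 1) :
    Tendsto (fun R => pullKernel R p q) atTop (𝓝 (cylKernel p q)) := by
  have hη : ∀ t : ℝ, Tendsto (fun R : ℝ => Real.sqrt (1 - t ^ 2 / R ^ 2)) atTop (𝓝 1) := fun t => by
    have : Tendsto (fun R : ℝ => 1 - t ^ 2 / R ^ 2) atTop (𝓝 (1 - 0)) :=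
      ((tendsto_pow_atTop two_ne_zero).const_div_atTop _).const_sub 1
    simpa using this.sqrt
  have hx : Tendsto (fun R => prolateParam R p 0 - prolateParam R q 0) atTop
      (𝓝 (Real.cos p.1 - Real.cos q.1)) := by
    simpa using ((hη p.2).mul_const (Real.cos p.1)).sub ((hη q.2).mul_const (Real.cos q.1))
  have hy : Tendsto (fun R => prolateParam R p 1 - prolateParam R q 1) atTop
      (𝓝 (Real.sin p.1 - Real.sin q.1)) := by
    simpa using ((hη p.2).mul_const (Real.sin p.1)).sub ((hη q.2).mul_const (Real.sin q.1))
  have hz : Tendsto (fun R : ℝ => (p.2 - q.2) ^ 2 / R ^ 2) atTop (𝓝 0) :=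
    (tendsto_pow_atTop two_ne_zero).const_div_atTop _
  have e : (Real.cos p.1 - Real.cos q.1) ^ 2 + (Real.sin p.1 - Real.sin q.1) ^ 2
      = 2 - 2 * Real.cos (p.1 - q.1) := by
    rw [Real.cos_sub]
    linear_combination Real.sin_sq_add_cos_sq p.1 + Real.sin_sq_add_cos_sq q.1
  have hpos : 0 < 2 - 2 * Real.cos (p.1 - q.1) := by
    linarith [lt_of_le_of_ne (Real.cos_le_one (p.1 - q.1)) h]
  have hQ := ((hx.pow 2).add (hy.pow 2)).add hz
  have hN := (((hx.pow 2).add (hy.pow 2)).add_const ((p.2 - q.2) ^ 2)).sqrt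
  rw [e] at hN hQ
  rw [add_zero] at hQ
  have hlim := (hQ.div (hN.pow 3) (by positivity)).const_mul (1 / (8 * Real.pi))
  refine hlim.congr' ?_
  -- Once R exceeds |q.2|, the point lies on the spheroid and the cut-off in `pullKernel` is
  -- inactive.
  filter_upwards [eventually_gt_atTop |q.2|] with R hR
  have hq : q ∈ Prod.snd ⁻¹' Ioo (-R) R := abs_lt.1 hR
  rw [pullKernel, indicator_of_mem hq, symKernel, ← Real.sqrt_sq (norm_nonneg _), E3.norm_sq]
  rfl

theorem tendsto_kernelDefect {p : ℝ × ℝ} (hp : p.1 ∈ Ioo (-Real.pi) Real.pi) :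
    Tendsto (fun R => kernelDefect R p) atTop (𝓝 0) := by
  have h := tendsto_lintegral_filter_of_dominated_convergence (μ := stripMeasure) (l := atTop)
    (F := fun R q => ENNReal.ofReal (cylKernel p q - pullKernel R p q)) (f := fun _ => 0)
    (fun q => ENNReal.ofReal (cylKernel p q))
    (Eventually.of_forall fun R => ((measurable_cylKernel_right p).sub
      (measurable_pullKernel_right R p)).ennreal_ofReal)
    (Eventually.of_forall fun R => Eventually.of_forall fun q =>
      ofReal_cylKernel_sub_pullKernel_le R p q)
    (by rw [lintegral_cylKernel hp]; exact ENNReal.ofReal_ne_top) (by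
      filter_upwards [ae_stripMeasure_mem, ae_stripMeasure_ne p.1] with q hq hqp
      have hc : Real.cos (p.1 - q.1) ≠ 1 := fun hc => by
        rw [Real.cos_eq_one_iff_of_lt_of_lt (by linarith [hp.1, hq.2]) (by linarith [hp.2, hq.1])]
          at hc
        exact hqp (by linarith)
      have h1 := (tendsto_pullKernel hc).const_sub (cylKernel p q)
      rw [sub_self] at h1
      simpa using ENNReal.tendsto_ofReal h1)
  simpa [kernelDefect] using h

theorem volume_cylinderDomain (L : ℝ) :
    volume (cylinderDomain L) = ENNReal.ofReal (2 * Real.pi) * ENNReal.ofReal (2 * L) := by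
  rw [cylinderDomain, Measure.volume_eq_prod, Measure.prod_prod, Real.volume_Ioo, Real.volume_Ioo]
  congr 2 <;> ring

/-- A second dominated convergence, now over the fixed bounded piece |t| < L with majorant 1/2; no
rate in R is needed. -/
theorem tendsto_lintegral_kernelDefect (L : ℝ) :
    Tendsto (fun R => ∫⁻ p in cylinderDomain L, kernelDefect R p) atTop (𝓝 0) := by
  have h := tendsto_lintegral_filter_of_dominated_convergence
    (μ := volume.restrict (cylinderDomain L)) (l := atTop)
    (F := fun R p => kernelDefect R p) (f := fun _ => 0) (fun _ => ENNReal.ofReal (1 / 2))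
    (Eventually.of_forall fun R => measurable_kernelDefect R)
    (Eventually.of_forall fun R => by
      filter_upwards [ae_restrict_mem (measurableSet_cylinderDomain L)] with p hp
      exact kernelDefect_le R hp.1)
    (by
      rw [lintegral_const, Measure.restrict_apply_univ, volume_cylinderDomain]
      finiteness) (by
      filter_upwards [ae_restrict_mem (measurableSet_cylinderDomain L)] with p hp
      exact tendsto_kernelDefect hp.1)
  simpa using h

/-! ### Approximate eigenfunctions -/

/-- The truncated plane wave `exp (i ξ x₃)`, `|x₃| < L`. -/
noncomputable def planeWave (ξ L : ℝ) (x : E3) : ℂ :=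
  {x : E3 | x 2 ∈ Ioo (-L) L}.indicator
    (fun x => Complex.exp ((ξ * x 2 : ℝ) * Complex.I)) x

theorem measurable_planeWave (ξ L : ℝ) : Measurable (planeWave ξ L) := by
  have h2 : Measurable fun x : E3 => x 2 := by fun_prop
  refine Measurable.indicator ?_ (h2 measurableSet_Ioo)
  exact (Complex.continuous_exp.comp (by fun_prop :
    Continuous fun x : E3 => ((ξ * x 2 : ℝ) : ℂ) * Complex.I)).measurable

theorem planeWave_of_mem (ξ : ℝ) {L : ℝ} {x : E3} (hx : x 2 ∈ Ioo (-L) L) :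
    planeWave ξ L x = Complex.exp ((ξ * x 2 : ℝ) * Complex.I) :=
  indicator_of_mem (s := {x : E3 | x 2 ∈ Ioo (-L) L}) hx _

theorem planeWave_of_notMem (ξ : ℝ) {L : ℝ} {x : E3} (hx : x 2 ∉ Ioo (-L) L) :
    planeWave ξ L x = 0 :=
  indicator_of_notMem (s := {x : E3 | x 2 ∈ Ioo (-L) L}) hx _

theorem enorm_exp_ofReal_mul_I (t : ℝ) : ‖Complex.exp ((t : ℝ) * Complex.I)‖ₑ = 1 := by
  rw [← ofReal_norm, Complex.norm_exp_ofReal_mul_I, ENNReal.ofReal_one]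

theorem lintegral_planeWave_sq (ξ : ℝ) {L R : ℝ} (hLR : L ≤ R) :
    ∫⁻ x, ‖planeWave ξ L x‖ₑ ^ 2 ∂coneMeasure R
      = ENNReal.ofReal (2 * Real.pi) * ENNReal.ofReal (2 * L) := by
  rw [lintegral_coneMeasure R ((measurable_planeWave ξ L).enorm.pow_const 2),
    ← volume_cylinderDomain, ← setLIntegral_one,
    ← lintegral_indicator (measurableSet_cylinderDomain R),
    ← lintegral_indicator (measurableSet_cylinderDomain L)]
  refine lintegral_congr fun p => ?_
  by_cases hp : p ∈ cylinderDomain L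
  · have hpR : p ∈ cylinderDomain R :=
      ⟨hp.1, Ioo_subset_Ioo (neg_le_neg hLR) hLR hp.2⟩
    rw [indicator_of_mem hp, indicator_of_mem hpR, planeWave_of_mem ξ (by simpa using hp.2),
      enorm_exp_ofReal_mul_I, one_pow]
  · rw [indicator_of_notMem hp]
    by_cases hpR : p ∈ cylinderDomain R
    · have : p.2 ∉ Ioo (-L) L := fun h => hp ⟨hpR.1, h⟩
      rw [indicator_of_mem hpR, planeWave_of_notMem ξ (by simpa using this)]
      simp
    · rw [indicator_of_notMem hpR]

theorem memLp_planeWave (ξ : ℝ) {L R : ℝ} (hLR : L ≤ R) :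
    MemLp (planeWave ξ L) 2 (coneMeasure R) :=
  memLp_two_of_lintegral (measurable_planeWave ξ L).aestronglyMeasurable
    (by rw [lintegral_planeWave_sq ξ hLR]; finiteness)

/-- The error of a truncated plane wave as an eigenfunction, at a point of its support. -/
theorem enorm_layerPotential_planeWave_sub_le {R : ℝ} (hR : 1 ≤ R) (ξ L : ℝ) {p : ℝ × ℝ}
    (hp : p ∈ cylinderDomain R) (hpL : p.2 ∈ Ioo (-L) L) :
    ‖layerPotential R (planeWave ξ L) (prolateParam R p)
        - (cylSymbol ξ : ℂ) * planeWave ξ L (prolateParam R p)‖ₑ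
      ≤ 2 * kernelDefect R p
        + ∫⁻ q in (Prod.snd ⁻¹' Ioo (-L) L)ᶜ, ENNReal.ofReal (cylKernel p q) ∂stripMeasure := by
  have hp2 : prolateParam R p 2 ∈ Ioo (-L) L := by simpa using hpL
  have hS : MeasurableSet (Prod.snd ⁻¹' Ioo (-L) L : Set (ℝ × ℝ))ᶜ :=
    (measurable_snd measurableSet_Ioo).compl
  have hk := measurable_pullKernel_right R p
  have hw : Measurable fun q => planeWave ξ L (prolateParam R q) :=
    (measurable_planeWave ξ L).comp (continuous_prolateParam R).measurable
  have hi : Integrable (fun q => (pullKernel R p q : ℂ) * planeWave ξ L (prolateParam R q))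
      stripMeasure := by
    refine ⟨((Complex.measurable_ofReal.comp hk).mul hw).aestronglyMeasurable, ?_⟩
    refine lt_of_le_of_lt (lintegral_mono fun q => ?_)
      ((lintegral_pullKernel_le hR hp).trans_lt ENNReal.ofReal_lt_top)
    rw [enorm_mul, ← ofReal_norm, Complex.norm_real, Real.norm_eq_abs,
      abs_of_nonneg (pullKernel_nonneg R p q)]
    refine mul_le_of_le_one_right' ?_
    by_cases hq : prolateParam R q 2 ∈ Ioo (-L) L
    · rw [planeWave_of_mem ξ hq, enorm_exp_ofReal_mul_I]
    · rw [planeWave_of_notMem ξ hq]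
      simp
  -- The eigenvalue term is replaced by the cylinder operator applied to the untruncated wave. For
  -- |q.2| < L the difference of the kernels remains, elsewhere only the cylinder kernel.
  rw [layerPotential_prolateParam R (measurable_planeWave ξ L), planeWave_of_mem ξ hp2,
    prolateParam_two, ← integral_cylKernel_mul_exp hp.1,
    ← integral_sub hi (integrable_cylKernel_mul_exp hp.1 ξ)]
  refine (enorm_integral_le_lintegral_enorm _).trans ?_
  refine le_trans ?_ (add_le_add_left (lintegral_abs_pullKernel_sub_cylKernel_le hR hp) _)
  have hd : Measurable fun q => ENNReal.ofReal |pullKernel R p q - cylKernel p q| :=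
    (hk.sub (measurable_cylKernel_right p)).abs.ennreal_ofReal
  rw [← lintegral_indicator hS, ← lintegral_add_left hd]
  refine lintegral_mono fun q => ?_
  by_cases hq : q ∈ Prod.snd ⁻¹' Ioo (-L) L
  · have hq2 : prolateParam R q 2 ∈ Ioo (-L) L := by simpa using hq
    rw [indicator_of_notMem (notMem_compl_iff.2 hq), add_zero, planeWave_of_mem ξ hq2,
      prolateParam_two, ← sub_mul, enorm_mul, enorm_exp_ofReal_mul_I, mul_one, ← ofReal_norm,
      ← Complex.ofReal_sub, Complex.norm_real, Real.norm_eq_abs]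
  · have hq2 : prolateParam R q 2 ∉ Ioo (-L) L := by simpa using hq
    rw [indicator_of_mem (mem_compl hq), planeWave_of_notMem ξ hq2, mul_zero, zero_sub, enorm_neg,
      enorm_mul, enorm_exp_ofReal_mul_I, mul_one, ← ofReal_norm, Complex.norm_real,
      Real.norm_eq_abs, abs_of_nonneg (cylKernel_nonneg p q)]
    exact le_add_self

/-- The potential of a truncated plane wave at a point outside its support. -/
theorem enorm_layerPotential_planeWave_le {R : ℝ} (ξ L : ℝ) {p : ℝ × ℝ} :
    ‖layerPotential R (planeWave ξ L) (prolateParam R p)‖ₑ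
      ≤ ∫⁻ q in Prod.snd ⁻¹' Ioo (-L) L, ENNReal.ofReal (pullKernel R p q) ∂stripMeasure := by
  rw [layerPotential_prolateParam R (measurable_planeWave ξ L),
    ← lintegral_indicator (measurable_snd measurableSet_Ioo)]
  refine (enorm_integral_le_lintegral_enorm _).trans (lintegral_mono fun q => ?_)
  by_cases hq : q ∈ Prod.snd ⁻¹' Ioo (-L) L
  · have hq2 : prolateParam R q 2 ∈ Ioo (-L) L := by simpa using hq
    rw [indicator_of_mem hq, planeWave_of_mem ξ hq2, enorm_mul, enorm_exp_ofReal_mul_I, mul_one,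
      ← ofReal_norm, Complex.norm_real, Real.norm_eq_abs, abs_of_nonneg (pullKernel_nonneg R p q)]
  · have hq2 : prolateParam R q 2 ∉ Ioo (-L) L := by simpa using hq
    rw [planeWave_of_notMem ξ hq2]
    simp

/-- The contribution of the truncation to the error. -/
noncomputable def truncationError (L t : ℝ) : ENNReal :=
  ENNReal.ofReal (20 * (1 + (t - L) ^ 2)⁻¹) + ENNReal.ofReal (20 * (1 + (t - -L) ^ 2)⁻¹)

theorem measurable_truncationError (L : ℝ) : Measurable (truncationError L) := by
  unfold truncationError
  fun_prop

theorem lintegral_truncationError (L : ℝ) :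
    ∫⁻ q, truncationError L q.2 ∂stripMeasure = ENNReal.ofReal (80 * Real.pi ^ 2) := by
  have hpi := Real.pi_pos
  have h : ∀ a : ℝ, ∫⁻ t : ℝ, ENNReal.ofReal (20 * (1 + (t - a) ^ 2)⁻¹)
      = ENNReal.ofReal (20 * Real.pi) := fun a => by
    rw [lintegral_sub_right_eq_self (fun t : ℝ => ENNReal.ofReal (20 * (1 + t ^ 2)⁻¹)) a]
    simp only [ENNReal.ofReal_mul (by norm_num : (0 : ℝ) ≤ 20)]
    rw [lintegral_const_mul' _ _ ENNReal.ofReal_ne_top, lintegral_inv_one_add_sq]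
  rw [lintegral_stripMeasure_comp_snd (measurable_truncationError L)]
  simp only [truncationError]
  rw [lintegral_add_left (by fun_prop), h, h, ← ENNReal.ofReal_add (by positivity) (by positivity),
    ← ENNReal.ofReal_mul (by positivity)]
  congr 1
  ring

/-- For |t| < L the error is the kernel defect plus a tail of the cylinder kernel; for |t| ≥ L the
wave vanishes and only a tail of the spheroid kernel is left. Each tail is governed by the distance
of t to the nearer of ±L. -/
theorem enorm_layerPotential_planeWave_sub_sq_le {R : ℝ} (hR : 1 ≤ R) (ξ L : ℝ)
    {p : ℝ × ℝ} (hp : p ∈ cylinderDomain R) :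
    ‖layerPotential R (planeWave ξ L) (prolateParam R p)
        - (cylSymbol ξ : ℂ) * planeWave ξ L (prolateParam R p)‖ₑ ^ 2
      ≤ 8 * (cylinderDomain L).indicator (kernelDefect R) p + 2 * truncationError L p.2 := by
  by_cases hpL : p.2 ∈ Ioo (-L) L
  · refine (pow_le_pow_left' (enorm_layerPotential_planeWave_sub_le hR ξ L hp hpL) 2).trans ?_
    refine (ENNReal.add_sq_le _ _).trans ?_
    rw [mul_add, indicator_of_mem (show p ∈ cylinderDomain L from ⟨hp.1, hpL⟩)]
    -- The squared defect is thereby at most the defect itself, so its L¹ convergence suffices.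
    have hD : kernelDefect R p ≤ 1 := (kernelDefect_le R hp.1).trans (by
      rw [← ENNReal.ofReal_one]
      exact ENNReal.ofReal_le_ofReal (by norm_num))
    refine add_le_add ?_ (mul_le_mul_right ?_ 2)
    · calc 2 * (2 * kernelDefect R p) ^ 2 = 8 * (kernelDefect R p * kernelDefect R p) := by ring
        _ ≤ 8 * (kernelDefect R p * 1) := by gcongr
        _ = _ := by rw [mul_one]
    · have hbound := fun s hs hA => sq_lintegral_tail_le (k := fun q => ENNReal.ofReal (cylKernel p q))
        (t := p.2) (lintegral_cylKernel hp.1).le (Eventually.of_forall fun q => by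
          rw [← ENNReal.ofReal_mul (abs_nonneg _)]
          exact ENNReal.ofReal_le_ofReal (abs_mul_cylKernel_le p q)) (s := s)
        (A := (Prod.snd ⁻¹' Ioo (-L) L)ᶜ) hs hA (measurable_snd measurableSet_Ioo).compl
      obtain ⟨h1, h2⟩ := hpL
      have hA : ∀ q ∈ (Prod.snd ⁻¹' Ioo (-L) L : Set (ℝ × ℝ))ᶜ, q.2 ≤ -L ∨ L ≤ q.2 := by
        intro q hq
        by_contra! hc
        exact hq hc
      rcases le_total 0 p.2 with h0 | h0
      · refine (hbound (L - p.2) (by linarith) fun q hq => ?_).trans ?_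
        · rcases hA q hq with h | h
          · rw [abs_of_nonneg] <;> linarith
          · rw [abs_of_nonpos] <;> linarith
        · rw [truncationError, ← neg_sq, neg_sub]
          exact le_self_add
      · refine (hbound (p.2 - -L) (by linarith) fun q hq => ?_).trans ?_
        · rcases hA q hq with h | h
          · rw [abs_of_nonneg] <;> linarith
          · rw [abs_of_nonpos] <;> linarith
        · exact le_add_self
  · have hp2 : prolateParam R p 2 ∉ Ioo (-L) L := by simpa using hpL
    rw [planeWave_of_notMem ξ hp2, mul_zero, sub_zero]
    refine (pow_le_pow_left' (enorm_layerPotential_planeWave_le ξ L) 2).trans ?_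
    refine le_trans ?_ (le_add_self (a := 2 * truncationError L p.2))
    refine le_trans ?_ (le_mul_of_one_le_left' one_le_two)
    have hbound := fun s hs hA => sq_lintegral_tail_le (k := fun q => ENNReal.ofReal (pullKernel R p q))
      (t := p.2) (lintegral_pullKernel_le hR hp) (by
        filter_upwards [ae_stripMeasure_mem] with q hq
        rw [← ENNReal.ofReal_mul (abs_nonneg _)]
        exact ENNReal.ofReal_le_ofReal (abs_mul_pullKernel_le hR hp hq)) (s := s)
      (A := Prod.snd ⁻¹' Ioo (-L) L) hs hA (measurable_snd measurableSet_Ioo)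
    have h : p.2 ≤ -L ∨ L ≤ p.2 := by
      by_contra! hc
      exact hpL hc
    rcases h with h | h
    · refine (hbound (-L - p.2) (by linarith) fun q hq => ?_).trans ?_
      · rw [abs_of_nonpos] <;> linarith [hq.1]
      · rw [truncationError, ← neg_sq (-L - p.2), neg_sub]
        exact le_add_self
    · refine (hbound (p.2 - L) (by linarith) fun q hq => ?_).trans ?_
      · rw [abs_of_nonneg] <;> linarith [hq.2]
      · exact le_self_add

/-- The squared truncation error decays like the inverse squared distance from the ends ±L and is
integrable in t. Its integral does not depend on L, whereas the squared norm of the wave grows like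
L. -/
theorem lintegral_layerPotential_planeWave_sub_sq_le {R : ℝ} (hR : 1 ≤ R) (ξ L : ℝ) :
    ∫⁻ x, ‖layerPotential R (planeWave ξ L) x - (cylSymbol ξ : ℂ) * planeWave ξ L x‖ₑ ^ 2
        ∂coneMeasure R
      ≤ 8 * (∫⁻ p in cylinderDomain L, kernelDefect R p) + ENNReal.ofReal (160 * Real.pi ^ 2) := by
  have hm : Measurable fun x =>
      ‖layerPotential R (planeWave ξ L) x - (cylSymbol ξ : ℂ) * planeWave ξ L x‖ₑ ^ 2 :=
    ((stronglyMeasurable_layerPotential R (measurable_planeWave ξ L).stronglyMeasurable).measurable.sub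
      ((measurable_planeWave ξ L).const_mul _)).enorm.pow_const 2
  have hD := (measurable_kernelDefect R).indicator (measurableSet_cylinderDomain L)
  rw [lintegral_coneMeasure R hm]
  refine (setLIntegral_mono' (measurableSet_cylinderDomain R) fun p hp =>
    enorm_layerPotential_planeWave_sub_sq_le hR ξ L hp).trans ?_
  rw [lintegral_add_left (hD.const_mul 8), lintegral_const_mul' _ _ (by finiteness),
    lintegral_const_mul' _ _ (by finiteness)]
  refine add_le_add (mul_le_mul_right ?_ 8) ?_
  · exact (setLIntegral_le_lintegral _ _).trans_eq
      (lintegral_indicator (measurableSet_cylinderDomain L) _)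
  · rw [volume_restrict_cylinderDomain]
    calc _ ≤ 2 * ∫⁻ q, truncationError L q.2 ∂stripMeasure := by
          gcongr
          exact Measure.restrict_le_self
      _ = _ := by
          rw [lintegral_truncationError, show (2 : ENNReal) = ENNReal.ofReal 2 by simp,
            ← ENNReal.ofReal_mul (by norm_num)]
          congr 1
          ring

/-- Long spheroids have spectrum close to every value of the symbol of the cylinder. -/
theorem eventually_exists_mem_spectrum_near (ξ : ℝ) {ε : ℝ} (hε : 0 < ε) (hεc : ε < cylSymbol ξ) :
    ∀ᶠ R in atTop, ∀ hR : 1 ≤ R, ∃ z ∈ spectrum ℂ (npOperator hR), ‖z - cylSymbol ξ‖ ≤ ε := by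
  have hpi := Real.pi_pos
  -- L makes ε² times the squared norm 4πL equal to the error bound: 160π² from the truncation and 8
  -- from a total defect at most 1, which holds for large R.
  set L : ℝ := (160 * Real.pi ^ 2 + 8) / (ε ^ 2 * (4 * Real.pi)) with hLdef
  have hL : 0 < L := by positivity
  have hLe : ε ^ 2 * (2 * Real.pi * (2 * L)) = 160 * Real.pi ^ 2 + 8 := by
    rw [hLdef]
    field_simp
    ring
  filter_upwards [(tendsto_lintegral_kernelDefect L).eventually (gt_mem_nhds one_pos),
    eventually_ge_atTop L] with R hRD hLR hR
  have hg := memLp_planeWave ξ hLR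
  set g := hg.toLp (planeWave ξ L) with hgdef
  have hgn : ‖g‖ₑ ^ 2 = ENNReal.ofReal (2 * Real.pi * (2 * L)) := by
    rw [enorm_toLp_sq, lintegral_planeWave_sq ξ hLR, ← ENNReal.ofReal_mul (by positivity)]
  have hg0 : g ≠ 0 := by
    intro h
    rw [h, enorm_zero] at hgn
    have : 0 < ENNReal.ofReal (2 * Real.pi * (2 * L)) := ENNReal.ofReal_pos.2 (by positivity)
    rw [← hgn] at this
    simp at this
  refine exists_mem_spectrum_npOperator_near hR hε.le hεc hg0 ?_
  have key : ‖symOperator hR g - (cylSymbol ξ : ℂ) • g‖ₑ ^ 2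
      ≤ ENNReal.ofReal (ε ^ 2) * ‖g‖ₑ ^ 2 := by
    rw [hgn, ← ENNReal.ofReal_mul (by positivity), hLe, Lp.enorm_sq_eq]
    have hae : ∀ᵐ x ∂coneMeasure R, (symOperator hR g - (cylSymbol ξ : ℂ) • g :
        Lp ℂ 2 (coneMeasure R)) x
        = layerPotential R (planeWave ξ L) x - (cylSymbol ξ : ℂ) * planeWave ξ L x := by
      filter_upwards [Lp.coeFn_sub (symOperator hR g) ((cylSymbol ξ : ℂ) • g),
        coeFn_symOperator hR g, Lp.coeFn_smul (cylSymbol ξ : ℂ) g, hg.coeFn_toLp] with x h1 h2 h3 h4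
      rw [h1, Pi.sub_apply, h2, h3, Pi.smul_apply, smul_eq_mul, hgdef, h4,
        layerPotential_congr R hg.coeFn_toLp]
    refine (lintegral_congr_ae (hae.mono fun x hx => by rw [hx])).trans_le ?_
    refine (lintegral_layerPotential_planeWave_sub_sq_le hR ξ L).trans ?_
    rw [ENNReal.ofReal_add (by positivity) (by norm_num), add_comm]
    refine add_le_add le_rfl ?_
    calc 8 * (∫⁻ p in cylinderDomain L, kernelDefect R p) ≤ 8 * 1 := by gcongr
      _ = _ := by simp
  have h := norm_sq_le_of_enorm_sq_le ENNReal.ofReal_ne_top key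
  rw [ENNReal.toReal_ofReal (by positivity), ← mul_pow] at h
  exact (sq_le_sq₀ (norm_nonneg _) (by positivity)).1 h

/-! ### The closure of the union of the spectra. -/

theorem theorem1p2 (R : ℕ → ℝ) (hR : ∀ j, 1 ≤ R j) (hlim : Tendsto R atTop atTop) :
    ∃ K : ∀ j, HHalf (prolateMeasure (R j)) →L[ℂ] HHalf (prolateMeasure (R j)),
      (∀ j, IsNPOperator (prolateMeasure (R j)) (prolateNormal (R j)) (K j)) ∧
        closure (⋃ j, spectrum ℂ (K j)) = Complex.ofReal '' Icc (0 : ℝ) (1 / 2) := by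
  refine ⟨fun j => npOperator (hR j), fun j => isNPOperator_npOperator (hR j), ?_⟩
  refine Subset.antisymm ?_ ?_
  · refine closure_minimal (iUnion_subset fun j => spectrum_npOperator_subset (hR j)) ?_
    exact (isCompact_Icc.image Complex.continuous_ofReal).isClosed
  · have hcl : Complex.ofReal '' Ioo (0 : ℝ) (1 / 2) ⊆ closure (⋃ j, spectrum ℂ (npOperator (hR j))) := by
      rintro _ ⟨c, hc, rfl⟩
      obtain ⟨ξ, rfl⟩ := exists_cylSymbol_eq hc
      rw [Metric.mem_closure_iff]
      intro δ hδ
      have hc0 := hc.1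
      -- Half the target value as a second bound on ε keeps the spectral point away from 0, where
      -- the spectra on L² and H^{1/2} are not compared.
      obtain ⟨j, hj⟩ := (hlim.eventually (eventually_exists_mem_spectrum_near ξ
        (ε := min (δ / 2) (cylSymbol ξ / 2)) (by positivity)
        ((min_le_right _ _).trans_lt (by linarith)))).exists
      obtain ⟨z, hz, hzc⟩ := hj (hR j)
      refine ⟨z, mem_iUnion.2 ⟨j, hz⟩, ?_⟩
      rw [dist_comm, dist_eq_norm]
      exact hzc.trans_lt ((min_le_left _ _).trans_lt (by linarith))
    rw [← closure_Ioo (by norm_num : (0 : ℝ) ≠ 1 / 2)]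
    exact (image_closure_subset_closure_image Complex.continuous_ofReal).trans
      (closure_minimal hcl isClosed_closure)
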